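/- Let $q$ be a prime power. Then the following two statements are equivalent: (i) for every positive integer $r$, every (finite) matroid of rank $r$ with no minor isomorphic to the uniform matroid $U_{2,q+2}$ has at most $$\binom{r}{2}_q = \frac{(q^r-1)(q^{r-1}-1)}{(q-1)(q^2-1)}$$ lines (a line being a flat of rank $2$); (ii) $q \le 5$. -/

import Mathlib

universe u

/-- The matroid `M` is isomorphic to the uniform matroid `U_{r,n}`: its ground set has exactly `n`
elements, and its independent sets are the subsets of the ground set with at most `r` elements. -/
def Matroid.IsUniform {α : Type*} (M : Matroid α) (r n : ℕ) : Prop :=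
  M.E.encard = n ∧ ∀ I ⊆ M.E, (M.Indep I ↔ I.encard ≤ r)

/-- `M` has a minor isomorphic to the uniform matroid `U_{r,n}`. -/
def Matroid.HasUniformMinor {α : Type*} (M : Matroid α) (r n : ℕ) : Prop :=
  ∃ N : Matroid α, N ≤m M ∧ N.IsUniform r n

/-- The set of lines (rank-2 flats) of the matroid `M`. -/
def Matroid.lines {α : Type*} (M : Matroid α) : Set (Set α) :=
  {L | M.IsFlat L ∧ M.eRk L = 2}

/-- The `q`-binomial coefficient `[r choose 2]_q`, as a rational number. It is meant for
`q ≥ 2` and `r ≥ 1`, where the denominator is nonzero and `r - 1` is a true subtraction. -/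
def qBinomTwo (q r : ℕ) : ℚ :=
  (((q : ℚ) ^ r - 1) * ((q : ℚ) ^ (r - 1) - 1)) / (((q : ℚ) - 1) * ((q : ℚ) ^ 2 - 1))

/-- The conjecture for a fixed `q`: for each positive integer `r`, every (finite) matroid of rank
`r` with no `U_{2,q+2}`-minor has at most `[r choose 2]_q` lines. For finite `M` the set of lines
is finite, so that `Set.ncard` is its number of elements. -/
def BoninConjecture (q : ℕ) : Prop :=
  ∀ (r : ℕ), 0 < r → ∀ (α : Type u) (M : Matroid α), M.Finite → M.eRank = r →
    ¬ M.HasUniformMinor 2 (q + 2) → (M.lines.ncard : ℚ) ≤ qBinomTwo q r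

/-!
The conjectured bound is what one gets by projecting from a point. Let `F` be a flat of rank `k` and
`G` a flat of rank `k + 1` above it. Sending a flat of rank `k + 1` (of rank `k + 2`) above `F` to
its join with `G` gives recursions for the numbers of these flats, with the solutions
`[j choose 1]_q` and `[j choose 2]_q`, provided that the fibres are small enough: at most `q` covers
of `F` other than `G` have the same join with `G`, as there is no `U_{2,q+2}`-minor
(`Matroid.card_between_le`), and at most `q ^ 2` flats of rank `k + 2` that avoid `G` should have the
same join `T` with `G`. The flats between `F` and `T` form a finite linear space with at most `q + 1`
lines through each point, so everything depends on whether in such a linear space at most `q ^ 2`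
lines avoid a given point `e`.

For `2 ≤ q ≤ 5` this is true (`IsLinearSpace.card_avoiding_le`). If some line has `q + 1` points, then
all lines meet it and counting is enough. If all lines have at most `min q 4` points, the
inequality `(t - 2) (T - t) ≥ 0` for the line sizes `t`, summed over the lines that avoid `e`, is
enough. There remains `q = 5` with a longest line `K` of five points. Then the points off `K` become
words of length five over five letters (`IsLinearSpace.Coordinates.word`): the letter of `x` at
position `c` is the line that joins `x` to the `c`-th point of `K`. Two of these words agree once if
the line of their points meets `K`, and nowhere if it misses `K`. The lines that miss `K` are disjoint,
so two points on each of them give a `Word.PairedCode`. More than `25` lines avoiding `e` force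
at least six lines that miss `K`, or five in an extremal configuration. Both are excluded by
properties of paired codes (`Word.PairedCode.not_extends`, `Word.PairedCode.false_of_five`): after
a normalization of four or three words, a short search, which the kernel runs on bit masks, finds
no example.

For prime powers `q ≥ 7` the bound fails in rank three, where it says that a linear space with at most
`q + 1` lines through each point has at most `q ^ 2 + q + 1` lines
(`IsLinearSpace.not_boninConjecture`). For a prime `p < q`, take the transversal design with `p + 1`
groups of size `p` and `p ^ 2` blocks that the field `ZMod p` gives, and fill each group with a linear
space on `p` points that has many lines, but at most `q + 1 - p` through each point
(`HasLinearSpace.not_boninConjecture`). In most cases this small space consists of two lines with a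
common point and of all pairs of points of different lines; Bertrand's postulate gives a suitable
`p` for all large `q`. For `q = 8` and `q = 13` all pairs of points serve as lines, for `q = 9` the
Fano plane does.
-/

open Finset

/-! ### Words of length five and the search for paired codes -/

/-- A word of length five over a five-letter alphabet. -/
abbrev Word := Fin 5 → Fin 5

namespace Word

/-- The number of positions in which two words agree. -/
def agr (v w : Word) : ℕ := #{i | v i = w i}

/-- A word as a 25-bit mask: bit `5 i + s` is set when the letter at position `i` is `s`. The number
of agreements of two words is the number of bits that their masks share. -/
def enc (w : Word) : ℕ :=
  2 ^ (w 0 : ℕ) ||| 2 ^ (5 + (w 1 : ℕ)) ||| 2 ^ (10 + (w 2 : ℕ)) ||| 2 ^ (15 + (w 3 : ℕ)) |||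
    2 ^ (20 + (w 4 : ℕ))

lemma agr_comm (v w : Word) : agr v w = agr w v := by
  simp only [agr, eq_comm]

lemma agr_self (w : Word) : agr w w = 5 := by simp [agr]

lemma agr_eq_zero {v w : Word} : agr v w = 0 ↔ ∀ i, v i ≠ w i := by
  simp [agr, Finset.card_eq_zero, Finset.filter_eq_empty_iff]

/-- Two words agree once if and only if they agree at exactly one position `c`. -/
lemma agr_eq_one {v w : Word} : agr v w = 1 ↔ ∃ c, ∀ i, v i = w i ↔ i = c := by
  rw [agr, Finset.card_eq_one]
  refine exists_congr fun c => ?_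
  rw [Finset.ext_iff]
  simp

lemma testBit_enc (w : Word) (k : ℕ) :
    (enc w).testBit k = true ↔ ∃ i : Fin 5, 5 * (i : ℕ) + w i = k := by
  simp only [enc, Nat.testBit_or, Nat.testBit_two_pow, Bool.or_eq_true, decide_eq_true_eq,
    Fin.exists_fin_succ]
  simp [or_assoc]

lemma testBit_enc_cell (w : Word) (c s : Fin 5) :
    (enc w).testBit (5 * c + s) = true ↔ w c = s := by
  rw [testBit_enc]
  constructor
  · rintro ⟨i, hi⟩
    have h1 : (i : ℕ) = c := by omega
    have h2 : i = c := Fin.ext h1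
    subst h2
    exact Fin.ext (by omega)
  · rintro rfl
    exact ⟨c, rfl⟩

lemma land_enc_of_agr_eq_zero {v w : Word} (h : agr v w = 0) : Nat.land (enc v) (enc w) = 0 := by
  change enc v &&& enc w = 0
  refine Nat.eq_of_testBit_eq fun k => ?_
  rw [Nat.testBit_and, Nat.zero_testBit, ← Bool.not_eq_true, Bool.and_eq_true, testBit_enc,
    testBit_enc]
  rintro ⟨⟨i, hi⟩, ⟨j, hj⟩⟩
  have hij : i = j := Fin.ext (by omega)
  subst hij
  exact agr_eq_zero.1 h i (Fin.ext (by omega))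

lemma land_enc_of_agr_eq_one {v w : Word} (h : agr v w = 1) :
    ∃ k, Nat.land (enc v) (enc w) = 2 ^ k := by
  obtain ⟨c, hc⟩ := agr_eq_one.1 h
  refine ⟨5 * c + v c, ?_⟩
  change enc v &&& enc w = _
  refine Nat.eq_of_testBit_eq fun k => ?_
  rw [Bool.eq_iff_iff, Nat.testBit_and, Nat.testBit_two_pow, Bool.and_eq_true, testBit_enc,
    testBit_enc, decide_eq_true_eq]
  constructor
  · rintro ⟨⟨i, hi⟩, ⟨j, hj⟩⟩
    have hij : i = j := Fin.ext (by omega)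
    subst hij
    have := (hc i).1 (Fin.ext (by omega))
    subst this
    exact hi
  · rintro rfl
    exact ⟨⟨c, rfl⟩, ⟨c, by rw [(hc c).2 rfl]⟩⟩

/-- The masks `f` and `h` share no bit. -/
def zeroAg (f h : ℕ) : Bool := Nat.beq (Nat.land f h) 0

/-- The masks `f` and `h` share exactly one bit: the common part `x` is nonzero and `x` and `x - 1`
share no bit. -/
def oneAg (f h : ℕ) : Bool :=
  Nat.rec false (fun n _ => Nat.beq (Nat.land (Nat.succ n) n) 0) (Nat.land f h)

lemma zeroAg_enc {v w : Word} (h : agr v w = 0) : zeroAg (enc v) (enc w) = true := by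
  rw [zeroAg, land_enc_of_agr_eq_zero h]; rfl

lemma oneAg_enc {v w : Word} (h : agr v w = 1) : oneAg (enc v) (enc w) = true := by
  obtain ⟨k, hk⟩ := land_enc_of_agr_eq_one h
  obtain ⟨n, hn⟩ := Nat.exists_eq_succ_of_ne_zero (pow_ne_zero k (two_ne_zero (α := ℕ)))
  rw [oneAg, hk, hn]
  change Nat.beq (Nat.land (Nat.succ n) n) 0 = true
  have h1 : n = 2 ^ k - 1 := by omega
  have h2 : Nat.land (Nat.succ n) n = 0 := by
    change n.succ &&& n = 0
    rw [← hn, h1, Nat.and_two_pow_sub_one_eq_mod, Nat.mod_self]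
  rw [h2]; rfl

lemma enc_injective : Function.Injective enc := by
  intro v w h
  funext c
  have := (testBit_enc_cell v c (v c)).2 rfl
  rw [h, testBit_enc_cell] at this
  exact this.symm

/-! The following list functions are written with recursors, which the kernel evaluates quickly. -/

/-- `List.filter`, by the recursor. -/
noncomputable def filt (p : ℕ → Bool) (l : List ℕ) : List ℕ :=
  List.rec [] (fun h _ t => cond (p h) (h :: t) t) l

/-- `List.any`, by the recursor. -/
noncomputable def anyL (p : ℕ → Bool) (l : List ℕ) : Bool :=
  List.rec false (fun h _ t => cond (p h) true t) l

lemma mem_filt {p : ℕ → Bool} {l : List ℕ} {x : ℕ} : x ∈ filt p l ↔ x ∈ l ∧ p x = true := by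
  induction l with
  | nil => simp [filt]
  | cons a l ih =>
    change x ∈ cond (p a) (a :: filt p l) (filt p l) ↔ _
    cases h : p a
    · simp only [cond_false, ih, List.mem_cons]
      constructor
      · tauto
      · rintro ⟨rfl | h1, h2⟩
        · simp [h] at h2
        · exact ⟨h1, h2⟩
    · simp only [cond_true, List.mem_cons, ih]
      constructor
      · rintro (rfl | ⟨h1, h2⟩)
        · exact ⟨Or.inl rfl, h⟩
        · exact ⟨Or.inr h1, h2⟩
      · tauto

lemma anyL_of_mem {p : ℕ → Bool} {l : List ℕ} {x : ℕ} (hx : x ∈ l) (h : p x = true) :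
    anyL p l = true := by
  induction l with
  | nil => simp at hx
  | cons a l ih =>
    change cond (p a) true (anyL p l) = true
    rcases List.mem_cons.1 hx with rfl | hx
    · simp [h]
    · simp [ih hx]

/-- Runs over the disjoint pairs `f`, `g` of masks in a list, `f` before `g`, and calls `next` on
the masks after `f` that share exactly one bit with both. -/
noncomputable def anyPair (next : List ℕ → List (ℕ × ℕ) → Bool) (l : List ℕ)
    (acc : List (ℕ × ℕ)) : Bool :=
  List.rec false (fun f cand r =>
    cond (anyL (fun g => next (filt (oneAg g) (filt (oneAg f) cand)) ((f, g) :: acc))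
      (filt (zeroAg f) cand)) true r) l

/-- Searches for `k` disjoint pairs in the list `l` of masks, with exactly one shared bit across
pairs, such that these pairs, put in front of `acc`, pass the test `leaf`. -/
noncomputable def searchPairs (leaf : List (ℕ × ℕ) → Bool) (k : ℕ) :
    List ℕ → List (ℕ × ℕ) → Bool :=
  Nat.rec (fun _ acc => leaf acc) (fun _ ih => anyPair ih) k

/-- A family of pairs of words: the two words of a pair agree nowhere, words of different pairs
agree exactly once. -/
structure PairedCode {J : Type*} (w : J × Bool → Word) : Prop where
  zero : ∀ j, agr (w (j, false)) (w (j, true)) = 0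
  one : ∀ p q, p.1 ≠ q.1 → agr (w p) (w q) = 1

section search
variable {J : Type*} {w : J × Bool → Word}

/-- The other member of the pair. -/
def flip (p : J × Bool) : J × Bool := (p.1, !p.2)

@[simp] lemma flip_fst (p : J × Bool) : (flip p).1 = p.1 := rfl

lemma eq_or_eq_flip {p q : J × Bool} (h : p.1 = q.1) : p = q ∨ p = flip q := by
  obtain ⟨j, b⟩ := p
  obtain ⟨j', b'⟩ := q
  simp only at h
  subst h
  cases b <;> cases b' <;> simp [flip]

lemma PairedCode.flip_zero (hw : PairedCode w) (p : J × Bool) : agr (w p) (w (flip p)) = 0 := by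
  obtain ⟨j, _ | _⟩ := p
  · exact hw.zero j
  · rw [agr_comm]; exact hw.zero j

lemma PairedCode.inj (hw : PairedCode w) {p q : J × Bool} (h : w p = w q) : p = q := by
  by_cases hj : p.1 = q.1
  · rcases eq_or_eq_flip hj with h1 | h1
    · exact h1
    · have := hw.flip_zero q
      rw [← h1, h, agr_self] at this
      omega
  · have := hw.one p q hj
    rw [h, agr_self] at this
    omega

/-- The masks of a word and of its partner. -/
def encPair (w : J × Bool → Word) (p : J × Bool) : ℕ × ℕ := (enc (w p), enc (w (flip p)))

/-- If the list of masks contains all words of the pairs that `L` does not list, the search finds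
these pairs, in some order. -/
lemma searchPairs_eq_true [DecidableEq J] (hw : PairedCode w) (leaf : List (ℕ × ℕ) → Bool)
    (hleaf : ∀ L : List (J × Bool), (L.map Prod.fst).Nodup → (∀ j, j ∈ L.map Prod.fst) →
      leaf (L.map (encPair w)) = true)
    (k : ℕ) (R : Finset J) (hR : #R = k) (cand : List ℕ)
    (hcand : ∀ p : J × Bool, p.1 ∈ R → enc (w p) ∈ cand)
    (L : List (J × Bool)) (hL : (L.map Prod.fst).Nodup)
    (hLR : ∀ j, j ∈ R ↔ j ∉ L.map Prod.fst) :
    searchPairs leaf k cand (L.map (encPair w)) = true := by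
  induction k generalizing R cand L with
  | zero =>
    refine hleaf L hL fun j => ?_
    by_contra h
    have := (hLR j).2 h
    rw [Finset.card_eq_zero.1 hR] at this
    simp at this
  | succ k ih =>
    change anyPair (searchPairs leaf k) cand _ = true
    induction cand with
    | nil =>
      obtain ⟨j, hj⟩ := Finset.card_pos.1 (by omega : 0 < #R)
      simpa using hcand (j, true) hj
    | cons f cand ihc =>
      change cond (anyL (fun g => searchPairs leaf k (filt (oneAg g) (filt (oneAg f) cand))
        ((f, g) :: L.map (encPair w))) (filt (zeroAg f) cand)) true
          (anyPair (searchPairs leaf k) cand _) = true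
      by_cases hf : ∃ p : J × Bool, p.1 ∈ R ∧ enc (w p) = f
      · obtain ⟨p, hpR, rfl⟩ := hf
        have hmem : ∀ q : J × Bool, q.1 ∈ R → q ≠ p → enc (w q) ∈ cand := by
          intro q hq hqp
          rcases List.mem_cons.1 (hcand q hq) with h | h
          · exact absurd (hw.inj (enc_injective h)) hqp
          · exact h
        have hfp : flip p ≠ p := by
          intro h
          have := congrArg Prod.snd h
          simp [flip] at this
        rw [anyL_of_mem (x := enc (w (flip p)))]
        · rfl
        · exact mem_filt.2 ⟨hmem _ hpR hfp, zeroAg_enc (hw.flip_zero p)⟩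
        · refine ih (R.erase p.1) (by rw [Finset.card_erase_of_mem hpR, hR]; rfl) _ ?_ (p :: L) ?_ ?_
          · intro q hq
            have hne := Finset.ne_of_mem_erase hq
            exact mem_filt.2 ⟨mem_filt.2 ⟨hmem q (Finset.mem_of_mem_erase hq)
              (fun h => hne (by rw [h])), oneAg_enc (hw.one _ _ hne.symm)⟩,
              oneAg_enc (hw.one _ _ (by simpa using hne.symm))⟩
          · simpa using ⟨by simpa using (hLR p.1).1 hpR, hL⟩
          · intro j
            rw [Finset.mem_erase, hLR]
            simp [not_or]
      · rw [ihc]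
        · simp
        · intro p hp
          rcases List.mem_cons.1 (hcand p hp) with h | h
          · exact absurd ⟨p, hp, h⟩ hf
          · exact h

end search

/-- The mask of the word with the given letters. -/
def mask (a b c d e : ℕ) : ℕ :=
  2 ^ a ||| 2 ^ (5 + b) ||| 2 ^ (10 + c) ||| 2 ^ (15 + d) ||| 2 ^ (20 + e)

/-- The masks of all words with letters below `n`. -/
def masks (n : ℕ) : List ℕ :=
  (List.range n).flatMap fun a => (List.range n).flatMap fun b => (List.range n).flatMap fun c =>
    (List.range n).flatMap fun d => (List.range n).map fun e => mask a b c d e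

lemma enc_mem_masks {n : ℕ} {w : Word} (h : ∀ i, (w i : ℕ) < n) : enc w ∈ masks n := by
  simp only [masks, List.mem_flatMap, List.mem_map, List.mem_range]
  exact ⟨w 0, h 0, w 1, h 1, w 2, h 2, w 3, h 3, w 4, h 4, rfl⟩

end Word

/-! ### Tests on paired codes and the exhaustive searches -/

namespace Word

section leaves
variable {J : Type*} {w : J × Bool → Word}

/-- The word `h` extends the family `w` of pairs: it agrees exactly once with both words of each
pair, except that there may be one pair with neither word of which it agrees. -/
structure Extends (w : J × Bool → Word) (h : Word) : Prop where
  one_or_zero : ∀ j, (∀ b, agr (w (j, b)) h = 1) ∨ (∀ b, agr (w (j, b)) h = 0)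
  unique : ∀ i j, (∀ b, agr (w (i, b)) h = 0) → (∀ b, agr (w (j, b)) h = 0) → i = j

/-- All letters occur at all positions, with the possible exception of one position. -/
def CoversButOne (w : J × Bool → Word) : Prop := ∃ c₀, ∀ c, c ≠ c₀ → ∀ s, ∃ p, w p c = s

/-- Tests on masks whether a word extends a list of pairs; the Boolean argument says whether a pair
with which the word does not agree is still allowed. -/
noncomputable def extendsPairs (l : List (ℕ × ℕ)) : Bool → ℕ → Bool :=
  List.rec (fun _ _ => true) (fun p _ ih z h => cond (oneAg p.1 h && oneAg p.2 h) (ih z h)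
    (z && zeroAg p.1 h && zeroAg p.2 h && ih false h)) l

/-- The union of the masks of a list of pairs. -/
noncomputable def unionPairs (l : List (ℕ × ℕ)) : ℕ :=
  List.rec 0 (fun p _ u => Nat.lor (Nat.lor p.1 p.2) u) l

/-- Tests on masks whether all letters occur at all positions but one. -/
def coversButOne (u : ℕ) : Bool :=
  (List.range 5).any fun c₀ => (List.range 5).all fun c =>
    Nat.beq c c₀ || Nat.beq (Nat.land (Nat.shiftRight u (5 * c)) 31) 31

/-- Tests whether one of the masks in `ext` extends the list of pairs, or the list covers all
positions but one. -/
noncomputable def extendsOrCovers (ext : List ℕ) (l : List (ℕ × ℕ)) : Bool :=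
  anyL (extendsPairs l true) ext || coversButOne (unionPairs l)

lemma forall_encPair {P : Word → Prop} {p : J × Bool} (h : ∀ b, P (w (p.1, b))) :
    P (w p) ∧ P (w (flip p)) := ⟨h p.2, h (!p.2)⟩

lemma Extends.extendsPairs_eq_true {h : Word} (hh : Extends w h) (L : List (J × Bool))
    (hL : (L.map Prod.fst).Nodup) (z : Bool)
    (hz : z = false → ∀ j ∈ L.map Prod.fst, ∀ b, agr (w (j, b)) h = 1) :
    extendsPairs (L.map (encPair w)) z (enc h) = true := by
  induction L generalizing z with
  | nil => rfl
  | cons p L ih =>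
    change cond (oneAg (enc (w p)) (enc h) && oneAg (enc (w (flip p))) (enc h))
      (extendsPairs (L.map (encPair w)) z (enc h))
      (z && zeroAg (enc (w p)) (enc h) && zeroAg (enc (w (flip p))) (enc h) &&
        extendsPairs (L.map (encPair w)) false (enc h)) = true
    rw [List.map_cons, List.nodup_cons] at hL
    have ih1 := ih hL.2 z (fun h1 j hj => hz h1 j (by simp at hj ⊢; tauto))
    by_cases h1 : ∀ b, agr (w (p.1, b)) h = 1
    · obtain ⟨h2, h3⟩ := forall_encPair (P := fun x => agr x h = 1) h1
      simp [oneAg_enc h2, oneAg_enc h3, ih1]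
    · have h0 := (hh.one_or_zero p.1).resolve_left h1
      obtain ⟨h2, h3⟩ := forall_encPair (P := fun x => agr x h = 0) h0
      have hzt : z = true := by
        by_contra hz'
        exact h1 (hz (by simpa using hz') p.1 (by simp))
      have hn : oneAg (enc (w p)) (enc h) = false := by
        rw [oneAg, land_enc_of_agr_eq_zero h2]; rfl
      have ih2 := ih hL.2 false (fun _ j hj => (hh.one_or_zero j).resolve_right
        (fun h4 => hL.1 (hh.unique _ _ h0 h4 ▸ hj)))
      simp [hn, hzt, zeroAg_enc h2, zeroAg_enc h3, ih2]

lemma testBit_unionPairs (L : List (J × Bool)) {p : J × Bool} (hp : p.1 ∈ L.map Prod.fst) {k : ℕ}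
    (hk : (enc (w p)).testBit k = true) :
    (unionPairs (L.map (encPair w))).testBit k = true := by
  induction L with
  | nil => simp at hp
  | cons q L ih =>
    change ((enc (w q) ||| enc (w (flip q))) ||| unionPairs (L.map (encPair w))).testBit k = true
    rw [Nat.testBit_or, Nat.testBit_or]
    rw [List.map_cons, List.mem_cons] at hp
    rcases hp with hp | hp
    · rcases eq_or_eq_flip hp with rfl | rfl <;> simp [hk]
    · simp [ih hp]

lemma CoversButOne.coversButOne_eq_true (hw : CoversButOne w) (L : List (J × Bool))
    (hL : ∀ j, j ∈ L.map Prod.fst) : coversButOne (unionPairs (L.map (encPair w))) = true := by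
  obtain ⟨c₀, hc⟩ := hw
  rw [coversButOne, List.any_eq_true]
  refine ⟨c₀, by simp, ?_⟩
  rw [List.all_eq_true]
  intro c hc5
  rw [List.mem_range] at hc5
  rw [Bool.or_eq_true]
  by_cases h : c = c₀
  · exact Or.inl (by simp [h])
  · right
    have : Nat.land (Nat.shiftRight (unionPairs (L.map (encPair w))) (5 * c)) 31 = 31 := by
      change (unionPairs (L.map (encPair w)) >>> (5 * c)) &&& (2 ^ 5 - 1) = 2 ^ 5 - 1
      refine Nat.eq_of_testBit_eq fun k => ?_
      rw [Nat.testBit_and, Nat.testBit_two_pow_sub_one, Nat.testBit_shiftRight]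
      by_cases hk : k < 5
      · obtain ⟨p, hp⟩ := hc ⟨c, hc5⟩ (fun h' => h (by rw [← h'])) ⟨k, hk⟩
        have := testBit_unionPairs L (hL p.1) ((testBit_enc_cell (w p) ⟨c, hc5⟩ ⟨k, hk⟩).2 hp)
        simpa [hk] using this
      · simp [hk]
    rw [this]
    rfl

lemma extendsOrCovers_eq_true (hw : (∃ h, Extends w h) ∨ CoversButOne w) (ext : List ℕ)
    (hext : ∀ h, Extends w h → enc h ∈ ext) (L : List (J × Bool))
    (hL : (L.map Prod.fst).Nodup) (hL' : ∀ j, j ∈ L.map Prod.fst) :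
    extendsOrCovers ext (L.map (encPair w)) = true := by
  rw [extendsOrCovers, Bool.or_eq_true]
  rcases hw with ⟨h, hh⟩ | hw
  · exact Or.inl (anyL_of_mem (hext h hh) (hh.extendsPairs_eq_true L hL _ (by simp)))
  · exact Or.inr (hw.coversButOne_eq_true L hL')

/-- The number of masks in a list of pairs that have the bit `k`. -/
noncomputable def countBit (l : List (ℕ × ℕ)) (k : ℕ) : ℕ :=
  List.rec 0 (fun p _ n => Nat.add
    (Nat.add (Nat.land (Nat.shiftRight p.1 k) 1) (Nat.land (Nat.shiftRight p.2 k) 1)) n) l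

/-- Tests whether the letter `0` occurs at most twice at each position. -/
noncomputable def zerosLeTwo (l : List (ℕ × ℕ)) : Bool :=
  (List.range 5).all fun c => Nat.ble (countBit l (5 * c)) 2

lemma land_shiftRight_enc (v : Word) (c : Fin 5) :
    Nat.land (Nat.shiftRight (enc v) (5 * c)) 1 = if v c = 0 then 1 else 0 := by
  change (enc v >>> (5 * (c : ℕ))) &&& 1 = _
  have h := testBit_enc_cell v c 0
  rw [Nat.and_one_is_mod, Nat.shiftRight_eq_div_pow, ← Nat.toNat_testBit]
  by_cases hv : v c = 0
  · simpa [hv] using h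
  · simpa [hv] using h

lemma countBit_encPair [Fintype J] [DecidableEq J] (c : Fin 5) (L : List (J × Bool)) :
    countBit (L.map (encPair w)) (5 * c) =
      ((L.map Prod.fst).map fun j => #{b : Bool | w (j, b) c = 0}).sum := by
  induction L with
  | nil => rfl
  | cons p L ih =>
    change (Nat.land (Nat.shiftRight (enc (w p)) (5 * c)) 1 +
      Nat.land (Nat.shiftRight (enc (w (flip p))) (5 * c)) 1) +
      countBit (L.map (encPair w)) (5 * c) = _
    rw [ih, land_shiftRight_enc, land_shiftRight_enc]
    simp only [List.map_cons, List.sum_cons]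
    congr 1
    rw [Finset.card_filter, Fintype.sum_bool]
    obtain ⟨j, _ | _⟩ := p
    · simp [flip, add_comm]
    · simp [flip]

lemma zerosLeTwo_eq_true [Fintype J] [DecidableEq J]
    (hw : ∀ c, #{p : J × Bool | w p c = 0} ≤ 2) (L : List (J × Bool))
    (hL : (L.map Prod.fst).Nodup) (hL' : ∀ j, j ∈ L.map Prod.fst) :
    zerosLeTwo (L.map (encPair w)) = true := by
  rw [zerosLeTwo, List.all_eq_true]
  intro c hc
  rw [List.mem_range] at hc
  rw [Nat.ble_eq]
  have h := countBit_encPair (w := w) ⟨c, hc⟩ L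
  simp only at h
  rw [h, ← List.sum_toFinset _ hL]
  have h2 : (L.map Prod.fst).toFinset = univ := by
    ext j; simpa using hL' j
  rw [h2]
  refine le_trans (le_of_eq ?_) (hw ⟨c, hc⟩)
  simp only [Finset.card_filter]
  rw [Fintype.sum_prod_type]

end leaves

/-- The search for six pairs, four of which have a word with letter `0` at position `0`. -/
noncomputable def searchFour : Bool :=
  (fun f₀ f₁ f₂ f₃ g₀ =>
    (fun base =>
      (fun P₁ P₂ P₃ C ext =>
        anyL (fun g₁ => anyL (fun g₂ => anyL (fun g₃ =>
          searchPairs (extendsOrCovers ext) 2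
            (filt (oneAg g₃) (filt (oneAg g₂) (filt (oneAg g₁) C)))
            [(f₃, g₃), (f₂, g₂), (f₁, g₁), (f₀, g₀)])
          (filt (oneAg g₂) (filt (oneAg g₁) P₃))) (filt (oneAg g₁) P₂)) P₁)
      (filt (oneAg f₃) (filt (oneAg f₂) (filt (zeroAg f₁) base)))
      (filt (oneAg f₃) (filt (oneAg f₁) (filt (zeroAg f₂) base)))
      (filt (oneAg f₁) (filt (oneAg f₂) (filt (zeroAg f₃) base)))
      (filt (oneAg f₁) (filt (oneAg f₂) (filt (oneAg f₃) base)))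
      (filt (fun h => (oneAg f₁ h || zeroAg f₁ h) && (oneAg f₂ h || zeroAg f₂ h) &&
        (oneAg f₃ h || zeroAg f₃ h)) (filt (extendsPairs [(f₀, g₀)] true) (masks 5))))
    (filt (oneAg f₀) (filt (oneAg g₀) (masks 5))))
  (mask 0 0 0 0 0) (mask 0 1 1 1 1) (mask 0 2 2 2 2) (mask 0 3 3 3 3) (mask 1 1 2 3 4)

lemma searchFour_eq_false : searchFour = false := by decide +kernel

/-- The search for six pairs over four letters, three of which have a word with letter `0` at
position `0`. -/
noncomputable def searchThree : Bool :=
  (fun f₀ f₁ f₂ g₀ =>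
    (fun base =>
      (fun P₁ P₂ C =>
        anyL (fun g₁ => anyL (fun g₂ =>
          searchPairs (fun _ => true) 3 (filt (oneAg g₂) (filt (oneAg g₁) C))
            [(f₂, g₂), (f₁, g₁), (f₀, g₀)])
          (filt (oneAg g₁) P₂)) P₁)
      (filt (oneAg f₂) (filt (zeroAg f₁) base))
      (filt (oneAg f₁) (filt (zeroAg f₂) base))
      (filt (oneAg f₁) (filt (oneAg f₂) base)))
    (filt (oneAg f₀) (filt (oneAg g₀) (masks 4))))
  (mask 0 0 0 0 0) (mask 0 1 1 1 1) (mask 0 2 2 2 2) (mask 1 1 2 3 3)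

lemma searchThree_eq_false : searchThree = false := by decide +kernel

/-- The search for five pairs of words that agree exactly once with the zero word; four of the pairs
have a word with letter `1` at position `0`. -/
noncomputable def searchFive : Bool :=
  (fun f₀ f₁ f₂ f₃ =>
    (fun base =>
      (fun P₀ P₁ P₂ P₃ C =>
        anyL (fun g₀ => anyL (fun g₁ => anyL (fun g₂ => anyL (fun g₃ =>
          searchPairs zerosLeTwo 1
            (filt (oneAg g₃) (filt (oneAg g₂) (filt (oneAg g₁) (filt (oneAg g₀) C))))
            [(f₃, g₃), (f₂, g₂), (f₁, g₁), (f₀, g₀)])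
          (filt (oneAg g₂) (filt (oneAg g₁) (filt (oneAg g₀) P₃))))
          (filt (oneAg g₁) (filt (oneAg g₀) P₂))) (filt (oneAg g₀) P₁)) P₀)
      (filt (oneAg f₃) (filt (oneAg f₂) (filt (oneAg f₁) (filt (zeroAg f₀) base))))
      (filt (oneAg f₃) (filt (oneAg f₂) (filt (oneAg f₀) (filt (zeroAg f₁) base))))
      (filt (oneAg f₃) (filt (oneAg f₁) (filt (oneAg f₀) (filt (zeroAg f₂) base))))
      (filt (oneAg f₂) (filt (oneAg f₁) (filt (oneAg f₀) (filt (zeroAg f₃) base))))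
      (filt (oneAg f₃) (filt (oneAg f₂) (filt (oneAg f₁) (filt (oneAg f₀) base)))))
    (filt (oneAg (mask 0 0 0 0 0)) (masks 5)))
  (mask 1 0 1 1 1) (mask 1 1 0 2 2) (mask 1 2 2 0 3) (mask 1 3 3 3 0)

lemma searchFive_eq_false : searchFive = false := by decide +kernel

end Word

/-! ### Soundness of the searches, and renaming of positions and letters -/

namespace Word

/-- The search finds all pairs that `L` does not list. -/
lemma searchPairs_compl_eq_true {J : Type*} [Fintype J] [DecidableEq J] {w : J × Bool → Word}
    (hw : PairedCode w) (leaf : List (ℕ × ℕ) → Bool)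
    (hleaf : ∀ L : List (J × Bool), (L.map Prod.fst).Nodup → (∀ j, j ∈ L.map Prod.fst) →
      leaf (L.map (encPair w)) = true)
    (k : ℕ) (L : List (J × Bool)) (hL : (L.map Prod.fst).Nodup)
    (hk : k + L.length = Fintype.card J) (cand : List ℕ)
    (hcand : ∀ p : J × Bool, p.1 ∉ L.map Prod.fst → enc (w p) ∈ cand) :
    searchPairs leaf k cand (L.map (encPair w)) = true := by
  refine searchPairs_eq_true hw leaf hleaf k (univ \ (L.map Prod.fst).toFinset) ?_ cand ?_ L hL ?_
  · rw [Finset.card_sdiff_of_subset (Finset.subset_univ _), List.toFinset_card_of_nodup hL,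
      List.length_map, Finset.card_univ]
    omega
  · intro p hp
    exact hcand p (by simpa using hp)
  · intro j
    simp

/-- The result of `searchFour` for codes that contain the words of its normal form. -/
lemma not_extends_of_searchFour {w : Fin 6 × Bool → Word} (hw : PairedCode w) {p₀ p₁ p₂ p₃ : Fin 6 × Bool}
    (hp : [p₃.1, p₂.1, p₁.1, p₀.1].Nodup)
    (h0 : w p₀ = ![0, 0, 0, 0, 0]) (h1 : w p₁ = ![0, 1, 1, 1, 1]) (h2 : w p₂ = ![0, 2, 2, 2, 2])
    (h3 : w p₃ = ![0, 3, 3, 3, 3]) (hg : w (flip p₀) = ![1, 1, 2, 3, 4]) :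
    ¬ ((∃ h, Extends w h) ∨ CoversButOne w) := by
  intro hbad
  have e0 : mask 0 0 0 0 0 = enc (w p₀) := by rw [h0]; rfl
  have e1 : mask 0 1 1 1 1 = enc (w p₁) := by rw [h1]; rfl
  have e2 : mask 0 2 2 2 2 = enc (w p₂) := by rw [h2]; rfl
  have e3 : mask 0 3 3 3 3 = enc (w p₃) := by rw [h3]; rfl
  have eg : mask 1 1 2 3 4 = enc (w (flip p₀)) := by rw [hg]; rfl
  have one : ∀ q r : Fin 6 × Bool, q.1 ≠ r.1 → oneAg (enc (w q)) (enc (w r)) = true :=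
    fun q r h => oneAg_enc (hw.one q r h)
  have zero : ∀ q : Fin 6 × Bool, zeroAg (enc (w q)) (enc (w (flip q))) = true :=
    fun q => zeroAg_enc (hw.flip_zero q)
  have hall : ∀ v : Word, enc v ∈ masks 5 := fun v => enc_mem_masks fun i => (v i).2
  have hp' := hp
  simp only [List.nodup_cons, List.mem_cons, List.not_mem_nil, not_or, or_false, not_false_eq_true,
    List.nodup_nil, and_true] at hp'
  obtain ⟨⟨h32, h31, h30⟩, ⟨h21, h20⟩, h10⟩ := hp'
  have : searchFour = true := by
    rw [searchFour, e0, e1, e2, e3, eg]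
    refine anyL_of_mem (x := enc (w (flip p₁))) ?_ (anyL_of_mem (x := enc (w (flip p₂))) ?_
      (anyL_of_mem (x := enc (w (flip p₃))) ?_ ?_))
    · simp only [mem_filt]
      exact ⟨⟨⟨⟨⟨hall _, one _ _ (Ne.symm h10)⟩, one _ _ (Ne.symm h10)⟩, zero _⟩, one _ _ h21⟩,
        one _ _ h31⟩
    · simp only [mem_filt]
      exact ⟨⟨⟨⟨⟨⟨hall _, one _ _ (Ne.symm h20)⟩, one _ _ (Ne.symm h20)⟩, zero _⟩,
        one _ _ (Ne.symm h21)⟩, one _ _ h32⟩, one _ _ (Ne.symm h21)⟩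
    · simp only [mem_filt]
      exact ⟨⟨⟨⟨⟨⟨⟨hall _, one _ _ (Ne.symm h30)⟩, one _ _ (Ne.symm h30)⟩, zero _⟩,
        one _ _ (Ne.symm h32)⟩, one _ _ (Ne.symm h31)⟩, one _ _ (Ne.symm h31)⟩,
        one _ _ (Ne.symm h32)⟩
    · refine searchPairs_compl_eq_true hw _ (extendsOrCovers_eq_true hbad _ ?_) 2 [p₃, p₂, p₁, p₀]
        hp rfl _ ?_
      · intro h hh
        have hor : ∀ q : Fin 6 × Bool,
            (oneAg (enc (w q)) (enc h) || zeroAg (enc (w q)) (enc h)) = true := by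
          intro q
          rw [Bool.or_eq_true]
          rcases hh.one_or_zero q.1 with h' | h'
          · exact Or.inl (oneAg_enc (h' q.2))
          · exact Or.inr (zeroAg_enc (h' q.2))
        simp only [mem_filt]
        refine ⟨⟨hall _, ?_⟩, by simp [hor]⟩
        exact hh.extendsPairs_eq_true [p₀] (by simp) true (by simp)
      · intro p hp
        simp only [List.map_cons, List.map_nil, List.mem_cons, List.not_mem_nil, not_or, or_false] at hp
        obtain ⟨k3, k2, k1, k0⟩ := hp
        simp only [mem_filt]
        exact ⟨⟨⟨⟨⟨⟨⟨⟨hall _, one _ _ (Ne.symm k0)⟩, one _ _ (Ne.symm k0)⟩, one _ _ (Ne.symm k3)⟩,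
          one _ _ (Ne.symm k2)⟩, one _ _ (Ne.symm k1)⟩, one _ _ (Ne.symm k1)⟩,
          one _ _ (Ne.symm k2)⟩, one _ _ (Ne.symm k3)⟩
  rw [searchFour_eq_false] at this
  exact absurd this (by simp)

/-- The result of `searchThree` for codes that contain the words of its normal form. -/
lemma false_of_searchThree {w : Fin 6 × Bool → Word} (hw : PairedCode w) {p₀ p₁ p₂ : Fin 6 × Bool}
    (hp : [p₂.1, p₁.1, p₀.1].Nodup)
    (h0 : w p₀ = ![0, 0, 0, 0, 0]) (h1 : w p₁ = ![0, 1, 1, 1, 1]) (h2 : w p₂ = ![0, 2, 2, 2, 2])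
    (hg : w (flip p₀) = ![1, 1, 2, 3, 3]) (h4 : ∀ p i, (w p i : ℕ) < 4) : False := by
  have e0 : mask 0 0 0 0 0 = enc (w p₀) := by rw [h0]; rfl
  have e1 : mask 0 1 1 1 1 = enc (w p₁) := by rw [h1]; rfl
  have e2 : mask 0 2 2 2 2 = enc (w p₂) := by rw [h2]; rfl
  have eg : mask 1 1 2 3 3 = enc (w (flip p₀)) := by rw [hg]; rfl
  have one : ∀ q r : Fin 6 × Bool, q.1 ≠ r.1 → oneAg (enc (w q)) (enc (w r)) = true :=
    fun q r h => oneAg_enc (hw.one q r h)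
  have zero : ∀ q : Fin 6 × Bool, zeroAg (enc (w q)) (enc (w (flip q))) = true :=
    fun q => zeroAg_enc (hw.flip_zero q)
  have hall : ∀ p, enc (w p) ∈ masks 4 := fun p => enc_mem_masks (h4 p)
  have hp' := hp
  simp only [List.nodup_cons, List.mem_cons, List.not_mem_nil, not_or, or_false, not_false_eq_true,
    List.nodup_nil, and_true] at hp'
  obtain ⟨⟨h21, h20⟩, h10⟩ := hp'
  have : searchThree = true := by
    rw [searchThree, e0, e1, e2, eg]
    refine anyL_of_mem (x := enc (w (flip p₁))) ?_ (anyL_of_mem (x := enc (w (flip p₂))) ?_ ?_)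
    · simp only [mem_filt]
      exact ⟨⟨⟨⟨hall _, one _ _ (Ne.symm h10)⟩, one _ _ (Ne.symm h10)⟩, zero _⟩, one _ _ h21⟩
    · simp only [mem_filt]
      exact ⟨⟨⟨⟨⟨hall _, one _ _ (Ne.symm h20)⟩, one _ _ (Ne.symm h20)⟩, zero _⟩,
        one _ _ (Ne.symm h21)⟩, one _ _ (Ne.symm h21)⟩
    · refine searchPairs_compl_eq_true hw _ (fun _ _ _ => rfl) 3 [p₂, p₁, p₀] hp rfl _ ?_
      intro p hp
      simp only [List.map_cons, List.map_nil, List.mem_cons, List.not_mem_nil, not_or, or_false] at hp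
      obtain ⟨k2, k1, k0⟩ := hp
      simp only [mem_filt]
      exact ⟨⟨⟨⟨⟨⟨hall _, one _ _ (Ne.symm k0)⟩, one _ _ (Ne.symm k0)⟩,
          one _ _ (Ne.symm k2)⟩, one _ _ (Ne.symm k1)⟩, one _ _ (Ne.symm k1)⟩,
          one _ _ (Ne.symm k2)⟩
  rw [searchThree_eq_false] at this
  exact absurd this (by simp)

/-- The result of `searchFive` for codes that contain the words of its normal form. -/
lemma false_of_searchFive {w : Fin 5 × Bool → Word} (hw : PairedCode w) {p₀ p₁ p₂ p₃ : Fin 5 × Bool}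
    (hp : [p₃.1, p₂.1, p₁.1, p₀.1].Nodup)
    (h0 : w p₀ = ![1, 0, 1, 1, 1]) (h1 : w p₁ = ![1, 1, 0, 2, 2]) (h2 : w p₂ = ![1, 2, 2, 0, 3])
    (h3 : w p₃ = ![1, 3, 3, 3, 0]) (he : ∀ p, agr 0 (w p) = 1)
    (hz : ∀ c, #{p | w p c = 0} ≤ 2) : False := by
  have e0 : mask 1 0 1 1 1 = enc (w p₀) := by rw [h0]; rfl
  have e1 : mask 1 1 0 2 2 = enc (w p₁) := by rw [h1]; rfl
  have e2 : mask 1 2 2 0 3 = enc (w p₂) := by rw [h2]; rfl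
  have e3 : mask 1 3 3 3 0 = enc (w p₃) := by rw [h3]; rfl
  have ee : mask 0 0 0 0 0 = enc 0 := rfl
  have one : ∀ q r : Fin 5 × Bool, q.1 ≠ r.1 → oneAg (enc (w q)) (enc (w r)) = true :=
    fun q r h => oneAg_enc (hw.one q r h)
  have zero : ∀ q : Fin 5 × Bool, zeroAg (enc (w q)) (enc (w (flip q))) = true :=
    fun q => zeroAg_enc (hw.flip_zero q)
  have hall : ∀ v : Word, enc v ∈ masks 5 := fun v => enc_mem_masks fun i => (v i).2
  have hone : ∀ p, oneAg (enc 0) (enc (w p)) = true := fun p => oneAg_enc (he p)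
  have hp' := hp
  simp only [List.nodup_cons, List.mem_cons, List.not_mem_nil, not_or, or_false, not_false_eq_true,
    List.nodup_nil, and_true] at hp'
  obtain ⟨⟨h32, h31, h30⟩, ⟨h21, h20⟩, h10⟩ := hp'
  have : searchFive = true := by
    rw [searchFive, e0, e1, e2, e3, ee]
    refine anyL_of_mem (x := enc (w (flip p₀))) ?_ (anyL_of_mem (x := enc (w (flip p₁))) ?_
      (anyL_of_mem (x := enc (w (flip p₂))) ?_ (anyL_of_mem (x := enc (w (flip p₃))) ?_ ?_)))
    · simp only [mem_filt]
      exact ⟨⟨⟨⟨⟨hall _, hone _⟩, zero _⟩, one _ _ h10⟩, one _ _ h20⟩, one _ _ h30⟩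
    · simp only [mem_filt]
      exact ⟨⟨⟨⟨⟨⟨hall _, hone _⟩, zero _⟩, one _ _ (Ne.symm h10)⟩, one _ _ h21⟩, one _ _ h31⟩,
        one _ _ (Ne.symm h10)⟩
    · simp only [mem_filt]
      exact ⟨⟨⟨⟨⟨⟨⟨hall _, hone _⟩, zero _⟩, one _ _ (Ne.symm h20)⟩, one _ _ (Ne.symm h21)⟩,
        one _ _ h32⟩, one _ _ (Ne.symm h20)⟩, one _ _ (Ne.symm h21)⟩
    · simp only [mem_filt]
      exact ⟨⟨⟨⟨⟨⟨⟨⟨hall _, hone _⟩, zero _⟩, one _ _ (Ne.symm h30)⟩, one _ _ (Ne.symm h31)⟩,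
        one _ _ (Ne.symm h32)⟩, one _ _ (Ne.symm h30)⟩, one _ _ (Ne.symm h31)⟩,
        one _ _ (Ne.symm h32)⟩
    · refine searchPairs_compl_eq_true hw _ (zerosLeTwo_eq_true hz) 1 [p₃, p₂, p₁, p₀] hp rfl _ ?_
      intro p hp
      simp only [List.map_cons, List.map_nil, List.mem_cons, List.not_mem_nil, not_or, or_false] at hp
      obtain ⟨k3, k2, k1, k0⟩ := hp
      simp only [mem_filt]
      exact ⟨⟨⟨⟨⟨⟨⟨⟨⟨hall _, hone _⟩, one _ _ (Ne.symm k0)⟩, one _ _ (Ne.symm k1)⟩,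
          one _ _ (Ne.symm k2)⟩, one _ _ (Ne.symm k3)⟩, one _ _ (Ne.symm k0)⟩,
          one _ _ (Ne.symm k1)⟩, one _ _ (Ne.symm k2)⟩, one _ _ (Ne.symm k3)⟩
  rw [searchFive_eq_false] at this
  exact absurd this (by simp)

/-- Permutes the positions of a word by `σ` and the letters at each position by `π`. -/
def permute (σ : Equiv.Perm (Fin 5)) (π : Fin 5 → Equiv.Perm (Fin 5)) (v : Word) : Word :=
  fun i => π i (v (σ i))

section permute
variable (σ : Equiv.Perm (Fin 5)) (π : Fin 5 → Equiv.Perm (Fin 5)) {J : Type*}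

@[simp] lemma agr_permute (v w : Word) : agr (permute σ π v) (permute σ π w) = agr v w := by
  refine Finset.card_equiv σ fun i => ?_
  simp [permute]

lemma PairedCode.map_permute {w : J × Bool → Word} (hw : PairedCode w) :
    PairedCode fun p => permute σ π (w p) :=
  ⟨fun j => by simpa using hw.zero j, fun p q h => by simpa using hw.one p q h⟩

lemma Extends.map_permute {w : J × Bool → Word} {h : Word} (hh : Extends w h) :
    Extends (fun p => permute σ π (w p)) (permute σ π h) :=
  ⟨by simpa using hh.one_or_zero, by simpa using hh.unique⟩

lemma CoversButOne.map_permute {w : J × Bool → Word} (hw : CoversButOne w) :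
    CoversButOne fun p => permute σ π (w p) := by
  obtain ⟨c₀, hc⟩ := hw
  refine ⟨σ.symm c₀, fun c hcc s => ?_⟩
  obtain ⟨p, hp⟩ := hc (σ c) (fun h => hcc (by simp [← h])) ((π c).symm s)
  exact ⟨p, by simp [Word.permute, hp]⟩

end permute

/-- Distinct letters can be renamed to any other distinct letters. -/
lemma exists_perm {k : ℕ} {u v : Fin k → Fin 5} (hu : Function.Injective u)
    (hv : Function.Injective v) : ∃ π : Equiv.Perm (Fin 5), ∀ i, π (u i) = v i := by
  classical
  let e := (Equiv.ofInjective u hu).symm.trans (Equiv.ofInjective v hv)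
  refine ⟨e.extendSubtype, fun i => ?_⟩
  rw [Equiv.extendSubtype_apply_of_mem e (u i) ⟨i, rfl⟩]
  simp [e]

end Word

/-! ### Paired codes cannot be extended -/

namespace Word

section counting
variable {J : Type*} [Fintype J] {w : J × Bool → Word}

/-- A word agrees five times with itself, not at all with its partner, and once with each other
word. -/
lemma PairedCode.sum_agr [DecidableEq J] (hw : PairedCode w) (p : J × Bool) :
    ∑ q, agr (w p) (w q) + 2 = 5 + 2 * Fintype.card J := by
  have h : ∀ j, ∑ b, agr (w p) (w (j, b)) = if j = p.1 then 5 else 2 := by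
    intro j
    split_ifs with hj
    · subst hj
      obtain ⟨j, _ | _⟩ := p
      · simp [agr_self, hw.zero]
      · simp [agr_self, agr_comm _ (w (j, false)), hw.zero]
    · simp [hw.one p (j, _) (Ne.symm hj)]
  rw [Fintype.sum_prod_type, Finset.sum_congr rfl (fun j _ => h j),
    ← Finset.add_sum_erase _ _ (Finset.mem_univ p.1)]
  rw [Finset.sum_congr rfl (g := fun _ => 2)
    (fun j hj => by rw [if_neg (Finset.ne_of_mem_erase hj)])]
  simp only [if_true, Finset.sum_const, Finset.card_erase_of_mem (Finset.mem_univ p.1),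
    Finset.card_univ, smul_eq_mul]
  have : 0 < Fintype.card J := Fintype.card_pos_iff.2 ⟨p.1⟩
  omega

/-- Counting pairs of words by the place where they agree. -/
lemma sum_sq_card_fiber (w : J × Bool → Word) :
    ∑ c, ∑ s, #{p | w p c = s} ^ 2 = ∑ p, ∑ q, agr (w p) (w q) := by
  have h : ∀ c, ∑ s, #{p | w p c = s} ^ 2 = ∑ p, ∑ q, if w p c = w q c then 1 else 0 := by
    intro c
    simp only [Finset.card_filter, sq, Finset.sum_mul_sum]
    rw [Finset.sum_comm]
    refine Finset.sum_congr rfl fun p _ => ?_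
    rw [Finset.sum_comm]
    refine Finset.sum_congr rfl fun q _ => ?_
    simp only [ite_mul, one_mul, zero_mul, Finset.sum_ite_eq, Finset.mem_univ, if_true]
    simp only [eq_comm]
  rw [Finset.sum_congr rfl fun c _ => h c, Finset.sum_comm]
  refine Finset.sum_congr rfl fun p _ => ?_
  rw [Finset.sum_comm]
  simp only [agr, Finset.card_filter]

lemma sum_card_fiber (w : J × Bool → Word) (c : Fin 5) :
    ∑ s, #{p | w p c = s} = 2 * Fintype.card J := by
  have := Finset.card_eq_sum_card_fiberwise (s := univ) (t := univ) (f := fun p => w p c)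
    (fun _ _ => by simp)
  rw [Finset.card_univ, Fintype.card_prod, Fintype.card_bool] at this
  omega

end counting

/-- Words that share a letter at one position belong to different pairs. -/
lemma PairedCode.fst_ne {J : Type*} {w : J × Bool → Word} (hw : PairedCode w) {p q : J × Bool}
    (hpq : p ≠ q) {c : Fin 5} (h : w p c = w q c) : p.1 ≠ q.1 := by
  intro h1
  rcases eq_or_eq_flip h1 with h2 | h2
  · exact hpq h2
  · have := hw.flip_zero q
    rw [← h2] at this
    exact agr_eq_zero.1 this c h.symm

lemma exists_fin_of_le_card {α : Type*} {s : Finset α} {k : ℕ} (h : k ≤ #s) :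
    ∃ p : Fin k → α, Function.Injective p ∧ ∀ i, p i ∈ s := by
  obtain ⟨t, hts, ht⟩ := Finset.exists_subset_card_eq h
  refine ⟨fun i => ((t.equivFinOfCardEq ht).symm i : α), fun i j hij => ?_, fun i => hts ?_⟩
  · exact (t.equivFinOfCardEq ht).symm.injective (Subtype.ext hij)
  · exact ((t.equivFinOfCardEq ht).symm i).2

/-- If words `p i` share a letter at position `c`, their letters at any other position differ. -/
lemma PairedCode.injective_of_ne {J : Type*} {w : J × Bool → Word} (hw : PairedCode w) {k : ℕ}
    {p : Fin k → J × Bool} (hp : Function.Injective p) {c s : Fin 5} (hs : ∀ i, w (p i) c = s)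
    {d : Fin 5} (hd : d ≠ c) : Function.Injective fun i => w (p i) d := by
  intro i j hij
  by_contra hne
  have h1 := hw.fst_ne (fun h => hne (hp h)) ((hs i).trans (hs j).symm)
  obtain ⟨m, hm⟩ := agr_eq_one.1 (hw.one _ _ h1)
  exact hd (((hm d).1 hij).trans ((hm c).1 ((hs i).trans (hs j).symm)).symm)

/-- The case of six pairs in which a letter occurs four times at one position. -/
lemma PairedCode.not_extends_of_four {w : Fin 6 × Bool → Word} (hw : PairedCode w) {c s : Fin 5}
    (h : 4 ≤ #{p | w p c = s}) : ¬ ((∃ h, Extends w h) ∨ CoversButOne w) := by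
  intro hbad
  obtain ⟨p, hp, hs⟩ := exists_fin_of_le_card h
  simp only [Finset.mem_filter, Finset.mem_univ, true_and] at hs
  have hfst : ∀ i j, i ≠ j → (p i).1 ≠ (p j).1 := fun i j hij =>
    hw.fst_ne (fun h => hij (hp h)) ((hs i).trans (hs j).symm)
  have hgc : w (flip (p 0)) c ≠ s := by
    intro h
    exact agr_eq_zero.1 (hw.flip_zero (p 0)) c ((hs 0).trans h.symm)
  -- The partner of the word `p 0` meets the three other words at three further positions.
  have hk : ∀ i : Fin 3, ∃ m, ∀ j, w (flip (p 0)) j = w (p i.succ) j ↔ j = m := fun i =>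
    agr_eq_one.1 (hw.one _ _ (by simpa using hfst 0 i.succ (Fin.succ_ne_zero i).symm))
  choose κ hκ using hk
  have hκc : ∀ i, κ i ≠ c := by
    intro i h
    exact hgc (((hκ i c).2 h.symm).trans (hs _))
  have hκinj : Function.Injective κ := by
    intro i j hij
    have h1 := (hκ i (κ i)).2 rfl
    have h2 := (hκ j (κ i)).2 hij
    exact Fin.succ_injective _ (hw.injective_of_ne hp hs (hκc i) (h1.symm.trans h2))
  -- Normal form: `c` becomes position `0`, the three meeting positions become `1`, `2`, `3`, and the
  -- four words get the constant letters `0`, `1`, `2`, `3` at all positions except position `0`.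
  obtain ⟨σ, hσ⟩ := exists_perm (u := fun i : Fin 4 => i.castSucc) (v := Fin.cons c κ)
    (Fin.castSucc_injective 4)
    (Fin.cons_injective_iff.2 ⟨fun ⟨i, hi⟩ => hκc i hi, hκinj⟩)
  have hσ0 : σ 0 = c := hσ 0
  have hσκ : ∀ i : Fin 3, σ i.succ.castSucc = κ i := fun i => by simpa using hσ i.succ
  have hπ : ∀ m, ∃ π : Equiv.Perm (Fin 5), (m = 0 → π s = 0 ∧ π (w (flip (p 0)) c) = 1) ∧
      (m ≠ 0 → ∀ i, π (w (p i) (σ m)) = i.castSucc) := by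
    intro m
    by_cases hm : m = 0
    · obtain ⟨π, hπ⟩ := exists_perm (u := ![s, w (flip (p 0)) c]) (v := ![0, 1])
        (by intro i j; fin_cases i <;> fin_cases j <;> simp [hgc, hgc.symm])
        (by decide)
      exact ⟨π, fun _ => ⟨hπ 0, hπ 1⟩, fun h => absurd hm h⟩
    · obtain ⟨π, hπ⟩ := exists_perm (hw.injective_of_ne hp hs (d := σ m)
        (fun h => hm (σ.injective (h.trans hσ0.symm)))) (Fin.castSucc_injective 4)
      exact ⟨π, fun h => absurd h hm, fun _ => hπ⟩
  choose π hπ0 hπ1 using hπ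
  have hrow : ∀ i : Fin 4, permute σ π (w (p i)) =
      ![0, i.castSucc, i.castSucc, i.castSucc, i.castSucc] := by
    intro i
    funext m
    by_cases hm : m = 0
    · subst hm
      simp [permute, hσ0, hs, (hπ0 0 rfl).1]
    · rw [permute, hπ1 m hm i]
      fin_cases m <;> first | exact absurd rfl hm | rfl
  have hg : permute σ π (w (flip (p 0))) = ![1, 1, 2, 3, 4] := by
    have h123 : ∀ i : Fin 3, permute σ π (w (flip (p 0))) i.succ.castSucc = i.succ.castSucc := by
      intro i
      have h := hπ1 i.succ.castSucc (fun h => by simpa using congrArg Fin.val h) i.succ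
      rw [permute]
      rw [hσκ] at h ⊢
      rw [(hκ i _).2 rfl, h]
    -- At position `4` the partner meets none of the four words.
    have h4 : permute σ π (w (flip (p 0))) 4 = 4 := by
      have hne : ∀ i : Fin 4, permute σ π (w (flip (p 0))) 4 ≠ i.castSucc := by
        intro i h
        rw [permute, ← hπ1 4 (by decide) i] at h
        have h' := (π 4).injective h
        rcases Fin.eq_zero_or_eq_succ i with rfl | ⟨j, rfl⟩
        · exact agr_eq_zero.1 (hw.flip_zero (p 0)) _ h'.symm
        · have := (hκ j _).1 h'
          rw [← hσκ] at this
          have := σ.injective this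
          revert this
          fin_cases j <;> decide
      generalize permute σ π (w (flip (p 0))) 4 = x at hne
      revert hne
      revert x
      decide
    funext m
    fin_cases m
    · simp [permute, hσ0, (hπ0 0 rfl).2]
    · exact h123 0
    · exact h123 1
    · exact h123 2
    · exact h4
  refine not_extends_of_searchFour (hw.map_permute σ π) (p₀ := p 0) (p₁ := p 1) (p₂ := p 2) (p₃ := p 3)
    ?_ (hrow 0) (hrow 1) (hrow 2) (hrow 3) hg ?_
  · simp [hfst]
  · rcases hbad with ⟨v, hv⟩ | hbad
    · exact Or.inl ⟨_, hv.map_permute σ π⟩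
    · exact Or.inr (hbad.map_permute σ π)

/-- The case of six pairs in which each letter at each position occurs not at all or three times. -/
lemma PairedCode.false_of_three {w : Fin 6 × Bool → Word} (hw : PairedCode w)
    (h3 : ∀ c s, #{p | w p c = s} = 0 ∨ #{p | w p c = s} = 3) : False := by
  have hsum := fun c => sum_card_fiber w c
  have hex : ∃ s, #{p | w p 0 = s} = 3 := by
    by_contra! h
    have := hsum 0
    rw [Finset.sum_eq_zero (fun s _ => (h3 0 s).resolve_right (h s))] at this
    simp at this
  -- Twelve words use four letters, three times each, so that one letter is not used.
  have hunused : ∀ c, ∃ u, ∀ p, w p c ≠ u := by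
    intro c
    by_contra! h
    have h' : ∀ s, #{p | w p c = s} = 3 := by
      intro s
      refine (h3 c s).resolve_left fun h0 => ?_
      obtain ⟨p, hp⟩ := h s
      rw [Finset.card_eq_zero, Finset.filter_eq_empty_iff] at h0
      exact h0 (Finset.mem_univ p) hp
    have := hsum c
    simp [h'] at this
  choose u hu using hunused
  obtain ⟨s, hs3⟩ := hex
  obtain ⟨p, hp, hs⟩ := exists_fin_of_le_card hs3.ge
  simp only [Finset.mem_filter, Finset.mem_univ, true_and] at hs
  have hfst : ∀ i j, i ≠ j → (p i).1 ≠ (p j).1 := fun i j hij =>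
    hw.fst_ne (fun h => hij (hp h)) ((hs i).trans (hs j).symm)
  have hgc : w (flip (p 0)) 0 ≠ s := by
    intro h
    exact agr_eq_zero.1 (hw.flip_zero (p 0)) 0 ((hs 0).trans h.symm)
  have hk : ∀ i : Fin 2, ∃ m, ∀ j, w (flip (p 0)) j = w (p i.succ) j ↔ j = m := fun i =>
    agr_eq_one.1 (hw.one _ _ (by simpa using hfst 0 i.succ (Fin.succ_ne_zero i).symm))
  choose κ hκ using hk
  have hκc : ∀ i, κ i ≠ 0 := by
    intro i h
    exact hgc (((hκ i 0).2 h.symm).trans (hs _))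
  have hκinj : Function.Injective κ := by
    intro i j hij
    have h1 := (hκ i (κ i)).2 rfl
    have h2 := (hκ j (κ i)).2 hij
    exact Fin.succ_injective _ (hw.injective_of_ne hp hs (hκc i) (h1.symm.trans h2))
  -- Normal form, as for four words; the unused letter becomes `4`.
  obtain ⟨σ, hσ⟩ := exists_perm (u := fun i : Fin 3 => i.castLE (by decide : 3 ≤ 5))
    (v := Fin.cons 0 κ) (Fin.castLE_injective (by decide))
    (Fin.cons_injective_iff.2 ⟨fun ⟨i, hi⟩ => hκc i hi, hκinj⟩)
  have hσ0 : σ 0 = 0 := hσ 0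
  have hσ1 : σ 1 = κ 0 := hσ 1
  have hσ2 : σ 2 = κ 1 := hσ 2
  have hπ : ∀ m, ∃ π : Equiv.Perm (Fin 5),
      (m = 0 → π s = 0 ∧ π (w (flip (p 0)) 0) = 1) ∧
      (m ≠ 0 → ∀ i : Fin 3, π (w (p i) (σ m)) = i.castLE (by decide)) ∧ π (u (σ m)) = 4 := by
    intro m
    by_cases hm : m = 0
    · subst hm
      have h1 : s ≠ u 0 := by rw [← hs 0]; exact hu 0 _
      have h2 := hu 0 (flip (p 0))
      obtain ⟨π, hπ⟩ := exists_perm (u := ![s, w (flip (p 0)) 0, u 0]) (v := ![0, 1, 4])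
        (by intro i j; fin_cases i <;> fin_cases j <;> simp [hgc, hgc.symm, h1, h1.symm, h2, h2.symm])
        (by decide)
      exact ⟨π, fun _ => ⟨hπ 0, hπ 1⟩, fun h => absurd rfl h, by rw [hσ0]; exact hπ 2⟩
    · have hinj := hw.injective_of_ne hp hs (d := σ m)
        (fun h => hm (σ.injective (h.trans hσ0.symm)))
      obtain ⟨π, hπ⟩ := exists_perm (u := Fin.cons (u (σ m)) fun i => w (p i) (σ m))
        (v := ![4, 0, 1, 2])
        (Fin.cons_injective_iff.2 ⟨fun ⟨i, hi⟩ => hu _ _ hi, hinj⟩) (by decide)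
      refine ⟨π, fun h => absurd h hm, fun _ i => ?_, by simpa using hπ 0⟩
      have := hπ i.succ
      rw [Fin.cons_succ] at this
      rw [this]
      fin_cases i <;> rfl
  choose π hπ0 hπ1 hπ4 using hπ
  have hrow : ∀ i : Fin 3, permute σ π (w (p i)) =
      ![0, i.castLE (by decide), i.castLE (by decide), i.castLE (by decide),
        i.castLE (by decide)] := by
    intro i
    funext m
    by_cases hm : m = 0
    · subst hm
      simp [permute, hσ0, hs, (hπ0 0 rfl).1]
    · rw [permute, hπ1 m hm i]
      fin_cases m <;> first | exact absurd rfl hm | rfl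
  have hne4 : ∀ q m, permute σ π (w q) m ≠ 4 := by
    intro q m h
    rw [permute, ← hπ4 m] at h
    exact hu _ _ ((π m).injective h)
  have hg : permute σ π (w (flip (p 0))) = ![1, 1, 2, 3, 3] := by
    have h3' : ∀ m, m ≠ 0 → m ≠ 1 → m ≠ 2 → permute σ π (w (flip (p 0))) m = 3 := by
      intro m hm0 hm1 hm2
      have hne : ∀ i : Fin 3, permute σ π (w (flip (p 0))) m ≠ i.castLE (by decide) := by
        intro i h
        rw [permute, ← hπ1 m hm0 i] at h
        have h' := (π m).injective h
        rcases Fin.eq_zero_or_eq_succ i with rfl | ⟨j, rfl⟩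
        · exact agr_eq_zero.1 (hw.flip_zero (p 0)) _ h'.symm
        · have := (hκ j _).1 h'
          fin_cases j
          · exact hm1 (σ.injective (this.trans hσ1.symm))
          · exact hm2 (σ.injective (this.trans hσ2.symm))
      have h4 := hne4 (flip (p 0)) m
      generalize permute σ π (w (flip (p 0))) m = x at hne h4
      revert hne h4
      revert x
      decide
    have h1 := hπ1 1 (by decide) 1
    have h2 := hπ1 2 (by decide) 2
    have hκ0 : w (flip (p 0)) (κ 0) = w (p 1) (κ 0) := (hκ 0 _).2 rfl
    have hκ1 : w (flip (p 0)) (κ 1) = w (p 2) (κ 1) := (hκ 1 _).2 rfl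
    funext m
    fin_cases m
    · simp [permute, hσ0, (hπ0 0 rfl).2]
    · simp only [permute, Fin.mk_one]
      rw [hσ1, hκ0, ← hσ1, h1]
      rfl
    · change π 2 (w (flip (p 0)) (σ 2)) = 2
      rw [hσ2, hκ1, ← hσ2, h2]
      rfl
    · exact h3' 3 (by decide) (by decide) (by decide)
    · exact h3' 4 (by decide) (by decide) (by decide)
  refine false_of_searchThree (hw.map_permute σ π) (p₀ := p 0) (p₁ := p 1) (p₂ := p 2)
    (by simp [hfst]) (hrow 0) (hrow 1) (hrow 2) hg ?_
  intro q m
  have := hne4 q m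
  generalize permute σ π (w q) m = x at this
  revert this x
  decide

/-- Six pairs cannot be extended, and there are at least two positions at which some letter is
missing. -/
theorem PairedCode.not_extends {w : Fin 6 × Bool → Word} (hw : PairedCode w) :
    ¬ ((∃ h, Extends w h) ∨ CoversButOne w) := by
  by_cases h4 : ∃ c s, 4 ≤ #{p | w p c = s}
  · obtain ⟨c, s, h⟩ := h4
    exact hw.not_extends_of_four h
  · exfalso
    push Not at h4
    refine hw.false_of_three ?_
    -- The squares of the letter counts sum to `12 * 15`, and the counts to `12` at each of the five
    -- positions, so counts of at most `3` have to be `0` or `3`.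
    have h180 := sum_sq_card_fiber w
    have hag : ∀ p, ∑ q, agr (w p) (w q) = 15 := by
      intro p
      have := hw.sum_agr p
      simp at this
      omega
    simp only [hag] at h180
    have hle : ∀ c s, #{p | w p c = s} ^ 2 ≤ 3 * #{p | w p c = s} := by
      intro c s
      have := h4 c s
      nlinarith
    have hlec : ∀ c, ∑ s, #{p | w p c = s} ^ 2 ≤ ∑ s, 3 * #{p | w p c = s} := fun c =>
      Finset.sum_le_sum fun s _ => hle c s
    have h36 : ∀ c, ∑ s, 3 * #{p | w p c = s} = 36 := by
      intro c
      rw [← Finset.mul_sum, sum_card_fiber]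
      simp
    have heq : ∀ c, ∑ s, #{p | w p c = s} ^ 2 = ∑ s, 3 * #{p | w p c = s} := by
      have := (Finset.sum_eq_sum_iff_of_le (s := univ) fun c _ => hlec c).1
        (by rw [h180]; simp [h36])
      exact fun c => this c (Finset.mem_univ c)
    intro c s
    have := (Finset.sum_eq_sum_iff_of_le (s := univ) fun s _ => hle c s).1 (heq c) s
      (Finset.mem_univ s)
    rcases Nat.eq_zero_or_pos #{p | w p c = s} with h0 | h0
    · exact Or.inl h0
    · right
      nlinarith

/-- There are no five pairs of words that agree exactly once with a given word `e`, such that all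
letters occur at all positions and the letter of `e` at most twice at each position. -/
theorem PairedCode.false_of_five {w : Fin 5 × Bool → Word} (hw : PairedCode w) {e : Word}
    (he : ∀ p, agr e (w p) = 1) (hz : ∀ c, #{p | w p c = e c} ≤ 2)
    (hs : ∀ c s, s ≠ e c → ∃ p, w p c = s) : False := by
  -- Some letter, different from that of `e`, occurs four times at some position.
  have h4 : ∃ c s, s ≠ e c ∧ 4 ≤ #{p | w p c = s} := by
    by_contra! h4
    -- Otherwise the letter counts at each position are `2` for the letter of `e`, and between `1` and
    -- `3` for the others, with square sum at most `24`; the square sum over all positions is `130`.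
    have h130 := sum_sq_card_fiber w
    have hag : ∀ p, ∑ q, agr (w p) (w q) = 13 := by
      intro p
      have := hw.sum_agr p
      simp at this
      omega
    simp only [hag] at h130
    simp only [Finset.sum_const, Finset.card_univ, Fintype.card_prod, Fintype.card_fin,
      Fintype.card_bool, smul_eq_mul] at h130
    have h2 : ∑ c, #{p | w p c = e c} = 10 := by
      have : ∑ c, #{p | w p c = e c} = ∑ p, agr e (w p) := by
        simp only [Finset.card_filter, agr]
        rw [Finset.sum_comm]
        simp only [eq_comm]
      rw [this]
      simp [he]
    have hcol : ∀ c, ∑ s, #{p | w p c = s} ^ 2 ≤ 24 := by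
      intro c
      have hsum := sum_card_fiber w c
      rw [← Finset.add_sum_erase _ _ (Finset.mem_univ (e c))] at hsum ⊢
      have h2c : #{p | w p c = e c} = 2 := by
        have := (Finset.sum_eq_sum_iff_of_le (s := univ) fun c _ => hz c).1 (by rw [h2]; rfl)
        exact this c (Finset.mem_univ c)
      rw [h2c] at hsum ⊢
      have hle : ∀ s ∈ univ.erase (e c), #{p | w p c = s} ^ 2 + 3 ≤ 4 * #{p | w p c = s} := by
        intro s hse
        have hne := Finset.ne_of_mem_erase hse
        have h1 := h4 c s hne
        obtain ⟨p, hp⟩ := hs c s hne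
        have h0 : 0 < #{p | w p c = s} := Finset.card_pos.2 ⟨p, by simp [hp]⟩
        generalize #{p | w p c = s} = x at h0 h1
        interval_cases x <;> omega
      have := Finset.sum_le_sum hle
      rw [Finset.sum_add_distrib, ← Finset.mul_sum] at this
      simp only [Finset.sum_const, Finset.card_erase_of_mem (Finset.mem_univ (e c)),
        Finset.card_univ, Fintype.card_fin, smul_eq_mul] at this hsum
      omega
    have := Finset.sum_le_sum fun c (_ : c ∈ (univ : Finset (Fin 5))) => hcol c
    rw [h130] at this
    simp at this
  obtain ⟨c, s, hse, h⟩ := h4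
  obtain ⟨p, hp, hs'⟩ := exists_fin_of_le_card h
  simp only [Finset.mem_filter, Finset.mem_univ, true_and] at hs'
  have hfst : ∀ i j, i ≠ j → (p i).1 ≠ (p j).1 := fun i j hij =>
    hw.fst_ne (fun h => hij (hp h)) ((hs' i).trans (hs' j).symm)
  -- The word `e` meets these four words at the four other positions.
  choose κ hκ using fun i => agr_eq_one.1 (he (p i))
  have hκc : ∀ i, κ i ≠ c := by
    intro i h
    exact hse ((hs' i).symm.trans ((hκ i c).2 h.symm).symm)
  have hκinj : Function.Injective κ := by
    intro i j hij
    have h1 := (hκ i (κ i)).2 rfl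
    have h2 := (hκ j (κ i)).2 hij
    exact hw.injective_of_ne hp hs' (hκc i) (h1.symm.trans h2)
  obtain ⟨σ, hσ⟩ := exists_perm (u := id) (v := Fin.cons c κ) Function.injective_id
    (Fin.cons_injective_iff.2 ⟨fun ⟨i, hi⟩ => hκc i hi, hκinj⟩)
  have hσ0 : σ 0 = c := hσ 0
  have hσκ : ∀ i : Fin 4, σ i.succ = κ i := fun i => by simpa using hσ i.succ
  have hπ0 : ∃ π : Equiv.Perm (Fin 5), π (e c) = 0 ∧ π s = 1 := by
    obtain ⟨π, hπ⟩ := exists_perm (u := ![e c, s]) (v := ![0, 1])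
      (by intro i j; fin_cases i <;> fin_cases j <;> simp [hse, hse.symm]) (by decide)
    exact ⟨π, hπ 0, hπ 1⟩
  obtain ⟨π0, hπe, hπs⟩ := hπ0
  have hπ1 : ∀ i : Fin 4, ∃ π : Equiv.Perm (Fin 5), ∀ j, π (w (p j) (κ i)) =
      (![![0, 1, 2, 3], ![1, 0, 2, 3], ![1, 2, 0, 3], ![1, 2, 3, 0]] : Fin 4 → Fin 4 → Fin 5) i j := by
    intro i
    exact exists_perm (hw.injective_of_ne hp hs' (hκc i)) (by fin_cases i <;> decide)
  choose π1 hπ1 using hπ1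
  have hw' := hw.map_permute σ (Fin.cons π0 π1)
  have hrow0 : ∀ i, permute σ (Fin.cons π0 π1) (w (p i)) 0 = 1 := by
    intro i
    simp [permute, hσ0, hs', hπs]
  have hrowS : ∀ i (m : Fin 4), permute σ (Fin.cons π0 π1) (w (p i)) m.succ =
      (![![0, 1, 2, 3], ![1, 0, 2, 3], ![1, 2, 0, 3], ![1, 2, 3, 0]] : Fin 4 → Fin 4 → Fin 5) m i := by
    intro i m
    simp [permute, hσκ, hπ1]
  have hE : permute σ (Fin.cons π0 π1) e = 0 := by
    funext m
    rcases Fin.eq_zero_or_eq_succ m with rfl | ⟨i, rfl⟩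
    · simp [permute, hσ0, hπe]
    · have h1 := hrowS i i
      have h2 : permute σ (Fin.cons π0 π1) e i.succ = permute σ (Fin.cons π0 π1) (w (p i)) i.succ := by
        simp only [permute, Fin.cons_succ, hσκ]
        rw [(hκ i _).2 rfl]
      rw [h2, h1]
      fin_cases i <;> rfl
  have key : ∀ i : Fin 4, permute σ (Fin.cons π0 π1) (w (p i)) =
      Fin.cons 1 fun m => (![![0, 1, 2, 3], ![1, 0, 2, 3], ![1, 2, 0, 3], ![1, 2, 3, 0]] :
        Fin 4 → Fin 4 → Fin 5) m i := by
    intro i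
    funext m
    rcases Fin.eq_zero_or_eq_succ m with rfl | ⟨m, rfl⟩
    · simpa using hrow0 i
    · simpa using hrowS i m
  refine false_of_searchFive hw' (p₀ := p 0) (p₁ := p 1) (p₂ := p 2) (p₃ := p 3) (by simp [hfst])
    ((key 0).trans (by decide)) ((key 1).trans (by decide)) ((key 2).trans (by decide))
    ((key 3).trans (by decide)) ?_ ?_
  · intro q
    rw [← hE, agr_permute]
    exact he q
  · intro m
    refine le_trans (le_of_eq ?_) (hz (σ m))
    congr 1
    ext q
    have h0 : permute σ (Fin.cons π0 π1) e m = 0 := by rw [hE]; rfl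
    simp only [Finset.mem_filter, Finset.mem_univ, true_and]
    rw [← h0]
    simp [permute]

end Word

/-! ### Linear spaces with short or long lines -/

/-- A finite linear space: any two distinct points lie on exactly one line of `L`, and each line has
at least two points. -/
structure IsLinearSpace {P : Type*} (L : Finset (Finset P)) : Prop where
  exists_line : ∀ x y, x ≠ y → ∃ l ∈ L, x ∈ l ∧ y ∈ l
  unique : ∀ l ∈ L, ∀ m ∈ L, ∀ x y, x ≠ y → x ∈ l → y ∈ l → x ∈ m → y ∈ m → l = m
  two_le_card : ∀ l ∈ L, 2 ≤ #l

namespace IsLinearSpace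

variable {P : Type*} {L : Finset (Finset P)}

open scoped Classical in
/-- The line through two distinct points; the empty set if the points coincide. -/
noncomputable def line (hL : IsLinearSpace L) (x y : P) : Finset P :=
  if h : x ≠ y then (hL.exists_line x y h).choose else ∅

section line
variable (hL : IsLinearSpace L) {x y : P}

lemma line_spec (h : x ≠ y) : hL.line x y ∈ L ∧ x ∈ hL.line x y ∧ y ∈ hL.line x y := by
  rw [line, dif_pos h]
  exact (hL.exists_line x y h).choose_spec

lemma line_mem (h : x ≠ y) : hL.line x y ∈ L := (hL.line_spec h).1

lemma left_mem_line (h : x ≠ y) : x ∈ hL.line x y := (hL.line_spec h).2.1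

lemma right_mem_line (h : x ≠ y) : y ∈ hL.line x y := (hL.line_spec h).2.2

lemma eq_line (h : x ≠ y) {l : Finset P} (hl : l ∈ L) (hx : x ∈ l) (hy : y ∈ l) :
    l = hL.line x y :=
  hL.unique _ hl _ (hL.line_mem h) x y h hx hy (hL.left_mem_line h) (hL.right_mem_line h)

include hL in
lemma eq_of_mem_of_mem {l m : Finset P} (hl : l ∈ L) (hm : m ∈ L) (hlm : l ≠ m)
    (hxl : x ∈ l) (hxm : x ∈ m) (hyl : y ∈ l) (hym : y ∈ m) : x = y := by
  by_contra h
  exact hlm (hL.unique l hl m hm x y h hxl hyl hxm hym)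

include hL in
lemma exists_mem_ne {l : Finset P} (hl : l ∈ L) (x : P) : ∃ y ∈ l, y ≠ x := by
  have h2 := hL.two_le_card l hl
  exact Finset.exists_mem_ne (by omega) x

include hL in
/-- The lines that join a point `x` off the set `K` to the points of a line `K` are distinct. -/
lemma injOn_line {K : Finset P} (hK : K ∈ L) {x : P} (hx : x ∉ K) : Set.InjOn (hL.line x) K := by
  intro y hy z hz h
  have hxy : x ≠ y := fun h => hx (h ▸ hy)
  have hxz : x ≠ z := fun h => hx (h ▸ hz)
  refine hL.eq_of_mem_of_mem (hL.line_mem hxy) hK (fun h' => hx (h' ▸ hL.left_mem_line hxy))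
    (hL.right_mem_line hxy) hy ?_ hz
  rw [h]
  exact hL.right_mem_line hxz

end line

variable [DecidableEq P] (hL : IsLinearSpace L)

include hL

lemma exists_mem_notMem {l m : Finset P} (hl : l ∈ L) (hm : m ∈ L) (h : m ≠ l) :
    ∃ x ∈ m, x ∉ l := by
  obtain ⟨x, hx, y, hy, hxy⟩ := Finset.one_lt_card.1 (hL.two_le_card m hm)
  by_contra! hml
  exact h (hL.unique m hm l hl x y hxy hx hy (hml x hx) (hml y hy))

lemma image_line_subset {K : Finset P} {x : P} (hx : x ∉ K) :
    K.image (hL.line x) ⊆ L.filter (x ∈ ·) := by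
  intro l hl
  obtain ⟨y, hy, rfl⟩ := Finset.mem_image.1 hl
  have hxy : x ≠ y := fun h => hx (h ▸ hy)
  exact Finset.mem_filter.2 ⟨hL.line_mem hxy, hL.left_mem_line hxy⟩

lemma card_image_line {K : Finset P} (hK : K ∈ L) {x : P} (hx : x ∉ K) :
    #(K.image (hL.line x)) = #K :=
  Finset.card_image_of_injOn (hL.injOn_line hK hx)

lemma card_le_degree {K : Finset P} (hK : K ∈ L) {x : P} (hx : x ∉ K) :
    #K ≤ #{l ∈ L | x ∈ l} := by
  rw [← hL.card_image_line hK hx]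
  exact Finset.card_le_card (hL.image_line_subset hx)

lemma card_filter_mem_notMem_add_one_le {x e : P} (h : x ≠ e) :
    #{l ∈ L | x ∈ l ∧ e ∉ l} + 1 ≤ #{l ∈ L | x ∈ l} := by
  refine Finset.card_lt_card ⟨fun l hl => ?_, fun hs => ?_⟩
  · simp only [Finset.mem_filter] at hl ⊢
    exact ⟨hl.1, hl.2.1⟩
  · have := hs (Finset.mem_filter.2 ⟨hL.line_mem h, hL.left_mem_line h⟩)
    exact (Finset.mem_filter.1 this).2.2 (hL.right_mem_line h)

/-- The case of a line with `q + 1` points: all other lines meet it. -/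
lemma card_avoiding_le_of_long {q : ℕ} (hq : ∀ x, #{l ∈ L | x ∈ l} ≤ q + 1) {K : Finset P}
    (hK : K ∈ L) (hKq : q + 1 ≤ #K) (e : P) : #{l ∈ L | e ∉ l} ≤ q ^ 2 := by
  have hmeet : ∀ l ∈ L, l ≠ K → ∃ y ∈ K, y ∈ l := by
    intro l hl hlK
    obtain ⟨x, hxl, hx⟩ := hL.exists_mem_notMem hK hl hlK
    have heq := Finset.eq_of_subset_of_card_le (hL.image_line_subset hx)
      (by rw [hL.card_image_line hK hx]; exact (hq x).trans hKq)
    have hmem : l ∈ K.image (hL.line x) := by rw [heq]; exact Finset.mem_filter.2 ⟨hl, hxl⟩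
    obtain ⟨y, hy, rfl⟩ := Finset.mem_image.1 hmem
    exact ⟨y, hy, hL.right_mem_line fun h => hx (h ▸ hy)⟩
  by_cases hout : ∃ l ∈ L, l ≠ K
  swap
  · push Not at hout
    have : #{l ∈ L | e ∉ l} ≤ 1 := by
      rw [Finset.card_le_one]
      intro l hl m hm
      rw [hout l (Finset.mem_filter.1 hl).1, hout m (Finset.mem_filter.1 hm).1]
    rcases Nat.eq_zero_or_pos q with rfl | h0
    · have he : e ∈ K := by
        by_contra he
        have := hL.card_le_degree hK he
        have h2 := hL.two_le_card K hK
        have := hq e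
        omega
      rw [Finset.filter_false_of_mem]
      · simp
      · intro l hl
        rw [hout l hl]
        simpa using he
    · nlinarith
  obtain ⟨l, hl, hlK⟩ := hout
  obtain ⟨x, hxl, hx⟩ := hL.exists_mem_notMem hK hl hlK
  have hKle : #K ≤ q + 1 := (hL.card_le_degree hK hx).trans (hq x)
  have hKeq : #K = q + 1 := le_antisymm hKle hKq
  by_cases he : e ∈ K
  · have hsub : L.filter (e ∉ ·) ⊆ (K.erase e).biUnion fun y => {l ∈ L | y ∈ l ∧ e ∉ l} := by
      intro l hl
      rw [Finset.mem_filter] at hl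
      obtain ⟨y, hy, hyl⟩ := hmeet l hl.1 (fun h => hl.2 (h ▸ he))
      exact Finset.mem_biUnion.2 ⟨y, Finset.mem_erase.2 ⟨fun h => hl.2 (h ▸ hyl), hy⟩,
        Finset.mem_filter.2 ⟨hl.1, hyl, hl.2⟩⟩
    calc #{l ∈ L | e ∉ l} ≤ _ := Finset.card_le_card hsub
      _ ≤ #(K.erase e) * q := Finset.card_biUnion_le_card_mul _ _ _ fun y hy => by
        have := hL.card_filter_mem_notMem_add_one_le (Finset.ne_of_mem_erase hy)
        have := hq y
        omega
      _ = q ^ 2 := by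
        rw [Finset.card_erase_of_mem he, hKeq, sq]; rfl
  · have hsub : L.filter (e ∉ ·) ⊆
        insert K (K.biUnion fun y => {l ∈ L | y ∈ l ∧ e ∉ l}.erase K) := by
      intro l hl
      rw [Finset.mem_filter] at hl
      by_cases hlK : l = K
      · simp [hlK]
      · obtain ⟨y, hy, hyl⟩ := hmeet l hl.1 hlK
        exact Finset.mem_insert_of_mem (Finset.mem_biUnion.2 ⟨y, hy,
          Finset.mem_erase.2 ⟨hlK, Finset.mem_filter.2 ⟨hl.1, hyl, hl.2⟩⟩⟩)
    have hle : ∀ y ∈ K, #({l ∈ L | y ∈ l ∧ e ∉ l}.erase K) ≤ q - 1 := by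
      intro y hy
      rw [Finset.card_erase_of_mem (Finset.mem_filter.2 ⟨hK, hy, he⟩)]
      have := hL.card_filter_mem_notMem_add_one_le (x := y) (e := e) (fun h => he (h ▸ hy))
      have := hq y
      omega
    have h1 := (Finset.card_le_card hsub).trans (Finset.card_insert_le _ _)
    have h2 := Finset.card_biUnion_le_card_mul _ _ _ hle
    have h3 := hL.two_le_card K hK
    obtain ⟨r, rfl⟩ : ∃ r, q = r + 1 := ⟨q - 1, by omega⟩
    rw [hKeq, Nat.add_sub_cancel] at h2
    nlinarith

/-- Counting points on lines that avoid `e`. -/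
lemma sum_card_avoiding_le [Fintype P] {q : ℕ} (hq : ∀ x, #{l ∈ L | x ∈ l} ≤ q + 1) (e : P) :
    ∑ l ∈ L with e ∉ l, #l ≤ q * (Fintype.card P - 1) := by
  have h1 : ∀ l ∈ L.filter (e ∉ ·), #l = #{x ∈ univ.erase e | x ∈ l} := by
    intro l hl
    congr 1
    ext x
    simp only [Finset.mem_filter, Finset.mem_erase, Finset.mem_univ, and_true]
    exact ⟨fun h => ⟨fun h' => (Finset.mem_filter.1 hl).2 (h' ▸ h), h⟩, And.right⟩
  rw [Finset.sum_congr rfl h1]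
  simp only [Finset.card_filter]
  rw [Finset.sum_comm, mul_comm, ← Finset.card_univ,
    ← Finset.card_erase_of_mem (Finset.mem_univ e), ← smul_eq_mul]
  refine Finset.sum_le_card_nsmul _ _ _ fun x hx => ?_
  rw [← Finset.card_filter, Finset.filter_filter]
  have := hL.card_filter_mem_notMem_add_one_le (Finset.ne_of_mem_erase hx)
  have := hq x
  simp only [and_comm] at *
  omega

/-- Counting ordered pairs of distinct points. -/
lemma sum_card_mul_card_sub_one [Fintype P] :
    ∑ l ∈ L, (#l * #l - #l) = Fintype.card P * Fintype.card P - Fintype.card P := by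
  rw [← Finset.card_univ, ← Finset.offDiag_card, Finset.sum_congr rfl fun l _ =>
    (Finset.offDiag_card l).symm, ← Finset.card_biUnion]
  · congr 1
    ext ⟨x, y⟩
    simp only [Finset.mem_biUnion, Finset.mem_offDiag, Finset.mem_univ, true_and]
    constructor
    · rintro ⟨l, -, -, -, h⟩
      exact h
    · intro h
      exact ⟨_, hL.line_mem h, hL.left_mem_line h, hL.right_mem_line h, h⟩
  · intro l hl m hm hlm
    rw [Function.onFun, Finset.disjoint_left]
    rintro ⟨x, y⟩ h1 h2
    rw [Finset.mem_offDiag] at h1 h2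
    exact hlm (hL.unique l hl m hm x y h1.2.2 h1.1 h1.2.1 h2.1 h2.2.1)

/-- The lines through `e` partition the other points. -/
lemma sum_card_sub_one [Fintype P] (e : P) :
    ∑ l ∈ L with e ∈ l, (#l - 1) = Fintype.card P - 1 := by
  have h1 : ∀ l ∈ L.filter (e ∈ ·), #l - 1 = #(l.erase e) := fun l hl =>
    (Finset.card_erase_of_mem (Finset.mem_filter.1 hl).2).symm
  rw [Finset.sum_congr rfl h1, ← Finset.card_univ,
    ← Finset.card_erase_of_mem (Finset.mem_univ e), ← Finset.card_biUnion]
  · congr 1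
    ext x
    simp only [Finset.mem_biUnion, Finset.mem_filter, Finset.mem_erase, Finset.mem_univ, and_true]
    constructor
    · rintro ⟨l, -, h, -⟩
      exact h
    · intro h
      exact ⟨hL.line x e, ⟨hL.line_mem h, hL.right_mem_line h⟩, h, hL.left_mem_line h⟩
  · intro l hl m hm hlm
    have hl := Finset.mem_filter.1 hl
    have hm := Finset.mem_filter.1 hm
    rw [Function.onFun, Finset.disjoint_left]
    intro x h1 h2
    rw [Finset.mem_erase] at h1 h2
    exact h1.1 (hL.eq_of_mem_of_mem hl.1 hm.1 hlm h1.2 h2.2 hl.2 hm.2)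

/-- The case of short lines. Each line size `t` has `(t - 2) (T - t) ≥ 0`; this is summed over the
lines that avoid `e`. -/
lemma mul_card_avoiding_le [Fintype P] {q T : ℕ} (hq : ∀ x, #{l ∈ L | x ∈ l} ≤ q + 1)
    (hT : ∀ l ∈ L, #l ≤ T) (e : P) :
    (2 * T * #{l ∈ L | e ∉ l} : ℤ) ≤
      ((T + 1) * q + T - 1) * (Fintype.card P - 1) - (Fintype.card P - 1) ^ 2 := by
  have hpos : 1 ≤ Fintype.card P := Fintype.card_pos_iff.2 ⟨e⟩
  have h1 := hL.sum_card_avoiding_le hq e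
  have h2 := hL.sum_card_mul_card_sub_one
  have h3 := hL.sum_card_sub_one e
  zify [hpos] at h1
  have h2' : ∑ l ∈ L, ((#l : ℤ) * (#l - 1)) = Fintype.card P * (Fintype.card P - 1) := by
    have := congrArg (Nat.cast : ℕ → ℤ) h2
    rw [Nat.cast_sum, Nat.cast_sub (Nat.le_mul_self _)] at this
    push_cast at this
    rw [mul_sub, mul_one, ← this]
    refine Finset.sum_congr rfl fun l _ => ?_
    rw [Nat.cast_sub (Nat.le_mul_self _)]
    push_cast
    ring
  have h3' : ∑ l ∈ L with e ∈ l, ((#l : ℤ) - 1) = Fintype.card P - 1 := by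
    have := congrArg (Nat.cast : ℕ → ℤ) h3
    rw [Nat.cast_sum, Nat.cast_sub hpos] at this
    push_cast at this
    rw [← this]
    refine Finset.sum_congr rfl fun l hl => ?_
    rw [Nat.cast_sub ((by norm_num : 1 ≤ 2).trans
      (hL.two_le_card l (Finset.mem_filter.1 hl).1))]
    simp
  have h4 : ∑ l ∈ L with e ∈ l, ((#l : ℤ) * (#l - 1)) ≤ T * (Fintype.card P - 1) := by
    rw [← h3', Finset.mul_sum]
    refine Finset.sum_le_sum fun l hl => ?_
    have ha := hL.two_le_card l (Finset.mem_filter.1 hl).1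
    have hb := hT l (Finset.mem_filter.1 hl).1
    zify at ha hb
    exact mul_le_mul_of_nonneg_right hb (by linarith)
  have h5 := Finset.sum_filter_add_sum_filter_not L (e ∈ ·) fun l => ((#l : ℤ) * (#l - 1))
  have h6 : ∑ l ∈ L with e ∉ l, (2 * T : ℤ) ≤
      ∑ l ∈ L with e ∉ l, ((T + 1) * (#l : ℤ) - (#l : ℤ) * (#l - 1)) := by
    refine Finset.sum_le_sum fun l hl => ?_
    have ha := hL.two_le_card l (Finset.mem_filter.1 hl).1
    have hb := hT l (Finset.mem_filter.1 hl).1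
    zify at ha hb
    nlinarith
  rw [Finset.sum_const, nsmul_eq_mul, Finset.sum_sub_distrib, ← Finset.mul_sum] at h6
  have h7 : ((T : ℤ) + 1) * ∑ l ∈ L with e ∉ l, (#l : ℤ) ≤
      (T + 1) * (q * (Fintype.card P - 1)) :=
    mul_le_mul_of_nonneg_left h1 (by positivity)
  rw [h2'] at h5
  nlinarith

lemma card_avoiding_le_of_short [Fintype P] {q : ℕ} (hq : ∀ x, #{l ∈ L | x ∈ l} ≤ q + 1)
    (hq2 : 2 ≤ q) (hq5 : q ≤ 5) (hT : ∀ l ∈ L, #l ≤ min q 4) (e : P) :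
    #{l ∈ L | e ∉ l} ≤ q ^ 2 := by
  have h := hL.mul_card_avoiding_le hq hT e
  generalize (Fintype.card P : ℤ) - 1 = S at h
  generalize #{l ∈ L | e ∉ l} = N at h
  zify
  interval_cases q
  · norm_num at h ⊢
    nlinarith [sq_nonneg (2 * S - 7)]
  · norm_num at h ⊢
    nlinarith [sq_nonneg (S - 7)]
  · norm_num at h ⊢
    nlinarith [sq_nonneg (2 * S - 23)]
  · norm_num at h ⊢
    nlinarith [sq_nonneg (S - 14)]

end IsLinearSpace

/-! ### Linear spaces with at most six lines through a point and a five-point line -/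

namespace IsLinearSpace

variable {P : Type*} {L : Finset (Finset P)}

/-- Five points `κ c` of a line `K`, with a numbering `g c` of the lines through `κ c`. -/
structure Coordinates (L : Finset (Finset P)) (K : Finset P) where
  κ : Fin 5 → P
  g : Fin 5 → Finset P → Fin 5
  κ_injective : Function.Injective κ
  mem_iff : ∀ x, x ∈ K ↔ ∃ c, κ c = x
  g_injOn : ∀ c l m, l ∈ L → m ∈ L → κ c ∈ l → κ c ∈ m → l ≠ K → m ≠ K → g c l = g c m → l = m

/-- A numbering of the lines through a point of `K` exists, as at most five of them differ from `K`. -/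
lemma exists_coordinates [DecidableEq P] {K : Finset P} (hK : K ∈ L) (hK5 : #K = 5)
    (hq : ∀ x, #{l ∈ L | x ∈ l} ≤ 6) : Nonempty (Coordinates L K) := by
  let E := K.equivFinOfCardEq hK5
  have hg : ∀ c, ∃ g : Finset P → Fin 5,
      Set.InjOn g ({l ∈ L | (E.symm c : P) ∈ l}.erase K : Finset (Finset P)) := by
    intro c
    have hc : #({l ∈ L | (E.symm c : P) ∈ l}.erase K) ≤ Fintype.card (Fin 5) := by
      rw [Finset.card_erase_of_mem (Finset.mem_filter.2 ⟨hK, (E.symm c).2⟩)]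
      have := hq (E.symm c)
      simp
      omega
    obtain ⟨f⟩ := Function.Embedding.nonempty_of_card_le
      (α := ({l ∈ L | (E.symm c : P) ∈ l}.erase K : Finset (Finset P))) (β := Fin 5) (by simpa using hc)
    refine ⟨fun l => if h : l ∈ {l ∈ L | (E.symm c : P) ∈ l}.erase K then f ⟨l, h⟩ else 0, ?_⟩
    intro l hl m hm h
    simp only [Finset.mem_coe] at hl hm
    simp only [hl, hm, dif_pos] at h
    exact congrArg Subtype.val (f.injective h)
  choose g hg using hg
  refine ⟨⟨fun c => E.symm c, g, fun c d h => E.symm.injective (Subtype.ext h), fun x => ?_, ?_⟩⟩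
  · exact ⟨fun h => ⟨E ⟨x, h⟩, by simp⟩, by rintro ⟨c, rfl⟩; exact (E.symm c).2⟩
  · intro c l m hl hm hcl hcm hlK hmK h
    exact hg c (by simp [hl, hcl, hlK]) (by simp [hm, hcm, hmK]) h

namespace Coordinates

variable {K : Finset P} (C : Coordinates L K) (hL : IsLinearSpace L)

/-- The word of a point off `K`: it lists the lines to the five points of `K`. -/
noncomputable def word (x : P) : Word := fun c => C.g c (hL.line x (C.κ c))

variable {C hL} (hK : K ∈ L)

lemma κ_mem (c : Fin 5) : C.κ c ∈ K := (C.mem_iff _).2 ⟨c, rfl⟩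

lemma ne_κ {x : P} (hx : x ∉ K) (c : Fin 5) : x ≠ C.κ c := fun h => hx (h ▸ C.κ_mem c)

lemma word_eq_iff_of_mem {l : Finset P} (hl : l ∈ L) {c : Fin 5} (hc : C.κ c ∈ l) {x y : P}
    (hx : x ∉ K) (hy : y ∉ K) (hxl : x ∈ l) :
    C.word hL x c = C.word hL y c ↔ y ∈ l := by
  have h1 := hL.eq_line (C.ne_κ hx c) hl hxl hc
  constructor
  · intro h
    have h2 := C.g_injOn c _ _ (hL.line_mem (C.ne_κ hx c)) (hL.line_mem (C.ne_κ hy c))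
      (hL.right_mem_line (C.ne_κ hx c)) (hL.right_mem_line (C.ne_κ hy c))
      (fun h' => hx (h' ▸ hL.left_mem_line (C.ne_κ hx c)))
      (fun h' => hy (h' ▸ hL.left_mem_line (C.ne_κ hy c))) h
    rw [h1, h2]
    exact hL.left_mem_line (C.ne_κ hy c)
  · intro h
    rw [word, word, ← h1, ← hL.eq_line (C.ne_κ hy c) hl h hc]

lemma word_eq_iff {x y : P} (hx : x ∉ K) (hy : y ∉ K) (hxy : x ≠ y) {l : Finset P} (hl : l ∈ L)
    (hxl : x ∈ l) (hyl : y ∈ l) (c : Fin 5) :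
    C.word hL x c = C.word hL y c ↔ C.κ c ∈ l := by
  constructor
  · intro h
    have h1 := (C.word_eq_iff_of_mem (hL := hL) (hL.line_mem (C.ne_κ hx c))
      (hL.right_mem_line (C.ne_κ hx c)) hx hy (hL.left_mem_line (C.ne_κ hx c))).1 h
    rw [hL.unique l hl _ (hL.line_mem (C.ne_κ hx c)) x y hxy hxl hyl
      (hL.left_mem_line (C.ne_κ hx c)) h1]
    exact hL.right_mem_line (C.ne_κ hx c)
  · intro h
    exact (C.word_eq_iff_of_mem hl h hx hy hxl).2 hyl

/-- Words of two points whose line misses `K`. -/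
lemma agr_word_eq_zero {x y : P} (hx : x ∉ K) (hy : y ∉ K) (hxy : x ≠ y) {l : Finset P}
    (hl : l ∈ L) (hxl : x ∈ l) (hyl : y ∈ l) (hd : Disjoint l K) :
    Word.agr (C.word hL x) (C.word hL y) = 0 := by
  rw [Word.agr_eq_zero]
  intro c h
  exact Finset.disjoint_left.1 hd ((C.word_eq_iff hx hy hxy hl hxl hyl c).1 h) (C.κ_mem c)

include hK in
/-- Words of two points whose line meets `K`. -/
lemma agr_word_eq_one {x y : P} (hx : x ∉ K) (hy : y ∉ K) (hxy : x ≠ y)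
    (hd : ∀ l ∈ L, x ∈ l → y ∈ l → ¬ Disjoint l K) :
    Word.agr (C.word hL x) (C.word hL y) = 1 := by
  rw [Word.agr_eq_one]
  have hl := hL.line_mem hxy
  have hxl := hL.left_mem_line hxy
  have hyl := hL.right_mem_line hxy
  obtain ⟨z, hz, hzK⟩ := Finset.not_disjoint_iff.1 (hd _ hl hxl hyl)
  obtain ⟨c, rfl⟩ := (C.mem_iff z).1 hzK
  refine ⟨c, fun i => ?_⟩
  rw [C.word_eq_iff hx hy hxy hl hxl hyl]
  constructor
  · intro hi
    by_contra hic
    exact hic (C.κ_injective (hL.eq_of_mem_of_mem hl hK (fun h => hx (h ▸ hxl)) hi (C.κ_mem i) hz hzK))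
  · rintro rfl
    exact hz

end Coordinates

/-- Two distinct points on each of `k` given lines. -/
lemma exists_points (hL : IsLinearSpace L) {k : ℕ} {s : Finset (Finset P)} (hs : s ⊆ L)
    (hk : k ≤ #s) : ∃ (m : Fin k → Finset P) (a : Fin k × Bool → P), Function.Injective m ∧
      (∀ j, m j ∈ s) ∧ (∀ p, a p ∈ m p.1) ∧ ∀ j, a (j, false) ≠ a (j, true) := by
  obtain ⟨m, hm, hms⟩ := Word.exists_fin_of_le_card hk
  have h2 : ∀ j, ∃ x y, x ∈ m j ∧ y ∈ m j ∧ x ≠ y := by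
    intro j
    obtain ⟨x, hx, y, hy, h⟩ := Finset.one_lt_card.1 (hL.two_le_card _ (hs (hms j)))
    exact ⟨x, y, hx, hy, h⟩
  choose x y hx hy hxy using h2
  exact ⟨m, fun p => if p.2 then y p.1 else x p.1, hm, hms,
    by rintro ⟨j, _ | _⟩ <;> simp [hx, hy], by simpa using hxy⟩

variable [DecidableEq P] {K : Finset P}

/-- At most one line through a point off a five-point line `K` misses `K`. -/
lemma eq_of_disjoint (hL : IsLinearSpace L) (hq : ∀ x, #{l ∈ L | x ∈ l} ≤ 6) (hK : K ∈ L)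
    (hK5 : #K = 5) {l m : Finset P} (hl : l ∈ L) (hm : m ∈ L) (hlK : Disjoint l K)
    (hmK : Disjoint m K) {x : P} (hxl : x ∈ l) (hxm : x ∈ m) : l = m := by
  by_contra hlm
  have hx : x ∉ K := Finset.disjoint_left.1 hlK hxl
  have hnot : ∀ k : Finset P, Disjoint k K → k ∉ K.image (hL.line x) := by
    intro k hk hkm
    obtain ⟨y, hy, rfl⟩ := Finset.mem_image.1 hkm
    exact Finset.disjoint_left.1 hk (hL.right_mem_line fun h => hx (h ▸ hy)) hy
  have hsub : insert l (insert m (K.image (hL.line x))) ⊆ L.filter (x ∈ ·) := by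
    intro k hk
    rw [Finset.mem_insert, Finset.mem_insert] at hk
    rcases hk with rfl | rfl | hk
    · exact Finset.mem_filter.2 ⟨hl, hxl⟩
    · exact Finset.mem_filter.2 ⟨hm, hxm⟩
    · exact hL.image_line_subset hx hk
  have := Finset.card_le_card hsub
  rw [Finset.card_insert_of_notMem (by simpa [hlm] using hnot l hlK),
    Finset.card_insert_of_notMem (hnot m hmK), hL.card_image_line hK hx] at this
  have := hq x
  omega

/-- The words of points on lines that miss `K`, two points on each, form a paired code. -/
lemma pairedCode_word {J : Type*} (hL : IsLinearSpace L) (C : Coordinates L K)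
    (hq : ∀ x, #{l ∈ L | x ∈ l} ≤ 6) (hK : K ∈ L) (hK5 : #K = 5) {m : J → Finset P}
    (hm : Function.Injective m) (hmL : ∀ j, m j ∈ L) (hmK : ∀ j, Disjoint (m j) K)
    {a : J × Bool → P} (ham : ∀ p, a p ∈ m p.1) (hab : ∀ j, a (j, false) ≠ a (j, true)) :
    Word.PairedCode fun p => C.word hL (a p) where
  zero j := C.agr_word_eq_zero (Finset.disjoint_left.1 (hmK j) (ham (j, false)))
    (Finset.disjoint_left.1 (hmK j) (ham (j, true))) (hab j) (hmL j) (ham _) (ham _) (hmK j)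
  one p q hpq := by
    refine C.agr_word_eq_one hK (Finset.disjoint_left.1 (hmK _) (ham p))
      (Finset.disjoint_left.1 (hmK _) (ham q)) ?_ ?_
    · intro h
      exact hpq (hm (hL.eq_of_disjoint hq hK hK5 (hmL _) (hmL _) (hmK _) (hmK _) (ham p)
        (h ▸ ham q)))
    · intro l hl hpl hql hd
      have h1 := hL.eq_of_disjoint hq hK hK5 hl (hmL p.1) hd (hmK _) hpl (ham p)
      have h2 := hL.eq_of_disjoint hq hK hK5 hl (hmL q.1) hd (hmK _) hql (ham q)
      exact hpq (hm (h1.symm.trans h2))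

/-- A point on none of the lines that miss `K`, or a new point of one of them, gives a word that
extends the code. -/
lemma extends_word {J : Type*} (hL : IsLinearSpace L) (C : Coordinates L K)
    (hq : ∀ x, #{l ∈ L | x ∈ l} ≤ 6) (hK : K ∈ L) (hK5 : #K = 5) {m : J → Finset P}
    (hm : Function.Injective m) (hmL : ∀ j, m j ∈ L) (hmK : ∀ j, Disjoint (m j) K)
    {a : J × Bool → P} (ham : ∀ p, a p ∈ m p.1) {x : P} (hx : x ∉ K) (hxa : ∀ p, a p ≠ x) :
    Word.Extends (fun p => C.word hL (a p)) (C.word hL x) := by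
  have haK : ∀ p, a p ∉ K := fun p => Finset.disjoint_left.1 (hmK _) (ham p)
  have h0 : ∀ p, x ∈ m p.1 → Word.agr (C.word hL (a p)) (C.word hL x) = 0 := fun p h =>
    C.agr_word_eq_zero (haK p) hx (hxa p) (hmL _) (ham p) h (hmK _)
  have h1 : ∀ p, x ∉ m p.1 → Word.agr (C.word hL (a p)) (C.word hL x) = 1 := by
    intro p h
    refine C.agr_word_eq_one hK (haK p) hx (hxa p) fun l hl hpl hxl hd => h ?_
    rwa [← hL.eq_of_disjoint hq hK hK5 hl (hmL p.1) hd (hmK _) hpl (ham p)]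
  have hmem : ∀ j, (∀ b, Word.agr (C.word hL (a (j, b))) (C.word hL x) = 0) → x ∈ m j := by
    intro j hj
    by_contra h
    have := h1 (j, true) h
    rw [hj true] at this
    omega
  refine ⟨fun j => ?_, fun i j hi hj => ?_⟩
  · by_cases h : x ∈ m j
    · exact Or.inr fun b => h0 (j, b) h
    · exact Or.inl fun b => h1 (j, b) h
  · exact hm (hL.eq_of_disjoint hq hK hK5 (hmL _) (hmL _) (hmK _) (hmK _) (hmem i hi) (hmem j hj))

/-- Lines through a point of `K` correspond to the letters used at that position. -/
lemma card_lines_le [Fintype P] (hL : IsLinearSpace L) (C : Coordinates L K) (hK : K ∈ L)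
    (c : Fin 5) :
    #({l ∈ L | C.κ c ∈ l}.erase K) ≤ #{s | ∃ x, x ∉ K ∧ C.word hL x c = s} := by
  refine Finset.card_le_card_of_injOn (C.g c) ?_ ?_
  · intro l hl
    simp only [Finset.coe_erase, Finset.coe_filter, Set.mem_sdiff, Set.mem_ofPred_eq,
      Set.mem_singleton_iff] at hl
    obtain ⟨x, hxl, hx⟩ := hL.exists_mem_notMem hK hl.1.1 hl.2
    simp only [Finset.coe_filter, Finset.mem_univ, true_and, Set.mem_ofPred_eq]
    exact ⟨x, hx, by rw [Coordinates.word, ← hL.eq_line (C.ne_κ hx c) hl.1.1 hxl hl.1.2]⟩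
  · intro l hl m hm h
    simp only [Finset.coe_erase, Finset.coe_filter, Set.mem_sdiff, Set.mem_ofPred_eq,
      Set.mem_singleton_iff] at hl hm
    exact C.g_injOn c l m hl.1.1 hm.1.1 hl.1.2 hm.1.2 hl.2 hm.2 h

/-- Six lines that miss `K`: there is no seventh, their union is the complement of `K`, and some
line is lacking at one of the points `κ c`, `c ≠ c₀`. -/
lemma of_six_le [Fintype P] (hL : IsLinearSpace L) (C : Coordinates L K)
    (hq : ∀ x, #{l ∈ L | x ∈ l} ≤ 6) (hK : K ∈ L) (hK5 : #K = 5)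
    (h6 : 6 ≤ #{l ∈ L | Disjoint l K}) :
    #{l ∈ L | Disjoint l K} = 6 ∧ (∀ x ∉ K, ∃ l ∈ L, Disjoint l K ∧ x ∈ l) ∧
      ∀ c₀, ∃ c ≠ c₀, #({l ∈ L | C.κ c ∈ l}.erase K) ≤ 4 := by
  obtain ⟨m, a, hm, hms, ham, hab⟩ := hL.exists_points (Finset.filter_subset _ _) h6
  have hmL : ∀ j, m j ∈ L := fun j => (Finset.mem_filter.1 (hms j)).1
  have hmK : ∀ j, Disjoint (m j) K := fun j => (Finset.mem_filter.1 (hms j)).2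
  have hcode := hL.pairedCode_word C hq hK hK5 hm hmL hmK ham hab
  have hnot := hcode.not_extends
  have hX : ∀ x ∉ K, ∃ p, a p = x := by
    intro x hx
    by_contra! h
    exact hnot (Or.inl ⟨_, hL.extends_word C hq hK hK5 hm hmL hmK ham hx h⟩)
  refine ⟨le_antisymm ?_ h6, ?_, ?_⟩
  · have hsub : L.filter (Disjoint · K) ⊆ univ.image m := by
      intro l hl
      rw [Finset.mem_filter] at hl
      obtain ⟨x, hx, -⟩ := Finset.one_lt_card.1 (hL.two_le_card l hl.1)
      obtain ⟨p, rfl⟩ := hX x (Finset.disjoint_left.1 hl.2 hx)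
      refine Finset.mem_image.2 ⟨p.1, Finset.mem_univ _, ?_⟩
      exact hL.eq_of_disjoint hq hK hK5 (hmL _) hl.1 (hmK _) hl.2 (ham p) hx
    simpa using (Finset.card_le_card hsub).trans Finset.card_image_le
  · intro x hx
    obtain ⟨p, rfl⟩ := hX x hx
    exact ⟨_, hmL p.1, hmK p.1, ham p⟩
  · intro c₀
    by_contra! h
    refine hnot (Or.inr ⟨c₀, fun c hc s => ?_⟩)
    have h5 := (h c hc).trans_le (hL.card_lines_le C hK c)
    have huniv : ({s | ∃ x, x ∉ K ∧ C.word hL x c = s} : Finset (Fin 5)) = univ := by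
      rw [← Finset.card_eq_iff_eq_univ]
      refine le_antisymm (Finset.card_le_univ _) ?_
      rw [Fintype.card_fin]
      exact h5
    have hs := Finset.mem_univ s
    rw [← huniv, Finset.mem_filter] at hs
    obtain ⟨-, x, hx, hxs⟩ := hs
    obtain ⟨p, rfl⟩ := hX x hx
    exact ⟨p, hxs⟩

lemma card_lines_le_five (C : Coordinates L K) (hq : ∀ x, #{l ∈ L | x ∈ l} ≤ 6) (hK : K ∈ L)
    (c : Fin 5) : #({l ∈ L | C.κ c ∈ l}.erase K) ≤ 5 := by
  rw [Finset.card_erase_of_mem (Finset.mem_filter.2 ⟨hK, C.κ_mem c⟩)]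
  have := hq (C.κ c)
  omega

lemma exists_mem_lines_or_disjoint (C : Coordinates L K) {l : Finset P} (hl : l ∈ L)
    (hlK : l ≠ K) : (∃ c, l ∈ {l ∈ L | C.κ c ∈ l}.erase K) ∨ Disjoint l K := by
  by_cases hd : Disjoint l K
  · exact Or.inr hd
  · left
    obtain ⟨z, hz, hzK⟩ := Finset.not_disjoint_iff.1 hd
    obtain ⟨c, rfl⟩ := (C.mem_iff z).1 hzK
    exact ⟨c, Finset.mem_erase.2 ⟨hlK, Finset.mem_filter.2 ⟨hl, hz⟩⟩⟩

lemma sum_erase_le_nineteen {f : Fin 5 → ℕ} (hf : ∀ c, f c ≤ 5) {c₀ : Fin 5}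
    (h : ∃ c ≠ c₀, f c ≤ 4) : ∑ c ∈ univ.erase c₀, f c ≤ 19 := by
  obtain ⟨c, hc, h4⟩ := h
  have hmem : c ∈ univ.erase c₀ := by simp [hc]
  rw [← Finset.add_sum_erase _ _ hmem]
  have := Finset.sum_le_card_nsmul ((univ.erase c₀).erase c) f 5 fun c _ => hf c
  change f c + ∑ c ∈ (univ.erase c₀).erase c, f c ≤ 19
  change ∑ c ∈ (univ.erase c₀).erase c, f c ≤ _ at this
  rw [Finset.card_erase_of_mem hmem, Finset.card_erase_of_mem (Finset.mem_univ _)] at this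
  simp at this
  omega

/-- The case of a five-point line through `e`. -/
lemma card_avoiding_le_of_mem [Fintype P] (hL : IsLinearSpace L)
    (hq : ∀ x, #{l ∈ L | x ∈ l} ≤ 6) (hK : K ∈ L) (hK5 : #K = 5) {e : P} (he : e ∈ K) :
    #{l ∈ L | e ∉ l} ≤ 25 := by
  obtain ⟨C⟩ := exists_coordinates hK hK5 hq
  obtain ⟨c₀, rfl⟩ := (C.mem_iff e).1 he
  have hsub : {l ∈ L | C.κ c₀ ∉ l} ⊆
      ((univ.erase c₀).biUnion fun c => {l ∈ L | C.κ c ∈ l}.erase K) ∪ {l ∈ L | Disjoint l K} := by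
    intro l hl
    rw [Finset.mem_filter] at hl
    rw [Finset.mem_union]
    refine (exists_mem_lines_or_disjoint C hl.1 (fun h => hl.2 (h ▸ he))).imp ?_ ?_
    · rintro ⟨c, hc⟩
      refine Finset.mem_biUnion.2 ⟨c, Finset.mem_erase.2 ⟨?_, Finset.mem_univ _⟩, hc⟩
      rintro rfl
      exact hl.2 (Finset.mem_filter.1 (Finset.mem_of_mem_erase hc)).2
    · exact fun h => Finset.mem_filter.2 ⟨hl.1, h⟩
  have h1 := (Finset.card_le_card hsub).trans (Finset.card_union_le _ _)
  have h2 := Finset.card_biUnion_le (s := univ.erase c₀)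
    (t := fun c => {l ∈ L | C.κ c ∈ l}.erase K)
  by_cases h6 : 6 ≤ #{l ∈ L | Disjoint l K}
  · obtain ⟨h6', -, hc⟩ := hL.of_six_le C hq hK hK5 h6
    have := sum_erase_le_nineteen (fun c => card_lines_le_five C hq hK c) (hc c₀)
    omega
  · have := Finset.sum_le_card_nsmul (univ.erase c₀) _ 5 fun c _ => card_lines_le_five C hq hK c
    simp at this
    omega

/-- The case of a five-point line `K` that avoids `e`, when no five-point line contains `e`. -/
lemma card_avoiding_le_of_notMem [Fintype P] (hL : IsLinearSpace L)
    (hq : ∀ x, #{l ∈ L | x ∈ l} ≤ 6) (hK : K ∈ L) (hK5 : #K = 5) {e : P} (he : e ∉ K)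
    (h4 : ∀ l ∈ L, e ∈ l → #l ≤ 4) : #{l ∈ L | e ∉ l} ≤ 25 := by
  obtain ⟨C⟩ := exists_coordinates hK hK5 hq
  have hline : ∀ c, hL.line e (C.κ c) ∈ {l ∈ L | C.κ c ∈ l}.erase K := fun c =>
    Finset.mem_erase.2 ⟨fun h => he (h ▸ hL.left_mem_line (C.ne_κ he c)), Finset.mem_filter.2
      ⟨hL.line_mem (C.ne_κ he c), hL.right_mem_line (C.ne_κ he c)⟩⟩
  set f : Fin 5 → ℕ := fun c => #({l ∈ L | C.κ c ∈ l}.erase K) with hf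
  have hf5 : ∀ c, f c ≤ 5 := fun c => card_lines_le_five C hq hK c
  have hsub : {l ∈ L | e ∉ l} ⊆ insert K
      ((univ.biUnion fun c => ({l ∈ L | C.κ c ∈ l}.erase K).erase (hL.line e (C.κ c))) ∪
        {l ∈ L | Disjoint l K ∧ e ∉ l}) := by
    intro l hl
    rw [Finset.mem_filter] at hl
    by_cases hlK : l = K
    · simp [hlK]
    refine Finset.mem_insert_of_mem (Finset.mem_union.2 ?_)
    refine (exists_mem_lines_or_disjoint C hl.1 hlK).imp ?_ ?_
    · rintro ⟨c, hc⟩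
      refine Finset.mem_biUnion.2 ⟨c, Finset.mem_univ _, Finset.mem_erase.2 ⟨?_, hc⟩⟩
      rintro rfl
      exact hl.2 (hL.left_mem_line (C.ne_κ he c))
    · exact fun h => Finset.mem_filter.2 ⟨hl.1, h, hl.2⟩
  have h1 := (Finset.card_le_card hsub).trans ((Finset.card_insert_le _ _).trans
    (Nat.add_le_add_right (Finset.card_union_le _ _) 1))
  have h2 : #(univ.biUnion fun c => ({l ∈ L | C.κ c ∈ l}.erase K).erase (hL.line e (C.κ c))) + 5 ≤
      ∑ c, f c := by
    have h3 := Finset.card_biUnion_le (s := univ)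
      (t := fun c => ({l ∈ L | C.κ c ∈ l}.erase K).erase (hL.line e (C.κ c)))
    have h4 : ∑ c, #(({l ∈ L | C.κ c ∈ l}.erase K).erase (hL.line e (C.κ c))) + 5 = ∑ c, f c := by
      have h5 : ∑ c : Fin 5, 1 = 5 := by simp
      refine (congrArg (_ + ·) h5.symm).trans ?_
      rw [← Finset.sum_add_distrib]
      exact Finset.sum_congr rfl fun c _ => Finset.card_erase_add_one (hline c)
    omega
  by_cases h6 : 6 ≤ #{l ∈ L | Disjoint l K}
  · obtain ⟨h6', hX, hc⟩ := hL.of_six_le C hq hK hK5 h6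
    have h19 := sum_erase_le_nineteen hf5 (hc 0)
    rw [← Finset.add_sum_erase _ _ (Finset.mem_univ 0)] at h2
    have h0 := hf5 0
    obtain ⟨l, hl, hlK, hel⟩ := hX e he
    have hlt : #{l ∈ L | Disjoint l K ∧ e ∉ l} < #{l ∈ L | Disjoint l K} := by
      refine Finset.card_lt_card ⟨fun l hl => ?_, fun hs => ?_⟩
      · simp only [Finset.mem_filter] at hl ⊢
        exact ⟨hl.1, hl.2.1⟩
      · exact (Finset.mem_filter.1 (hs (Finset.mem_filter.2 ⟨hl, hlK⟩))).2.2 hel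
    omega
  by_contra! hN
  have h25 : ∑ c, f c ≤ 25 := by
    have := Finset.sum_le_card_nsmul univ f 5 fun c _ => hf5 c
    simpa using this
  have hle : #{l ∈ L | Disjoint l K ∧ e ∉ l} ≤ #{l ∈ L | Disjoint l K} := by
    refine Finset.card_le_card fun l hl => ?_
    simp only [Finset.mem_filter] at hl ⊢
    exact ⟨hl.1, hl.2.1⟩
  -- All bounds are attained: five lines miss `K`, none of them contains `e`, and all letters are used.
  have hfeq : ∀ c, f c = 5 := by
    have := (Finset.sum_eq_sum_iff_of_le (s := univ) (g := fun _ => 5) fun c _ => hf5 c).1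
      (by simp; omega)
    exact fun c => this c (Finset.mem_univ c)
  have hemiss : ∀ l ∈ L, Disjoint l K → e ∉ l := by
    intro l hl hlK
    have := Finset.eq_of_subset_of_card_le (s := {l ∈ L | Disjoint l K ∧ e ∉ l})
      (t := {l ∈ L | Disjoint l K}) (by
        intro l hl
        simp only [Finset.mem_filter] at hl ⊢
        exact ⟨hl.1, hl.2.1⟩) (by omega)
    have hl' : l ∈ ({l ∈ L | Disjoint l K} : Finset (Finset P)) := Finset.mem_filter.2 ⟨hl, hlK⟩
    rw [← this] at hl'
    exact (Finset.mem_filter.1 hl').2.2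
  obtain ⟨m, a, hm, hms, ham, hab⟩ := hL.exists_points (k := 5)
    (Finset.filter_subset (Disjoint · K) L) (by omega)
  have hmL : ∀ j, m j ∈ L := fun j => (Finset.mem_filter.1 (hms j)).1
  have hmK : ∀ j, Disjoint (m j) K := fun j => (Finset.mem_filter.1 (hms j)).2
  have haK : ∀ p, a p ∉ K := fun p => Finset.disjoint_left.1 (hmK _) (ham p)
  have hae : ∀ p, a p ≠ e := fun p h => hemiss _ (hmL p.1) (hmK _) (h ▸ ham p)
  have hcode := hL.pairedCode_word C hq hK hK5 hm hmL hmK ham hab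
  have hainj : Function.Injective a := fun p q h => hcode.inj (by rw [h])
  -- Each line through `e` has at most two points besides `e` and its point of `K`.
  have htwo : ∀ c, #(((hL.line e (C.κ c)).erase (C.κ c)).erase e) ≤ 2 := by
    intro c
    have hne := C.ne_κ he c
    rw [Finset.card_erase_of_mem (Finset.mem_erase.2 ⟨hne, hL.left_mem_line hne⟩),
      Finset.card_erase_of_mem (hL.right_mem_line hne)]
    have := h4 _ (hL.line_mem hne) (hL.left_mem_line hne)
    omega
  have hword : ∀ x ∉ K, x ≠ e → ∀ c, C.word hL e c = C.word hL x c →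
      x ∈ ((hL.line e (C.κ c)).erase (C.κ c)).erase e := by
    intro x hx hxe c h
    have hne := C.ne_κ he c
    exact Finset.mem_erase.2 ⟨hxe, Finset.mem_erase.2 ⟨C.ne_κ hx c,
      (C.word_eq_iff_of_mem (hL.line_mem hne) (hL.right_mem_line hne) he hx
        (hL.left_mem_line hne)).1 h⟩⟩
  have hagr : ∀ x ∉ K, x ≠ e → Word.agr (C.word hL e) (C.word hL x) = 1 := fun x hx hxe =>
    C.agr_word_eq_one hK he hx hxe.symm fun l hl hel _ hd => hemiss l hl hd hel
  have hX : ∀ x ∉ K, x ≠ e → ∃ p, a p = x := by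
    have hsub' : univ.image a ⊆
        univ.biUnion fun c => ((hL.line e (C.κ c)).erase (C.κ c)).erase e := by
      intro x hx
      obtain ⟨p, -, rfl⟩ := Finset.mem_image.1 hx
      obtain ⟨c, hc⟩ := Word.agr_eq_one.1 (hagr _ (haK p) (hae p))
      exact Finset.mem_biUnion.2 ⟨c, Finset.mem_univ _, hword _ (haK p) (hae p) c ((hc c).2 rfl)⟩
    have heq := Finset.eq_of_subset_of_card_le hsub' (by
      rw [Finset.card_image_of_injective _ hainj]
      exact Finset.card_biUnion_le_card_mul _ _ 2 fun c _ => htwo c)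
    intro x hx hxe
    obtain ⟨c, hc⟩ := Word.agr_eq_one.1 (hagr x hx hxe)
    have hmem : x ∈ univ.image a := by
      rw [heq]
      exact Finset.mem_biUnion.2 ⟨c, Finset.mem_univ _, hword x hx hxe c ((hc c).2 rfl)⟩
    simpa using hmem
  refine hcode.false_of_five (e := C.word hL e) (fun p => hagr _ (haK p) (hae p)) ?_ ?_
  · intro c
    refine (Finset.card_le_card_of_injOn a ?_ hainj.injOn).trans (htwo c)
    intro p hp
    exact hword _ (haK p) (hae p) c (Finset.mem_filter.1 hp).2.symm
  · intro c s hs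
    have h5 := (hfeq c).symm.trans_le (hL.card_lines_le C hK c)
    have huniv : ({s | ∃ x, x ∉ K ∧ C.word hL x c = s} : Finset (Fin 5)) = univ := by
      rw [← Finset.card_eq_iff_eq_univ]
      refine le_antisymm (Finset.card_le_univ _) ?_
      rw [Fintype.card_fin]
      exact h5
    have hmem := Finset.mem_univ s
    rw [← huniv, Finset.mem_filter] at hmem
    obtain ⟨-, x, hx, hxs⟩ := hmem
    obtain ⟨p, rfl⟩ := hX x hx (fun h => hs (by rw [← hxs, h]))
    exact ⟨p, hxs⟩

/-- If at most `q + 1` lines pass through each point, `2 ≤ q ≤ 5`, then at most `q ^ 2` lines avoid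
a given point. -/
theorem card_avoiding_le [Fintype P] (hL : IsLinearSpace L) {q : ℕ}
    (hq : ∀ x, #{l ∈ L | x ∈ l} ≤ q + 1) (hq2 : 2 ≤ q) (hq5 : q ≤ 5) (e : P) :
    #{l ∈ L | e ∉ l} ≤ q ^ 2 := by
  by_cases hlong : ∃ K ∈ L, q + 1 ≤ #K
  · obtain ⟨K, hK, hKq⟩ := hlong
    exact hL.card_avoiding_le_of_long hq hK hKq e
  push Not at hlong
  by_cases hshort : ∀ l ∈ L, #l ≤ min q 4
  · exact hL.card_avoiding_le_of_short hq hq2 hq5 hshort e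
  push Not at hshort
  obtain ⟨K, hK, hKq⟩ := hshort
  have hKlt := hlong K hK
  obtain rfl : q = 5 := by omega
  by_cases he : ∃ K ∈ L, #K = 5 ∧ e ∈ K
  · obtain ⟨K, hK, hK5, heK⟩ := he
    exact hL.card_avoiding_le_of_mem hq hK hK5 heK
  · push Not at he
    have hK5 : #K = 5 := by omega
    refine hL.card_avoiding_le_of_notMem hq hK hK5 (he K hK hK5) fun l hl hel => ?_
    have h1 := hlong l hl
    have h2 : #l ≠ 5 := fun h => he l hl h hel
    omega

end IsLinearSpace

/-! ### Flats between two flats of a matroid -/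

namespace Matroid

variable {α : Type*} {M : Matroid α} {F G G' H T : Set α} {k q : ℕ}

lemma IsFlat.inter (hF : M.IsFlat F) (hG : M.IsFlat G) : M.IsFlat (F ∩ G) := by
  rw [Set.inter_eq_iInter]
  refine IsFlat.iInter fun b => ?_
  cases b
  · exact hG
  · exact hF

lemma IsFlat.closure_subset (hF : M.IsFlat F) {X : Set α} (h : X ⊆ F) : M.closure X ⊆ F :=
  (M.closure_subset_closure h).trans hF.closure.subset

lemma IsFlat.exists_cover (hF : M.IsFlat F) (hrF : M.eRk F = k) {e : α} (he : e ∈ M.E)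
    (heF : e ∉ F) : M.eRk (M.closure (insert e F)) = (k + 1 : ℕ) := by
  rw [eRk_closure_eq, eRk_insert_eq_add_one (by rw [hF.closure]; exact ⟨he, heF⟩), hrF]
  norm_cast

section Finite
variable [M.Finite]

lemma IsFlat.eq_of_subset_of_eRk_le (hF : M.IsFlat F) (hG : M.IsFlat G) (h : F ⊆ G)
    (hr : M.eRk G ≤ M.eRk F) : F = G := by
  rw [← hF.closure, ← hG.closure]
  exact (RankFinite.isRkFinite F).closure_eq_closure_of_subset_of_eRk_ge_eRk h hr

lemma IsFlat.eRk_lt_of_ssubset (hF : M.IsFlat F) (hG : M.IsFlat G) (h : F ⊂ G) :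
    M.eRk F < M.eRk G := by
  by_contra! hr
  exact h.ne (hF.eq_of_subset_of_eRk_le hG h.subset hr)

/-- The intersection of two distinct flats of rank `k + 1` above a flat of rank `k`. -/
lemma IsFlat.inter_eq (hF : M.IsFlat F) (hG : M.IsFlat G) (hH : M.IsFlat H) (hFG : F ⊆ G)
    (hFH : F ⊆ H) (hrF : M.eRk F = k) (hrG : M.eRk G = (k + 1 : ℕ)) (h : ¬ G ⊆ H) :
    G ∩ H = F := by
  refine (hF.eq_of_subset_of_eRk_le (hG.inter hH) (Set.subset_inter hFG hFH) ?_).symm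
  have hlt := (hG.inter hH).eRk_lt_of_ssubset hG
    ⟨Set.inter_subset_left, fun h' => h (h'.trans Set.inter_subset_right)⟩
  rw [hrG] at hlt
  rw [hrF]
  exact ENat.lt_natCast_add_one_iff.1 (by exact_mod_cast hlt)

/-- The join of a flat `H` with a flat that covers `F ⊆ H` has rank one more than `H`. -/
lemma IsFlat.eRk_union (hF : M.IsFlat F) (hG : M.IsFlat G) (hH : M.IsFlat H) (hFG : F ⊆ G)
    (hFH : F ⊆ H) (hrF : M.eRk F = k) (hrG : M.eRk G = (k + 1 : ℕ)) {m : ℕ} (hrH : M.eRk H = m)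
    (h : ¬ G ⊆ H) : M.eRk (M.closure (G ∪ H)) = (m + 1 : ℕ) := by
  refine le_antisymm ?_ ?_
  · have hs := M.eRk_inter_add_eRk_union_le G H
    rw [hF.inter_eq hG hH hFG hFH hrF hrG h, hrF, hrG, hrH] at hs
    rw [eRk_closure_eq]
    have hne : M.eRk (G ∪ H) ≠ ⊤ := (RankFinite.isRkFinite _).eRk_lt_top.ne
    lift M.eRk (G ∪ H) to ℕ using hne with x
    norm_cast at hs ⊢
    omega
  · have hss : H ⊂ M.closure (G ∪ H) := by
      have hsub := M.subset_closure (G ∪ H) (Set.union_subset hG.subset_ground hH.subset_ground)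
      refine ⟨Set.subset_union_right.trans hsub, fun h' => h ?_⟩
      exact Set.subset_union_left.trans (hsub.trans h')
    have hlt := hH.eRk_lt_of_ssubset (M.isFlat_closure _) hss
    rw [hrH] at hlt
    exact_mod_cast Order.add_one_le_of_lt hlt

variable (M) in
/-- The flats of rank `k` that contain the set `F`. -/
noncomputable def flatsAbove (F : Set α) (k : ℕ) : Finset (Set α) :=
  Set.Finite.toFinset (s := {G | M.IsFlat G ∧ F ⊆ G ∧ M.eRk G = k})
    (M.ground_finite.finite_subsets.subset fun _ h => h.1.subset_ground)

@[simp] lemma mem_flatsAbove : G ∈ M.flatsAbove F k ↔ M.IsFlat G ∧ F ⊆ G ∧ M.eRk G = k := by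
  simp [flatsAbove]

open scoped Classical in
/-- Without a `U_{2,q+2}`-minor, at most `q + 1` flats lie strictly between two flats whose ranks
differ by two: contracting a basis of the lower one and restricting to one element of each of the
flats between gives a uniform matroid of rank two. -/
lemma card_between_le (hM : ¬ M.HasUniformMinor 2 (q + 2)) (hF : M.IsFlat F) (hrF : M.eRk F = k)
    (hrH : M.eRk H = (k + 2 : ℕ)) : #{G ∈ M.flatsAbove F (k + 1) | G ⊆ H} ≤ q + 1 := by
  by_contra! hlt
  obtain ⟨S, hS, hcard⟩ := Finset.exists_subset_card_eq (show q + 2 ≤ _ from hlt)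
  have hS' : ∀ G ∈ S, M.IsFlat G ∧ F ⊆ G ∧ M.eRk G = (k + 1 : ℕ) ∧ G ⊆ H := by
    intro G hG
    have := hS hG
    simp only [Finset.mem_filter, mem_flatsAbove] at this
    tauto
  have hex : ∀ G ∈ S, ∃ e ∈ G, e ∉ F := by
    intro G hG
    obtain ⟨-, -, h, -⟩ := hS' G hG
    by_contra! hGF
    have := M.eRk_mono hGF
    rw [hrF, h] at this
    norm_cast at this
    omega
  obtain ⟨G₀, hG₀⟩ : S.Nonempty := Finset.card_pos.1 (by omega)
  obtain ⟨e₀, -⟩ := hex G₀ hG₀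
  have : Nonempty α := ⟨e₀⟩
  choose! e heG heF using hex
  have hnot : ∀ G ∈ S, ∀ G' ∈ S, G ≠ G' → e G' ∉ G := by
    intro G hG G' hG' hne h
    obtain ⟨h1, h2, h3, -⟩ := hS' G hG
    obtain ⟨h1', h2', h3', -⟩ := hS' G' hG'
    have hsub : ¬ G ⊆ G' := fun h => hne (h1.eq_of_subset_of_eRk_le h1' h (by rw [h3, h3']))
    refine heF G' hG' ?_
    rw [← hF.inter_eq h1 h1' h2 h2' hrF h3 hsub]
    exact ⟨h, heG G' hG'⟩
  have hinj : Set.InjOn e S := by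
    intro G hG G' hG' h
    by_contra hne
    exact hnot G hG G' hG' hne (h ▸ heG G hG)
  obtain ⟨I, hI⟩ := M.exists_isBasis F hF.subset_ground
  have hclI : M.closure I = F := by rw [hI.closure_eq_closure, hF.closure]
  set R : Set α := e '' S with hR
  have hRE : R ⊆ M.E := by
    rintro _ ⟨G, hG, rfl⟩
    exact (hS' G hG).1.subset_ground (heG G hG)
  have hRI : Disjoint R I := by
    rw [Set.disjoint_left]
    rintro _ ⟨G, hG, rfl⟩ h
    exact heF G hG (hI.subset h)
  have hRcard : R.encard = (q + 2 : ℕ) := by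
    rw [hR, hinj.encard_image, Set.encard_coe_eq_coe_finsetCard, hcard]
  have hIenc : I.encard = k := by rw [← hI.eRk_eq_encard, hrF]
  have hpair : ∀ G ∈ S, ∀ G' ∈ S, G ≠ G' → M.Indep (insert (e G') (insert (e G) I)) := by
    intro G hG G' hG' hne
    obtain ⟨h1, h2, h3, -⟩ := hS' G hG
    have h4 : M.Indep (insert (e G) I) :=
      insert_indep_iff.2 ⟨hI.indep, fun _ => ⟨h1.subset_ground (heG G hG), by
        rw [hclI]; exact heF G hG⟩⟩
    refine insert_indep_iff.2 ⟨h4, fun _ => ⟨(hS' G' hG').1.subset_ground (heG G' hG'), fun h => ?_⟩⟩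
    refine hnot G hG G' hG' hne (h1.closure_subset ?_ h)
    exact Set.insert_subset (heG G hG) (hI.subset.trans h2)
  refine hM ⟨(M ／ I) ↾ R, ?_, ?_, ?_⟩
  · exact ⟨I, (M ／ I).E \ R, (delete_compl (Set.subset_sdiff.2 ⟨hRE, hRI⟩)).symm⟩
  · rw [restrict_ground_eq, hRcard]
  · intro J hJ
    rw [restrict_ground_eq] at hJ
    rw [restrict_indep_iff, hI.indep.contract_indep_iff]
    have hJI : Disjoint J I := hRI.mono_left hJ
    constructor
    · rintro ⟨⟨-, h⟩, -⟩
      have hle := h.encard_le_eRk_of_subset (X := H) (Set.union_subset (fun x hx => by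
        obtain ⟨G, hG, rfl⟩ := hJ hx
        exact (hS' G hG).2.2.2 (heG G hG)) (hI.subset.trans ?_))
      · rw [Set.encard_union_eq hJI, hIenc, hrH] at hle
        have hne : J.encard ≠ ⊤ := by
          intro h'
          rw [h'] at hle
          simp at hle
        lift J.encard to ℕ using hne with x
        norm_cast at hle ⊢
        omega
      · exact (hS' G₀ hG₀).2.1.trans (hS' G₀ hG₀).2.2.2
    · intro h
      refine ⟨⟨hJI, ?_⟩, hJ⟩
      obtain ⟨J', hJJ', hJ'R, hJ'⟩ := Set.exists_superset_subset_encard_eq hJ h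
        (by rw [hRcard]; norm_cast; omega)
      obtain ⟨x, y, hxy, rfl⟩ := Set.encard_eq_two.1 hJ'
      obtain ⟨G, hG, rfl⟩ := hJ'R (Set.mem_insert x {y})
      obtain ⟨G', hG', rfl⟩ := hJ'R (Set.mem_insert_of_mem _ (Set.mem_singleton y))
      refine (hpair G' hG' G hG (fun h => hxy (by rw [h]))).subset ?_
      intro z hz
      rcases hz with hz | hz
      · rcases hJJ' hz with rfl | hz
        · exact Set.mem_insert _ _
        · exact Set.mem_insert_of_mem _ (Set.mem_insert_iff.2 (Or.inl hz))
      · simp [hz]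

end Finite

end Matroid

/-! ### The bound for the number of lines -/

namespace Matroid

variable {α : Type*} {M : Matroid α} {F G G' H T : Set α} {k q : ℕ}

lemma subset_join_left (hG : M.IsFlat G) (hG' : M.IsFlat G') : G ⊆ M.closure (G ∪ G') :=
  Set.subset_union_left.trans
    (M.subset_closure _ (Set.union_subset hG.subset_ground hG'.subset_ground))

lemma subset_join_right (hG : M.IsFlat G) (hG' : M.IsFlat G') : G' ⊆ M.closure (G ∪ G') :=
  Set.subset_union_right.trans
    (M.subset_closure _ (Set.union_subset hG.subset_ground hG'.subset_ground))

variable [M.Finite]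

/-- The join of two distinct flats that cover `F`. -/
lemma join_mem_flatsAbove (hF : M.IsFlat F) (hrF : M.eRk F = k) (hG : G ∈ M.flatsAbove F (k + 1))
    (hG' : G' ∈ M.flatsAbove F (k + 1)) (h : G ≠ G') :
    M.closure (G ∪ G') ∈ M.flatsAbove F (k + 2) := by
  rw [mem_flatsAbove] at *
  have hsub : ¬ G ⊆ G' := fun h' => h (hG.1.eq_of_subset_of_eRk_le hG'.1 h'
    (by rw [hG.2.2, hG'.2.2]))
  exact ⟨M.isFlat_closure _, hG.2.1.trans (Set.subset_union_left.trans (M.subset_closure _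
    (Set.union_subset hG.1.subset_ground hG'.1.subset_ground))),
    hF.eRk_union hG.1 hG'.1 hG.2.1 hG'.2.1 hrF hG.2.2 hG'.2.2 hsub⟩

/-- A flat of rank `k + 2` is determined by two distinct covers of `F` below it. -/
lemma eq_join (hF : M.IsFlat F) (hrF : M.eRk F = k) (hG : G ∈ M.flatsAbove F (k + 1))
    (hG' : G' ∈ M.flatsAbove F (k + 1)) (h : G ≠ G') (hH : H ∈ M.flatsAbove F (k + 2))
    (hGH : G ⊆ H) (hGH' : G' ⊆ H) : H = M.closure (G ∪ G') := by
  have hJ := join_mem_flatsAbove hF hrF hG hG' h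
  rw [mem_flatsAbove] at hH hJ
  exact (hJ.1.eq_of_subset_of_eRk_le hH.1 (hH.1.closure_subset (Set.union_subset hGH hGH'))
    (by rw [hH.2.2, hJ.2.2])).symm

lemma exists_cover_subset (hF : M.IsFlat F) (hrF : M.eRk F = k) (hH : M.IsFlat H)
    (hFH : F ⊆ H) {e : α} (he : e ∈ H) (heF : e ∉ F) :
    ∃ G ∈ M.flatsAbove F (k + 1), G ⊆ H ∧ e ∈ G := by
  have heE := hH.subset_ground he
  refine ⟨M.closure (insert e F), ?_, hH.closure_subset (Set.insert_subset he hFH),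
    M.mem_closure_of_mem (Set.mem_insert e F) (Set.insert_subset heE hF.subset_ground)⟩
  rw [mem_flatsAbove]
  exact ⟨M.isFlat_closure _, (Set.subset_insert e F).trans (M.subset_closure _
    (Set.insert_subset heE hF.subset_ground)), hF.exists_cover hrF heE heF⟩

lemma exists_two_covers (hF : M.IsFlat F) (hrF : M.eRk F = k) (hH : H ∈ M.flatsAbove F (k + 2)) :
    ∃ G ∈ M.flatsAbove F (k + 1), ∃ G' ∈ M.flatsAbove F (k + 1), G ≠ G' ∧ G ⊆ H ∧ G' ⊆ H := by
  rw [mem_flatsAbove] at hH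
  have hnot : ∀ G : Set α, M.eRk G = k ∨ M.eRk G = (k + 1 : ℕ) → ∃ e ∈ H, e ∉ G := by
    intro G hG
    by_contra! h
    have hle := M.eRk_mono h
    rcases hG with hG | hG <;>
    · rw [hH.2.2, hG] at hle
      norm_cast at hle
      omega
  obtain ⟨e, heH, heF⟩ := hnot F (Or.inl hrF)
  obtain ⟨G, hG, hGH, -⟩ := exists_cover_subset hF hrF hH.1 hH.2.1 heH heF
  have hG' := mem_flatsAbove.1 hG
  obtain ⟨f, hfH, hfG⟩ := hnot G (Or.inr hG'.2.2)
  obtain ⟨G', hG1, hG2, hG3⟩ := exists_cover_subset hF hrF hH.1 hH.2.1 hfH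
    (fun h => hfG (hG'.2.1 h))
  exact ⟨G, hG, G', hG1, fun h => hfG (h ▸ hG3), hGH, hG2⟩

section Between

open scoped Classical

/-- The flats that cover `F` below `T`, as a type. -/
abbrev CoverBelow (M : Matroid α) [M.Finite] (F : Set α) (k : ℕ) (T : Set α) : Type _ :=
  {G : Set α // G ∈ {G ∈ M.flatsAbove F (k + 1) | G ⊆ T}}

/-- The covers of `F` below `T` that a flat `H` contains. -/
noncomputable def coversIn (F : Set α) (k : ℕ) (T H : Set α) : Finset (CoverBelow M F k T) :=
  univ.filter fun G => G.1 ⊆ H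

/-- The linear space of the flats of ranks `k + 1` and `k + 2` between `F` and `T`. -/
noncomputable def linesBetween (M : Matroid α) [M.Finite] (F : Set α) (k : ℕ) (T : Set α) :
    Finset (Finset (CoverBelow M F k T)) :=
  {H ∈ M.flatsAbove F (k + 2) | H ⊆ T}.image (coversIn F k T)

lemma mem_coversIn {G : CoverBelow M F k T} : G ∈ coversIn F k T H ↔ G.1 ⊆ H := by
  simp [coversIn]

lemma CoverBelow.mem (G : CoverBelow M F k T) : G.1 ∈ M.flatsAbove F (k + 1) :=
  (Finset.mem_filter.1 G.2).1

lemma CoverBelow.subset (G : CoverBelow M F k T) : G.1 ⊆ T := (Finset.mem_filter.1 G.2).2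

lemma coversIn_injOn (hF : M.IsFlat F) (hrF : M.eRk F = k) :
    Set.InjOn (coversIn (M := M) F k T) {H | H ∈ M.flatsAbove F (k + 2) ∧ H ⊆ T} := by
  intro H hH H' hH' h
  obtain ⟨G, hG, G', hG', hne, h1, h2⟩ := exists_two_covers hF hrF hH.1
  have key : ∀ G ∈ M.flatsAbove F (k + 1), G ⊆ H → G ⊆ H' := by
    intro G hG hGH
    have hmem : (⟨G, Finset.mem_filter.2 ⟨hG, hGH.trans hH.2⟩⟩ : CoverBelow M F k T) ∈
      coversIn F k T H := mem_coversIn.2 hGH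
    rw [h] at hmem
    exact mem_coversIn.1 hmem
  rw [eq_join hF hrF hG hG' hne hH.1 h1 h2,
    eq_join hF hrF hG hG' hne hH'.1 (key G hG h1) (key G' hG' h2)]

lemma isLinearSpace_linesBetween (hF : M.IsFlat F) (hrF : M.eRk F = k) (hT : M.IsFlat T) :
    IsLinearSpace (linesBetween M F k T) where
  exists_line x y hxy := by
    have hne : x.1 ≠ y.1 := fun h => hxy (Subtype.ext h)
    have hx := (mem_flatsAbove.1 x.mem).1
    have hy := (mem_flatsAbove.1 y.mem).1
    exact ⟨_, Finset.mem_image_of_mem _ (Finset.mem_filter.2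
      ⟨join_mem_flatsAbove hF hrF x.mem y.mem hne,
        hT.closure_subset (Set.union_subset x.subset y.subset)⟩),
      mem_coversIn.2 (subset_join_left hx hy), mem_coversIn.2 (subset_join_right hx hy)⟩
  unique l hl m hm x y hxy hxl hyl hxm hym := by
    obtain ⟨H, hH, rfl⟩ := Finset.mem_image.1 hl
    obtain ⟨H', hH', rfl⟩ := Finset.mem_image.1 hm
    rw [mem_coversIn] at *
    have hne : x.1 ≠ y.1 := fun h => hxy (Subtype.ext h)
    rw [eq_join hF hrF x.mem y.mem hne (Finset.mem_filter.1 hH).1 hxl hyl,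
      eq_join hF hrF x.mem y.mem hne (Finset.mem_filter.1 hH').1 hxm hym]
  two_le_card l hl := by
    obtain ⟨H, hH, rfl⟩ := Finset.mem_image.1 hl
    rw [Finset.mem_filter] at hH
    obtain ⟨G, hG, G', hG', hne, h1, h2⟩ := exists_two_covers hF hrF hH.1
    refine Finset.one_lt_card.2 ⟨⟨G, Finset.mem_filter.2 ⟨hG, h1.trans hH.2⟩⟩, mem_coversIn.2 h1,
      ⟨G', Finset.mem_filter.2 ⟨hG', h2.trans hH.2⟩⟩, mem_coversIn.2 h2, ?_⟩
    simpa using hne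

lemma card_linesBetween_mem_le (hM : ¬ M.HasUniformMinor 2 (q + 2))
    (hrT : M.eRk T = (k + 3 : ℕ)) (x : CoverBelow M F k T) :
    #{l ∈ linesBetween M F k T | x ∈ l} ≤ q + 1 := by
  have hx := mem_flatsAbove.1 x.mem
  refine le_trans (le_trans (Finset.card_le_card ?_) (Finset.card_image_le (f := coversIn F k T)))
    (card_between_le hM hx.1 hx.2.2 hrT)
  intro l hl
  rw [Finset.mem_filter] at hl
  obtain ⟨H, hH, rfl⟩ := Finset.mem_image.1 hl.1
  rw [Finset.mem_filter, mem_flatsAbove] at hH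
  refine Finset.mem_image_of_mem _ (Finset.mem_filter.2 ⟨mem_flatsAbove.2 ⟨hH.1.1, ?_, hH.1.2.2⟩,
    hH.2⟩)
  exact mem_coversIn.1 hl.2

/-- Between flats `F` and `T` whose ranks differ by three, at most `q ^ 2` flats of rank `k + 2`
avoid a given cover of `F`. -/
lemma card_avoiding_le (hM : ¬ M.HasUniformMinor 2 (q + 2)) (hq2 : 2 ≤ q) (hq5 : q ≤ 5)
    (hF : M.IsFlat F) (hrF : M.eRk F = k) (hT : M.IsFlat T) (hrT : M.eRk T = (k + 3 : ℕ))
    (hG : G ∈ M.flatsAbove F (k + 1)) (hGT : G ⊆ T) :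
    #{H ∈ M.flatsAbove F (k + 2) | H ⊆ T ∧ ¬ G ⊆ H} ≤ q ^ 2 := by
  have h := (isLinearSpace_linesBetween hF hrF hT).card_avoiding_le
    (fun x => by convert card_linesBetween_mem_le hM hrT x) hq2 hq5
    ⟨G, Finset.mem_filter.2 ⟨hG, hGT⟩⟩
  refine le_trans ?_ h
  refine Finset.card_le_card_of_injOn (coversIn F k T) ?_ ?_
  · intro H hH
    rw [Finset.mem_coe, Finset.mem_filter] at hH
    rw [Finset.mem_coe, Finset.mem_filter, mem_coversIn]
    exact ⟨Finset.mem_image_of_mem _ (Finset.mem_filter.2 ⟨hH.1, hH.2.1⟩), hH.2.2⟩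
  · refine (coversIn_injOn hF hrF).mono fun H hH => ?_
    rw [Finset.mem_coe, Finset.mem_filter] at hH
    exact ⟨hH.1, hH.2.1⟩

end Between

/-- Projection from a cover `G` of `F`, on the covers of `F`. -/
lemma card_flatsAbove_add_one_le (hM : ¬ M.HasUniformMinor 2 (q + 2)) (hF : M.IsFlat F)
    (hrF : M.eRk F = k) (hG : G ∈ M.flatsAbove F (k + 1)) :
    #(M.flatsAbove F (k + 1)) ≤ 1 + q * #(M.flatsAbove G (k + 2)) := by
  classical
  have hG' := mem_flatsAbove.1 hG
  rw [← Finset.card_erase_add_one hG, add_comm]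
  refine Nat.add_le_add_left ?_ 1
  refine Finset.card_le_mul_card_image_of_maps_to (f := fun G' => M.closure (G ∪ G')) ?_ q ?_
  · intro G' hG1
    rw [Finset.mem_erase] at hG1
    have h := mem_flatsAbove.1 (join_mem_flatsAbove hF hrF hG hG1.2 hG1.1.symm)
    exact mem_flatsAbove.2 ⟨h.1, subset_join_left hG'.1 (mem_flatsAbove.1 hG1.2).1, h.2.2⟩
  · intro H hH
    rw [mem_flatsAbove] at hH
    have hle := card_between_le hM hF hrF hH.2.2
    rw [← Finset.card_erase_add_one (Finset.mem_filter.2 ⟨hG, hH.2.1⟩)] at hle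
    refine le_trans (Finset.card_le_card fun G1 hG1 => ?_) (Nat.le_of_succ_le_succ hle)
    rw [Finset.mem_filter, Finset.mem_erase] at hG1
    refine Finset.mem_erase.2 ⟨hG1.1.1, Finset.mem_filter.2 ⟨hG1.1.2, ?_⟩⟩
    rw [← hG1.2]
    exact subset_join_right hG'.1 (mem_flatsAbove.1 hG1.1.2).1

/-- Projection from a cover `G` of `F`, on the flats of rank two over `F`. -/
lemma card_flatsAbove_add_two_le (hM : ¬ M.HasUniformMinor 2 (q + 2)) (hq2 : 2 ≤ q) (hq5 : q ≤ 5)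
    (hF : M.IsFlat F) (hrF : M.eRk F = k) (hG : G ∈ M.flatsAbove F (k + 1)) :
    #(M.flatsAbove F (k + 2)) ≤
      #(M.flatsAbove G (k + 2)) + q ^ 2 * #(M.flatsAbove G (k + 3)) := by
  classical
  have hG' := mem_flatsAbove.1 hG
  rw [← Finset.card_filter_add_card_filter_not (s := M.flatsAbove F (k + 2)) (G ⊆ ·)]
  refine Nat.add_le_add (Finset.card_le_card fun H hH => ?_) ?_
  · rw [Finset.mem_filter, mem_flatsAbove] at hH
    exact mem_flatsAbove.2 ⟨hH.1.1, hH.2, hH.1.2.2⟩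
  · refine Finset.card_le_mul_card_image_of_maps_to (f := fun H => M.closure (G ∪ H)) ?_ _ ?_
    · intro H hH
      rw [Finset.mem_filter, mem_flatsAbove] at hH
      exact mem_flatsAbove.2 ⟨M.isFlat_closure _, subset_join_left hG'.1 hH.1.1,
        hF.eRk_union hG'.1 hH.1.1 hG'.2.1 hH.1.2.1 hrF hG'.2.2 hH.1.2.2 hH.2⟩
    · intro T hT
      rw [mem_flatsAbove] at hT
      refine le_trans (Finset.card_le_card fun H hH => ?_)
        (card_avoiding_le hM hq2 hq5 hF hrF hT.1 hT.2.2 hG hT.2.1)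
      rw [Finset.mem_filter, Finset.mem_filter] at hH
      refine Finset.mem_filter.2 ⟨hH.1.1, ?_, hH.1.2⟩
      rw [← hH.2]
      exact subset_join_right hG'.1 (mem_flatsAbove.1 hH.1.1).1

/-- The numbers `[j choose 1]_q` and `[j choose 2]_q`, by the recursions that projection from a
point gives. -/
def gaussOneTwo (q : ℕ) : ℕ → ℕ × ℕ
  | 0 => (0, 0)
  | j + 1 => (1 + q * (gaussOneTwo q j).1, (gaussOneTwo q j).1 + q ^ 2 * (gaussOneTwo q j).2)

lemma flatsAbove_eq_empty {r : ℕ} (hr : M.eRank = r) (hk : r < k) : M.flatsAbove F k = ∅ := by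
  rw [Finset.eq_empty_iff_forall_notMem]
  intro G hG
  have h := M.eRk_le_eRank G
  rw [(mem_flatsAbove.1 hG).2.2, hr] at h
  norm_cast at h
  omega

/-- Bounds for the numbers of flats of ranks one and two over a flat of corank `j`. -/
lemma card_flatsAbove_le (hM : ¬ M.HasUniformMinor 2 (q + 2)) (hq2 : 2 ≤ q) (hq5 : q ≤ 5) {r : ℕ}
    (hr : M.eRank = r) (j : ℕ) (hF : M.IsFlat F) (hrF : M.eRk F = k) (hj : k + j = r) :
    #(M.flatsAbove F (k + 1)) ≤ (gaussOneTwo q j).1 ∧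
      #(M.flatsAbove F (k + 2)) ≤ (gaussOneTwo q j).2 := by
  induction j generalizing F k with
  | zero => simp [flatsAbove_eq_empty hr (show r < k + 1 by omega),
      flatsAbove_eq_empty hr (show r < k + 2 by omega)]
  | succ j ih =>
    by_cases hex : ∃ G, G ∈ M.flatsAbove F (k + 1)
    · obtain ⟨G, hG⟩ := hex
      have hG' := mem_flatsAbove.1 hG
      obtain ⟨h1, h2⟩ := ih hG'.1 hG'.2.2 (by omega)
      refine ⟨(card_flatsAbove_add_one_le hM hF hrF hG).trans ?_,
        (card_flatsAbove_add_two_le hM hq2 hq5 hF hrF hG).trans ?_⟩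
      · exact Nat.add_le_add_left (Nat.mul_le_mul_left q h1) 1
      · exact Nat.add_le_add h1 (Nat.mul_le_mul_left _ h2)
    · push Not at hex
      have h1 : M.flatsAbove F (k + 1) = ∅ := Finset.eq_empty_of_forall_notMem hex
      have h2 : M.flatsAbove F (k + 2) = ∅ := by
        refine Finset.eq_empty_of_forall_notMem fun H hH => ?_
        obtain ⟨G, hG, -⟩ := exists_two_covers hF hrF hH
        exact hex G hG
      simp [h1, h2]

end Matroid

open Matroid in
lemma gaussOneTwo_fst (q : ℕ) (j : ℕ) :
    ((gaussOneTwo q j).1 : ℚ) * (q - 1) = q ^ j - 1 := by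
  induction j with
  | zero => simp [gaussOneTwo]
  | succ j ih =>
    simp only [gaussOneTwo]
    push_cast
    linear_combination (q : ℚ) * ih

open Matroid in
lemma gaussOneTwo_snd (q : ℕ) (hq : 2 ≤ q) (j : ℕ) :
    ((gaussOneTwo q (j + 1)).2 : ℚ) = qBinomTwo q (j + 1) := by
  have hq' : (2 : ℚ) ≤ q := by exact_mod_cast hq
  rw [qBinomTwo, eq_div_iff (by
    have : (0 : ℚ) < q - 1 := by linarith
    have : (0 : ℚ) < (q : ℚ) ^ 2 - 1 := by nlinarith
    positivity), Nat.add_sub_cancel]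
  induction j with
  | zero => simp [gaussOneTwo]
  | succ j ih =>
    rw [gaussOneTwo]
    push_cast
    linear_combination ((q : ℚ) ^ 2 - 1) * gaussOneTwo_fst q (j + 1) + (q : ℚ) ^ 2 * ih

/-- The bound on the number of lines for `q ≤ 5`. -/
theorem boninConjecture_of_le_five {q : ℕ} (hq2 : 2 ≤ q) (hq5 : q ≤ 5) : BoninConjecture.{u} q := by
  intro r hr α M hfin hrank hM
  obtain ⟨j, rfl⟩ : ∃ j, r = j + 1 := ⟨r - 1, by omega⟩
  rw [← gaussOneTwo_snd q hq2 j]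
  have h := (Matroid.card_flatsAbove_le (F := M.closure ∅) (k := 0) hM hq2 hq5 hrank (j + 1)
    (M.isFlat_closure _) (by simp) (by omega)).2
  have hlines : M.lines = (M.flatsAbove (M.closure ∅) 2 : Set (Set α)) := by
    ext L
    simp only [Matroid.lines, Set.mem_ofPred_eq, Finset.mem_coe, Matroid.mem_flatsAbove]
    constructor
    · rintro ⟨h1, h2⟩
      exact ⟨h1, h1.closure_subset (Set.empty_subset _), by exact_mod_cast h2⟩
    · rintro ⟨h1, -, h2⟩
      exact ⟨h1, by exact_mod_cast h2⟩
  rw [hlines, Set.ncard_coe_finset]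
  exact_mod_cast h

/-! ### The matroid of a linear space -/

namespace IsLinearSpace

lemma ncard_triple_le {P : Type*} {x y z : P} : ({x, y, z} : Set P).ncard ≤ 3 :=
  (Set.ncard_insert_le x {y, z}).trans (Nat.add_le_add_right (Set.ncard_insert_le y {z}) 1 |>.trans
    (by simp))

variable {P : Type*} [Finite P] {L : Finset (Finset P)}

/-- Three points off a common line meet each line in at most two points. -/
lemma ncard_inter_le (hL : IsLinearSpace L) {x y z : P} (hxy : x ≠ y) {l : Finset P} (hl : l ∈ L)
    (hx : x ∈ l) (hy : y ∈ l) (hz : z ∉ l) {m : Finset P} (hm : m ∈ L) :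
    (({z, x, y} : Set P) ∩ m).ncard ≤ 2 := by
  by_contra! h
  have heq : ({z, x, y} : Set P) ∩ m = {z, x, y} :=
    Set.eq_of_subset_of_ncard_le Set.inter_subset_left (ncard_triple_le.trans h) (Set.toFinite _)
  have hsub : ({z, x, y} : Set P) ⊆ m := heq ▸ Set.inter_subset_right
  have hlm := hL.unique l hl m hm x y hxy hx hy (hsub (by simp)) (hsub (by simp))
  exact hz (hlm ▸ hsub (by simp))

/-- The matroid of rank at most three of a linear space: a set is independent if it has at most
three points, not three of them on a line. -/
noncomputable def matroid (hL : IsLinearSpace L) : Matroid P :=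
  (IndepMatroid.ofFinite (E := Set.univ) (Set.toFinite _)
    (fun I => I.ncard ≤ 3 ∧ ∀ l ∈ L, (I ∩ l).ncard ≤ 2)
    (by simp)
    (fun I J hJ hIJ => ⟨(Set.ncard_le_ncard hIJ).trans hJ.1, fun l hl =>
      (Set.ncard_le_ncard (Set.inter_subset_inter_left _ hIJ)).trans (hJ.2 l hl)⟩)
    (by
      intro I J hI hJ hIJ
      by_cases h2 : I.ncard ≤ 1
      · obtain ⟨e, heJ, heI⟩ := Set.exists_mem_notMem_of_ncard_lt_ncard hIJ
        have hle : (insert e I).ncard ≤ 2 := (Set.ncard_insert_le e I).trans (by omega)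
        exact ⟨e, heJ, heI, by omega, fun l _ =>
          (Set.ncard_le_ncard Set.inter_subset_left).trans hle⟩
      · have hI2 : I.ncard = 2 := by have := hJ.1; omega
        obtain ⟨x, y, hxy, rfl⟩ := Set.ncard_eq_two.1 hI2
        have hnot : ¬ J ⊆ hL.line x y := by
          intro h
          have := hJ.2 _ (hL.line_mem hxy)
          rw [Set.inter_eq_left.2 h] at this
          omega
        obtain ⟨e, heJ, he⟩ := Set.not_subset.1 hnot
        refine ⟨e, heJ, ?_, ncard_triple_le, fun m hm => hL.ncard_inter_le hxy (hL.line_mem hxy)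
          (hL.left_mem_line hxy) (hL.right_mem_line hxy) (by simpa using he) hm⟩
        rintro (rfl | rfl)
        · exact he (hL.left_mem_line hxy)
        · exact he (hL.right_mem_line hxy))
    (fun _ _ => Set.subset_univ _)).matroid

section matroid
variable (hL : IsLinearSpace L) {I : Set P} {x y z : P} {l : Finset P}

lemma matroid_finite : hL.matroid.Finite := ⟨Set.toFinite _⟩

lemma matroid_indep_pair (x y : P) : hL.matroid.Indep {x, y} := by
  have h : ({x, y} : Set P).ncard ≤ 2 := (Set.ncard_insert_le x {y}).trans (by simp)
  exact ⟨by omega, fun l _ => (Set.ncard_le_ncard Set.inter_subset_left).trans h⟩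

lemma matroid_indep_triple (hxy : x ≠ y) (hl : l ∈ L) (hx : x ∈ l) (hy : y ∈ l) (hz : z ∉ l) :
    hL.matroid.Indep {z, x, y} :=
  ⟨ncard_triple_le, fun _ hm => hL.ncard_inter_le hxy hl hx hy hz hm⟩

lemma encard_le_two_of_indep (hI : hL.matroid.Indep I) (hl : l ∈ L) (h : I ⊆ l) :
    I.encard ≤ 2 := by
  have := hI.2 l hl
  rw [Set.inter_eq_left.2 h] at this
  rw [← (Set.toFinite I).cast_ncard_eq]
  exact_mod_cast this

lemma encard_le_three_of_indep (hI : hL.matroid.Indep I) : I.encard ≤ 3 := by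
  rw [← (Set.toFinite I).cast_ncard_eq]
  exact_mod_cast hI.1

/-- Each line of the linear space is a line of the matroid. -/
lemma mem_lines_matroid (hl : l ∈ L) : (l : Set P) ∈ hL.matroid.lines := by
  obtain ⟨x, hx, y, hy, hxy⟩ := Finset.one_lt_card.1 (hL.two_le_card l hl)
  have hpair : hL.matroid.IsBasis {x, y} l := by
    refine (hL.matroid_indep_pair x y).isBasis_of_forall_insert ?_ ?_
    · rintro z (rfl | rfl) <;> assumption
    · rintro z ⟨hzl, hz⟩
      refine (Matroid.not_indep_iff (Set.subset_univ _)).1 fun h => ?_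
      have hle := hL.encard_le_two_of_indep h hl
        (Set.insert_subset hzl (Set.insert_subset hx (Set.singleton_subset_iff.2 hy)))
      rw [Set.encard_insert_of_notMem hz, Set.encard_pair hxy] at hle
      norm_num at hle
  refine ⟨?_, by rw [hpair.eRk_eq_encard, Set.encard_pair hxy]⟩
  rw [Matroid.isFlat_iff_closure_eq]
  refine Set.Subset.antisymm ?_ (hL.matroid.subset_closure _ (Set.subset_univ _))
  rw [← hpair.closure_eq_closure]
  intro z hz
  by_contra hzl
  have hzn : z ∉ ({x, y} : Set P) := by
    rintro (rfl | rfl) <;> exact hzl (by assumption)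
  have hind := hL.matroid_indep_triple hxy hl hx hy hzl
  have hdep := ((hL.matroid_indep_pair x y).insert_dep_iff (e := z)).2 ⟨hz, hzn⟩
  exact hdep.not_indep hind

lemma eRank_matroid (hl : l ∈ L) (hz : z ∉ l) : hL.matroid.eRank = 3 := by
  obtain ⟨x, hx, y, hy, hxy⟩ := Finset.one_lt_card.1 (hL.two_le_card l hl)
  refine le_antisymm ?_ ?_
  · obtain ⟨B, hB⟩ := hL.matroid.exists_isBase
    rw [← hB.encard_eq_eRank]
    exact hL.encard_le_three_of_indep hB.indep
  · have h := (hL.matroid_indep_triple hxy hl hx hy hz).encard_le_eRank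
    rw [Set.encard_insert_of_notMem, Set.encard_pair hxy] at h
    · norm_num at h
      exact h
    · rintro (rfl | rfl) <;> exact hz (by assumption)

open scoped Classical in
/-- If each point is on at most `q + 1` lines, and not all points are on one line, then a
`U_{2,q+2}`-minor would consist of points on a line, if nothing is contracted, and of points on
different lines through `x`, if the contracted set has rank one and contains `x`. -/
lemma not_hasUniformMinor_matroid {q : ℕ} (hdeg : ∀ x, #{l ∈ L | x ∈ l} ≤ q + 1)
    (hout : ∀ l ∈ L, ∃ x, x ∉ l) : ¬ hL.matroid.HasUniformMinor 2 (q + 2) := by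
  rintro ⟨N, hN, hcard, hind⟩
  obtain ⟨C, D, hC, -, -, rfl⟩ := hN.exists_eq_contract_delete_disjoint
  set R := ((hL.matroid.contract C).delete D).E with hR
  obtain ⟨I, hI⟩ := hL.matroid.exists_isBasis C hC
  have hRfin : R.Finite := Set.toFinite R
  have hiff : ∀ J ⊆ R, hL.matroid.Indep (J ∪ I) ↔ J.encard ≤ 2 := by
    intro J hJ
    rw [← Nat.cast_ofNat, ← hind J hJ, Matroid.delete_indep_iff, hI.contract_indep_iff]
    have hJ' : J ⊆ (hL.matroid.E \ C) \ D := hJ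
    have h1 : Disjoint C J := (Set.disjoint_sdiff_right (s := C) (t := hL.matroid.E)).mono_right
      (hJ'.trans Set.sdiff_subset)
    have h2 : Disjoint J D := (Set.disjoint_sdiff_left).mono_left hJ'
    simp [h1, h2]
  have hRI : Disjoint R I := by
    have hR' : R ⊆ hL.matroid.E \ C := by rw [hR]; exact Set.sdiff_subset
    exact Set.disjoint_sdiff_left.mono hR' hI.subset
  have hRncard : R.ncard = q + 2 := by
    rw [← hRfin.cast_ncard_eq] at hcard
    exact_mod_cast hcard
  obtain ⟨u, hu, v, hv, huv⟩ := (Set.one_lt_ncard hRfin).1 (by omega : 1 < R.ncard)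
  have huvR : ({u, v} : Set P) ⊆ R := Set.insert_subset hu (Set.singleton_subset_iff.2 hv)
  have huv2 : ({u, v} : Set P).encard ≤ 2 := (Set.encard_pair huv).le
  rcases I.eq_empty_or_nonempty with rfl | ⟨x, hx⟩
  · -- All points of `R` are on the line of two of them.
    have hsub : R ⊆ hL.line u v := by
      intro w hw
      by_contra h
      have hw3 := (hiff {w, u, v} (Set.insert_subset hw huvR)).1 (by
        rw [Set.union_empty]
        exact hL.matroid_indep_triple huv (hL.line_mem huv) (hL.left_mem_line huv)
          (hL.right_mem_line huv) h)
      rw [Set.encard_insert_of_notMem, Set.encard_pair huv] at hw3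
      · norm_num at hw3
      · rintro (rfl | rfl)
        · exact h (hL.left_mem_line huv)
        · exact h (hL.right_mem_line huv)
    obtain ⟨z, hz⟩ := hout _ (hL.line_mem huv)
    have h1 := (hL.card_le_degree (hL.line_mem huv) hz).trans (hdeg z)
    have h2 := Set.ncard_le_ncard hsub
    rw [Set.ncard_coe_finset] at h2
    omega
  · -- The lines from `x` to the points of `R` are distinct.
    have hRx : ∀ w ∈ R, x ≠ w := fun w hw h => Set.disjoint_left.1 hRI hw (h ▸ hx)
    have hinj : Set.InjOn (hL.line x) hRfin.toFinset := by
      intro w hw w' hw' h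
      simp only [Set.Finite.coe_toFinset] at hw hw'
      by_contra hne
      have hww : ({w, w'} : Set P) ⊆ R := Set.insert_subset hw (Set.singleton_subset_iff.2 hw')
      have h3 := ((hiff {w, w'} hww).2 (Set.encard_pair hne).le).subset
        (Set.union_subset_union_right {w, w'} (Set.singleton_subset_iff.2 hx))
      have hle := hL.encard_le_two_of_indep h3 (hL.line_mem (hRx w hw)) (by
        rintro z ((rfl | rfl) | rfl)
        · exact hL.right_mem_line (hRx _ hw)
        · rw [h]; exact hL.right_mem_line (hRx _ hw')
        · exact hL.left_mem_line (hRx _ hw))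
      rw [Set.union_singleton, Set.encard_insert_of_notMem, Set.encard_pair hne] at hle
      · norm_num at hle
      · rintro (h | h)
        · exact hRx w hw h
        · exact hRx w' hw' h
    have hle := Finset.card_le_card_of_injOn (t := L.filter (x ∈ ·)) _ (fun w hw => by
      have hw' : w ∈ R := by simpa using hw
      exact Finset.mem_coe.2 (Finset.mem_filter.2 ⟨hL.line_mem (hRx w hw'),
        hL.left_mem_line (hRx w hw')⟩)) hinj
    rw [← Set.ncard_eq_toFinset_card R hRfin] at hle
    have := hdeg x
    omega

end matroid

end IsLinearSpace

lemma qBinomTwo_three {q : ℕ} (hq : 2 ≤ q) : qBinomTwo q 3 = q ^ 2 + q + 1 := by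
  have hq' : (2 : ℚ) ≤ q := by exact_mod_cast hq
  have h1 : (q : ℚ) - 1 ≠ 0 := by linarith
  have h2 : (q : ℚ) ^ 2 - 1 ≠ 0 := by nlinarith
  rw [qBinomTwo, div_eq_iff (mul_ne_zero h1 h2)]
  ring

open scoped Classical in
/-- A linear space with few lines through each point, and too many lines in all, refutes the
bound in rank three. -/
lemma IsLinearSpace.not_boninConjecture {P : Type u} [Finite P] {L : Finset (Finset P)}
    (hL : IsLinearSpace L) {q : ℕ} (hq : 2 ≤ q) (hdeg : ∀ x, #{l ∈ L | x ∈ l} ≤ q + 1)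
    (hcard : q ^ 2 + q + 1 < #L) : ¬ BoninConjecture.{u} q := by
  intro h
  have hout : ∀ l ∈ L, ∃ x, x ∉ l := by
    intro l hl
    obtain ⟨m, hm, hml⟩ := Finset.exists_mem_ne (by omega : 1 < #L) l
    obtain ⟨x, -, hx⟩ := hL.exists_mem_notMem hl hm hml
    exact ⟨x, hx⟩
  obtain ⟨l, hl⟩ := Finset.card_pos.1 (by omega : 0 < #L)
  obtain ⟨z, hz⟩ := hout l hl
  have hle := h 3 (by norm_num) P hL.matroid hL.matroid_finite (hL.eRank_matroid hl hz)
    (hL.not_hasUniformMinor_matroid hdeg hout)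
  rw [qBinomTwo_three hq] at hle
  have hsub : ((fun l : Finset P => (l : Set P)) '' L).ncard ≤ hL.matroid.lines.ncard := by
    refine Set.ncard_le_ncard ?_ (Set.toFinite _)
    rintro _ ⟨l, hl, rfl⟩
    exact hL.mem_lines_matroid hl
  rw [Set.ncard_image_of_injective _ Finset.coe_injective, Set.ncard_coe_finset] at hsub
  have : hL.matroid.lines.ncard ≤ q ^ 2 + q + 1 := by exact_mod_cast hle
  omega

/-! ### Linear spaces with many lines -/

section transport
variable {P P' : Type*} {S : Finset (Finset P)}

/-- The image of a linear space under a bijection. -/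
lemma IsLinearSpace.map (hS : IsLinearSpace S) (e : P ≃ P') :
    IsLinearSpace (S.map (Finset.mapEmbedding e.toEmbedding).toEmbedding) where
  exists_line x y hxy := by
    obtain ⟨l, hl, hx, hy⟩ := hS.exists_line (e.symm x) (e.symm y) (by simpa using hxy)
    exact ⟨l.map e.toEmbedding, Finset.mem_map_of_mem _ hl, by simpa using hx, by simpa using hy⟩
  unique l hl m hm x y hxy hxl hyl hxm hym := by
    obtain ⟨l, hlS, rfl⟩ := Finset.mem_map.1 hl
    obtain ⟨m, hmS, rfl⟩ := Finset.mem_map.1 hm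
    rw [hS.unique l hlS m hmS (e.symm x) (e.symm y) (by simpa using hxy) (by simpa using hxl)
      (by simpa using hyl) (by simpa using hxm) (by simpa using hym)]
  two_le_card l hl := by
    obtain ⟨l, hlS, rfl⟩ := Finset.mem_map.1 hl
    simpa using hS.two_le_card l hlS

lemma card_filter_mem_map [DecidableEq P] [DecidableEq P'] (e : P ≃ P') (x : P') :
    #{l ∈ S.map (Finset.mapEmbedding e.toEmbedding).toEmbedding | x ∈ l} =
      #{l ∈ S | e.symm x ∈ l} := by
  rw [Finset.filter_map, Finset.card_map]
  congr 1
  ext l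
  simp

end transport

/-- There is a linear space with `v` points and `s` lines, at most `d` of them through each
point. -/
def HasLinearSpace (v d s : ℕ) : Prop :=
  ∃ S : Finset (Finset (Fin v)), IsLinearSpace S ∧ (∀ x, #{l ∈ S | x ∈ l} ≤ d) ∧ #S = s

lemma IsLinearSpace.hasLinearSpace {P : Type*} [Fintype P] [DecidableEq P] {S : Finset (Finset P)}
    (hS : IsLinearSpace S) {v d : ℕ} (hv : Fintype.card P = v)
    (hd : ∀ x, #{l ∈ S | x ∈ l} ≤ d) : HasLinearSpace v d #S := by
  refine ⟨_, hS.map (Fintype.equivFinOfCardEq hv), fun x => ?_, Finset.card_map _⟩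
  rw [card_filter_mem_map]
  exact hd _

lemma mem_group {F : Type*} {g : Option F} {k : Finset F} {x : Option F × F} :
    x ∈ ({g} ×ˢ k : Finset (Option F × F)) ↔ x.1 = g ∧ x.2 ∈ k := by
  rw [Finset.mem_product, Finset.mem_singleton]

section transversal
variable {F : Type*} [Field F] [Fintype F] [DecidableEq F]

/-- A line of slope `m` in the affine plane over `F`, with its direction as the value at `none`. -/
def lineVal (m b : F) : Option F → F
  | some g => m * g + b
  | none => m

/-- The blocks of the transversal design with groups `{g} × F`, for `g : Option F`. -/
def transversalBlock (c : F × F) : Finset (Option F × F) :=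
  univ.image fun g => (g, lineVal c.1 c.2 g)

lemma mem_transversalBlock {c : F × F} {x : Option F × F} :
    x ∈ transversalBlock c ↔ x.2 = lineVal c.1 c.2 x.1 := by
  obtain ⟨g, y⟩ := x
  simp [transversalBlock, eq_comm]

/-- Two points in different groups lie in a unique block. -/
lemma existsUnique_transversalBlock {x y : Option F × F} (h : x.1 ≠ y.1) :
    ∃! c : F × F, x ∈ transversalBlock c ∧ y ∈ transversalBlock c := by
  obtain ⟨g, x⟩ := x
  obtain ⟨g', y⟩ := y
  simp only [mem_transversalBlock]
  cases g with
  | none =>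
    cases g' with
    | none => exact absurd rfl h
    | some g' =>
      simp only [lineVal]
      refine ⟨(x, y - x * g'), by simp, ?_⟩
      rintro ⟨m, b⟩ ⟨rfl, rfl⟩
      simp
  | some g =>
    cases g' with
    | none =>
      simp only [lineVal]
      refine ⟨(y, x - y * g), by simp, ?_⟩
      rintro ⟨m, b⟩ ⟨rfl, rfl⟩
      simp
    | some g' =>
      have hg : g - g' ≠ 0 := sub_ne_zero.2 fun h' => h (by rw [h'])
      simp only [lineVal]
      refine ⟨((x - y) / (g - g'), x - (x - y) / (g - g') * g), ⟨by simp, ?_⟩, ?_⟩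
      · simp only
        field_simp
        ring
      · rintro ⟨m, b⟩ ⟨rfl, rfl⟩
        have hm : (m * g + b - (m * g' + b)) / (g - g') = m := by
          rw [div_eq_iff hg]
          ring
        simp only [hm, Prod.mk.injEq, true_and]
        ring

/-- The transversal design, with a copy of the linear space `S` on each group. -/
def filledDesign (S : Finset (Finset F)) : Finset (Finset (Option F × F)) :=
  univ.image transversalBlock ∪ (univ ×ˢ S).image fun gl => {gl.1} ×ˢ gl.2

variable {S : Finset (Finset F)}

lemma mem_filledDesign {l : Finset (Option F × F)} : l ∈ filledDesign S ↔
    (∃ c, transversalBlock c = l) ∨ ∃ g, ∃ k ∈ S, {g} ×ˢ k = l := by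
  simp [filledDesign]

lemma card_transversalBlock (c : F × F) : #(transversalBlock c) = Fintype.card F + 1 := by
  rw [transversalBlock, Finset.card_image_of_injective _ fun g g' h => congrArg Prod.fst h]
  simp

lemma fst_ne_of_mem_transversalBlock {c : F × F} {x y : Option F × F} (hx : x ∈ transversalBlock c)
    (hy : y ∈ transversalBlock c) (hxy : x ≠ y) : x.1 ≠ y.1 := by
  rw [mem_transversalBlock] at hx hy
  exact fun h => hxy (Prod.ext h (by rw [hx, hy, h]))

lemma isLinearSpace_filledDesign (hS : IsLinearSpace S) : IsLinearSpace (filledDesign S) where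
  exists_line x y hxy := by
    by_cases h : x.1 = y.1
    · obtain ⟨k, hk, hx, hy⟩ := hS.exists_line x.2 y.2 fun h' => hxy (Prod.ext h h')
      exact ⟨_, mem_filledDesign.2 (Or.inr ⟨x.1, k, hk, rfl⟩), mem_group.2 ⟨rfl, hx⟩,
        mem_group.2 ⟨h.symm, hy⟩⟩
    · obtain ⟨c, ⟨hx, hy⟩, -⟩ := existsUnique_transversalBlock h
      exact ⟨_, mem_filledDesign.2 (Or.inl ⟨c, rfl⟩), hx, hy⟩
  unique l hl m hm x y hxy hxl hyl hxm hym := by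
    rcases mem_filledDesign.1 hl with ⟨c, rfl⟩ | ⟨g, k, hk, rfl⟩ <;>
    rcases mem_filledDesign.1 hm with ⟨c', rfl⟩ | ⟨g', k', hk', rfl⟩
    · rw [(existsUnique_transversalBlock (fst_ne_of_mem_transversalBlock hxl hyl hxy)).unique
        ⟨hxl, hyl⟩ ⟨hxm, hym⟩]
    · rw [mem_group] at hxm hym
      exact absurd (hxm.1.trans hym.1.symm) (fst_ne_of_mem_transversalBlock hxl hyl hxy)
    · rw [mem_group] at hxl hyl
      exact absurd (hxl.1.trans hyl.1.symm) (fst_ne_of_mem_transversalBlock hxm hym hxy)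
    · rw [mem_group] at hxl hyl hxm hym
      obtain rfl : g = g' := hxl.1.symm.trans hxm.1
      rw [hS.unique k hk k' hk' x.2 y.2 (fun h => hxy (Prod.ext (hxl.1.trans hyl.1.symm) h)) hxl.2
        hyl.2 hxm.2 hym.2]
  two_le_card l hl := by
    rcases mem_filledDesign.1 hl with ⟨c, rfl⟩ | ⟨g, k, hk, rfl⟩
    · rw [card_transversalBlock]
      have := Fintype.card_pos (α := F)
      omega
    · simpa using hS.two_le_card k hk

lemma card_filter_lineVal (g : Option F) (y : F) :
    #{c : F × F | y = lineVal c.1 c.2 g} ≤ Fintype.card F := by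
  rw [← Finset.card_univ]
  cases g with
  | none =>
    refine Finset.card_le_card_of_injOn Prod.snd (fun _ _ => Finset.mem_coe.2 (Finset.mem_univ _))
      ?_
    rintro ⟨m, b⟩ h ⟨m', b'⟩ h' rfl
    replace h := (Finset.mem_filter.1 h).2
    replace h' := (Finset.mem_filter.1 h').2
    simp only [lineVal] at h h'
    rw [← h, ← h']
  | some g =>
    refine Finset.card_le_card_of_injOn Prod.fst (fun _ _ => Finset.mem_coe.2 (Finset.mem_univ _))
      ?_
    rintro ⟨m, b⟩ h ⟨m', b'⟩ h' rfl
    replace h := (Finset.mem_filter.1 h).2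
    replace h' := (Finset.mem_filter.1 h').2
    simp only [lineVal] at h h'
    rw [h, add_right_inj] at h'
    rw [h']

lemma card_filter_filledDesign_le {d : ℕ} (hd : ∀ x, #{l ∈ S | x ∈ l} ≤ d) (x : Option F × F) :
    #{l ∈ filledDesign S | x ∈ l} ≤ Fintype.card F + d := by
  have hsub : {l ∈ filledDesign S | x ∈ l} ⊆
      ({c : F × F | x.2 = lineVal c.1 c.2 x.1} : Finset (F × F)).image transversalBlock ∪
        {k ∈ S | x.2 ∈ k}.image fun k => {x.1} ×ˢ k := by
    intro l hl
    rw [Finset.mem_filter, mem_filledDesign] at hl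
    rw [Finset.mem_union, Finset.mem_image, Finset.mem_image]
    rcases hl with ⟨⟨c, rfl⟩ | ⟨g, k, hk, rfl⟩, hx⟩
    · exact Or.inl ⟨c, by simpa using mem_transversalBlock.1 hx, rfl⟩
    · rw [mem_group] at hx
      exact Or.inr ⟨k, Finset.mem_filter.2 ⟨hk, hx.2⟩, by rw [hx.1]⟩
  refine (Finset.card_le_card hsub).trans ((Finset.card_union_le _ _).trans (Nat.add_le_add ?_ ?_))
  · exact Finset.card_image_le.trans (card_filter_lineVal _ _)
  · exact Finset.card_image_le.trans (hd _)

lemma card_filledDesign (hS : IsLinearSpace S) :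
    #(filledDesign S) = Fintype.card F ^ 2 + (Fintype.card F + 1) * #S := by
  rw [filledDesign, Finset.card_union_of_disjoint, Finset.card_image_of_injective,
    Finset.card_image_of_injOn, Finset.card_product]
  · simp [sq]
  · rintro ⟨g, k⟩ hk ⟨g', k'⟩ - h
    have h' : ({g} ×ˢ k : Finset (Option F × F)) = {g'} ×ˢ k' := h
    have hk2 := hS.two_le_card k (by simpa using hk)
    obtain ⟨x, hx⟩ := Finset.card_pos.1 (by omega : 0 < #k)
    have hg : (g, x) ∈ ({g'} ×ˢ k' : Finset (Option F × F)) := h' ▸ mem_group.2 ⟨rfl, hx⟩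
    obtain rfl : g = g' := (mem_group.1 hg).1
    refine Prod.ext rfl (Finset.ext fun y => ?_)
    have := Finset.ext_iff.1 h' (g, y)
    simpa [mem_group] using this
  · rintro ⟨m, b⟩ ⟨m', b'⟩ h
    have h1 := Finset.ext_iff.1 h (none, m)
    have h2 := Finset.ext_iff.1 h (some 0, b)
    simp only [mem_transversalBlock, lineVal, mul_zero, zero_add, true_iff] at h1 h2
    rw [h1, h2]
  · rw [Finset.disjoint_left]
    intro l hl hl'
    obtain ⟨c, -, rfl⟩ := Finset.mem_image.1 hl
    obtain ⟨⟨g, k⟩, -, h⟩ := Finset.mem_image.1 hl'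
    have h1 : ∀ g', g' = g := by
      intro g'
      have : (g', lineVal c.1 c.2 g') ∈ ({g} ×ˢ k : Finset (Option F × F)) := by
        rw [h]
        exact mem_transversalBlock.2 rfl
      exact (mem_group.1 this).1
    have := (h1 none).trans (h1 (some 0)).symm
    simp at this

end transversal

/-- A linear space on a prime number `p` of points, with few lines through each point, refutes the
bound for suitable `q`. -/
lemma HasLinearSpace.not_boninConjecture {p d s q : ℕ} (hp : p.Prime) (h : HasLinearSpace p d s)
    (hq : 2 ≤ q) (hpd : p + d ≤ q + 1) (hs : q ^ 2 + q + 1 < p ^ 2 + (p + 1) * s) :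
    ¬ BoninConjecture.{u} q := by
  have : Fact p.Prime := ⟨hp⟩
  obtain ⟨S, hS, hd, rfl⟩ := h
  let e : Fin p ≃ ZMod p := (Fintype.equivFinOfCardEq (ZMod.card p)).symm
  have hS' := isLinearSpace_filledDesign (hS.map e)
  have hcard := card_filledDesign (hS.map e)
  have hdeg := card_filter_filledDesign_le (S := S.map (Finset.mapEmbedding e.toEmbedding).toEmbedding)
    (d := d) (fun x => by rw [card_filter_mem_map]; exact hd _)
  rw [ZMod.card, Finset.card_map] at hcard
  rw [ZMod.card] at hdeg
  refine (hS'.map Equiv.ulift.{u}.symm).not_boninConjecture hq (fun x => ?_) ?_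
  · refine le_trans (le_of_eq ?_) ((hdeg (Equiv.ulift x)).trans hpd)
    convert card_filter_mem_map (S := filledDesign _) Equiv.ulift.{u}.symm x using 4
    rfl
  · rw [Finset.card_map, hcard]
    exact hs

/-- All pairs of points as lines. -/
lemma hasLinearSpace_pairs (v : ℕ) : HasLinearSpace v (v - 1) (v.choose 2) := by
  refine ⟨univ.powersetCard 2, ⟨?_, ?_, ?_⟩, fun x => ?_, by simp⟩
  · intro x y hxy
    exact ⟨{x, y}, by simp [Finset.mem_powersetCard, Finset.card_pair hxy], by simp, by simp⟩
  · have key : ∀ l ∈ univ.powersetCard 2, ∀ x y : Fin v, x ≠ y → x ∈ l → y ∈ l → {x, y} = l := by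
      intro l hl x y hxy hx hy
      refine Finset.eq_of_subset_of_card_le
        (Finset.insert_subset hx (Finset.singleton_subset_iff.2 hy)) ?_
      rw [(Finset.mem_powersetCard.1 hl).2, Finset.card_pair hxy]
    intro l hl m hm x y hxy hxl hyl hxm hym
    rw [← key l hl x y hxy hxl hyl, key m hm x y hxy hxm hym]
  · intro l hl
    exact (Finset.mem_powersetCard.1 hl).2.ge
  · have hsub : {l ∈ (univ : Finset (Fin v)).powersetCard 2 | x ∈ l} ⊆
        (univ.erase x).image fun y => {x, y} := by
      intro l hl
      rw [Finset.mem_filter, Finset.mem_powersetCard] at hl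
      obtain ⟨y, hy, hyx⟩ := Finset.exists_mem_ne (by omega : 1 < #l) x
      refine Finset.mem_image.2 ⟨y, by simp [hyx], Finset.eq_of_subset_of_card_le
        (Finset.insert_subset hl.2 (Finset.singleton_subset_iff.2 hy)) ?_⟩
      rw [hl.1.2, Finset.card_pair hyx.symm]
    refine (Finset.card_le_card hsub).trans (Finset.card_image_le.trans ?_)
    simp

/-- The Fano plane. -/
lemma hasLinearSpace_fano : HasLinearSpace 7 3 7 := by
  refine ⟨univ.image fun i : Fin 7 => {i, i + 1, i + 3}, ⟨?_, ?_, ?_⟩, ?_, ?_⟩ <;>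
    decide +kernel

/-- Two lines with a common point `none`, and all pairs of points of different lines. -/
def twoLines (n : ℕ) : Finset (Finset (Option (Bool × Fin n))) :=
  (univ.image fun b : Bool => insert none (univ.image fun i => some (b, i))) ∪
    univ.image fun ij : Fin n × Fin n => {some (false, ij.1), some (true, ij.2)}

lemma mem_twoLines {n : ℕ} {l : Finset (Option (Bool × Fin n))} : l ∈ twoLines n ↔
    (∃ b, insert none (univ.image fun i => some (b, i)) = l) ∨
      ∃ i j, {some (false, i), some (true, j)} = l := by
  simp only [twoLines, Finset.mem_union, Finset.mem_image, Finset.mem_univ, true_and, Prod.exists]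

lemma isLinearSpace_twoLines {n : ℕ} (hn : 0 < n) : IsLinearSpace (twoLines n) where
  exists_line x y hxy := by
    simp only [mem_twoLines]
    have hlong : ∀ b, (∃ i, x = none ∨ x = some (b, i)) → (∃ i, y = none ∨ y = some (b, i)) →
        ∃ l, ((∃ b, insert none (univ.image fun i => some (b, i)) = l) ∨
          ∃ i j, {some (false, i), some (true, j)} = l) ∧ x ∈ l ∧ y ∈ l := by
      intro b hx hy
      refine ⟨_, Or.inl ⟨b, rfl⟩, ?_, ?_⟩
      · obtain ⟨i, rfl | rfl⟩ := hx <;> simp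
      · obtain ⟨i, rfl | rfl⟩ := hy <;> simp
    rcases x with _ | ⟨_ | _, i⟩ <;> rcases y with _ | ⟨_ | _, j⟩
    · exact absurd rfl hxy
    · exact hlong false ⟨j, by simp⟩ ⟨j, by simp⟩
    · exact hlong true ⟨j, by simp⟩ ⟨j, by simp⟩
    · exact hlong false ⟨i, by simp⟩ ⟨i, by simp⟩
    · exact hlong false ⟨i, by simp⟩ ⟨j, by simp⟩
    · exact ⟨_, Or.inr ⟨i, j, rfl⟩, by simp, by simp⟩
    · exact hlong true ⟨i, by simp⟩ ⟨i, by simp⟩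
    · exact ⟨_, Or.inr ⟨j, i, rfl⟩, by simp, by simp⟩
    · exact hlong true ⟨i, by simp⟩ ⟨j, by simp⟩
  unique l hl m hm x y hxy hxl hyl hxm hym := by
    rw [mem_twoLines] at hl hm
    rcases hl with ⟨b, rfl⟩ | ⟨i, j, rfl⟩ <;> rcases hm with ⟨b', rfl⟩ | ⟨i', j', rfl⟩ <;>
      simp only [Finset.mem_insert, Finset.mem_image, Finset.mem_univ, true_and,
        Finset.mem_singleton] at hxl hyl hxm hym <;> grind
  two_le_card l hl := by
    rcases mem_twoLines.1 hl with ⟨b, rfl⟩ | ⟨i, j, rfl⟩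
    · rw [Finset.card_insert_of_notMem (by simp),
        Finset.card_image_of_injective _ fun i j h => by simpa using h]
      simp
      omega
    · rw [Finset.card_pair (by simp)]

lemma card_filter_twoLines_le {n : ℕ} (hn : 0 < n) (x : Option (Bool × Fin n)) :
    #{l ∈ twoLines n | x ∈ l} ≤ n + 1 := by
  rcases x with _ | ⟨b, i⟩
  · have hsub : {l ∈ twoLines n | none ∈ l} ⊆
        univ.image fun b : Bool => insert none (univ.image fun i => some (b, i)) := by
      intro l hl
      rw [Finset.mem_filter, mem_twoLines] at hl
      rcases hl with ⟨⟨b, rfl⟩ | ⟨i, j, rfl⟩, h⟩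
      · exact Finset.mem_image_of_mem _ (Finset.mem_univ _)
      · simp at h
    refine (Finset.card_le_card hsub).trans (Finset.card_image_le.trans ?_)
    simp
    omega
  · have hsub : {l ∈ twoLines n | some (b, i) ∈ l} ⊆
        insert (insert none (univ.image fun i => some (b, i)))
          (univ.image fun j => {some (b, i), some (!b, j)}) := by
      intro l hl
      rw [Finset.mem_filter, mem_twoLines] at hl
      rw [Finset.mem_insert, Finset.mem_image]
      rcases hl with ⟨⟨b', rfl⟩ | ⟨i', j, rfl⟩, h⟩
      · simp only [Finset.mem_insert, reduceCtorEq, Finset.mem_image, Finset.mem_univ, true_and,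
          Option.some.injEq, Prod.mk.injEq, false_or] at h
        obtain ⟨_, rfl, -⟩ := h
        exact Or.inl rfl
      · right
        simp only [Finset.mem_insert, Option.some.injEq, Prod.mk.injEq,
          Finset.mem_singleton] at h
        rcases h with ⟨rfl, rfl⟩ | ⟨rfl, rfl⟩
        · exact ⟨j, Finset.mem_univ _, rfl⟩
        · exact ⟨i', Finset.mem_univ _, Finset.pair_comm _ _⟩
    refine (Finset.card_le_card hsub).trans ((Finset.card_insert_le _ _).trans ?_)
    exact Nat.add_le_add_right (Finset.card_image_le.trans (by simp)) 1

lemma card_twoLines {n : ℕ} (hn : 0 < n) : #(twoLines n) = n ^ 2 + 2 := by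
  rw [twoLines, Finset.card_union_of_disjoint, Finset.card_image_of_injective,
    Finset.card_image_of_injective]
  · simp [sq, add_comm]
  · rintro ⟨i, j⟩ ⟨i', j'⟩ h
    have h1 := Finset.ext_iff.1 h (some (false, i))
    have h2 := Finset.ext_iff.1 h (some (true, j))
    simp at h1 h2
    rw [h1, h2]
  · intro b b' h
    have h1 := Finset.ext_iff.1 h (some (b, ⟨0, hn⟩))
    simpa [eq_comm] using h1
  · rw [Finset.disjoint_left]
    intro l hl hl'
    obtain ⟨b, -, rfl⟩ := Finset.mem_image.1 hl
    obtain ⟨ij, -, h⟩ := Finset.mem_image.1 hl'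
    have := Finset.ext_iff.1 h none
    simp at this

lemma hasLinearSpace_twoLines {n : ℕ} (hn : 0 < n) :
    HasLinearSpace (2 * n + 1) (n + 1) (n ^ 2 + 2) := by
  rw [← card_twoLines hn]
  exact (isLinearSpace_twoLines hn).hasLinearSpace (by simp) (card_filter_twoLines_le hn)

/-- Two lines with a common point on each group of the transversal design. -/
lemma not_boninConjecture_of_twoLines {n q : ℕ} (hn : 0 < n) (hp : (2 * n + 1).Prime)
    (hq : 3 * n + 1 ≤ q) (hs : q ^ 2 + q + 1 < (2 * n + 1) ^ 2 + (2 * n + 2) * (n ^ 2 + 2)) :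
    ¬ BoninConjecture.{u} q :=
  (hasLinearSpace_twoLines hn).not_boninConjecture hp (by omega) (by omega) hs

/-- Primes from Bertrand's postulate serve for all large `q`. -/
lemma not_boninConjecture_of_large {q : ℕ} (hq : 103 ≤ q) : ¬ BoninConjecture.{u} q := by
  obtain ⟨p, hp, hlt, hle⟩ := Nat.exists_prime_lt_and_le_two_mul ((q - 1) / 3) (by omega)
  obtain ⟨n, hn⟩ := hp.odd_of_ne_two (by omega)
  -- From `(q - 1) / 3 < p ≤ 2 * ((q - 1) / 3)` it follows that `n` is between `q / 6` and `q / 3`.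
  have hq1 : 3 * n + 1 ≤ q := by omega
  have hq2 : q ≤ 6 * n + 3 := by omega
  have hn17 : 17 ≤ n := by omega
  subst hn
  refine not_boninConjecture_of_twoLines (by omega) hp hq1 ?_
  calc q ^ 2 + q + 1 ≤ (6 * n + 3) ^ 2 + (6 * n + 3) + 1 := by gcongr
    _ < (2 * n + 1) ^ 2 + (2 * n + 2) * (n ^ 2 + 2) := by nlinarith [mul_le_mul hn17 hn17]

/-- The cases that Bertrand's postulate leaves; neither `6` nor `15` is a prime power. -/
lemma not_boninConjecture_of_five_lt {q : ℕ} (hq : IsPrimePow q) (hq5 : 5 < q) :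
    ¬ BoninConjecture.{u} q := by
  have h6 : q ≠ 6 := by
    rintro rfl
    have := (Nat.Coprime.isPrimePow_dvd_mul (a := 2) (b := 3) (by norm_num) hq).1 (by norm_num)
    omega
  have h15 : q ≠ 15 := by
    rintro rfl
    have := (Nat.Coprime.isPrimePow_dvd_mul (a := 3) (b := 5) (by norm_num) hq).1 (by norm_num)
    omega
  -- The spaces with two long lines on `2 * n + 1` points serve for `3 * n + 1 ≤ q ≤ m`.
  have hA : ∀ n m, 0 < n → (2 * n + 1).Prime →
      m ^ 2 + m + 1 < (2 * n + 1) ^ 2 + (2 * n + 2) * (n ^ 2 + 2) → 3 * n + 1 ≤ q → q ≤ m →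
      ¬ BoninConjecture.{u} q := by
    intro n m hn hp hs h1 h2
    refine not_boninConjecture_of_twoLines hn hp h1 (lt_of_le_of_lt ?_ hs)
    gcongr
  rcases lt_or_ge q 16 with hlt | hge
  · have hcase : q = 7 ∨ q = 8 ∨ q = 9 ∨ q = 10 ∨ q = 11 ∨ q = 12 ∨ q = 13 ∨ q = 14 := by omega
    rcases hcase with rfl | rfl | rfl | rfl | rfl | rfl | rfl | rfl
    · exact hA 2 7 (by norm_num) (by norm_num) (by norm_num) (by norm_num) le_rfl
    · exact (hasLinearSpace_pairs 5).not_boninConjecture (by norm_num) (by norm_num) (by norm_num)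
        (by decide)
    · exact hasLinearSpace_fano.not_boninConjecture (by norm_num) (by norm_num) (by norm_num)
        (by norm_num)
    · exact hA 3 11 (by norm_num) (by norm_num) (by norm_num) (by norm_num) (by norm_num)
    · exact hA 3 11 (by norm_num) (by norm_num) (by norm_num) (by norm_num) (by norm_num)
    all_goals
      exact (hasLinearSpace_pairs 7).not_boninConjecture (by norm_num) (by norm_num) (by norm_num)
        (by decide)
  · rcases le_or_gt q 20 with h | h
    · exact hA 5 20 (by norm_num) (by norm_num) (by norm_num) hge h
    rcases le_or_gt q 25 with h | h
    · exact hA 6 25 (by norm_num) (by norm_num) (by norm_num) (by omega) h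
    rcases le_or_gt q 37 with h | h
    · exact hA 8 37 (by norm_num) (by norm_num) (by norm_num) (by omega) h
    rcases le_or_gt q 58 with h | h
    · exact hA 11 58 (by norm_num) (by norm_num) (by norm_num) (by omega) h
    rcases le_or_gt q 90 with h | h
    · exact hA 15 90 (by norm_num) (by norm_num) (by norm_num) (by omega) h
    rcases le_or_gt q 198 with h | h
    · exact hA 26 198 (by norm_num) (by norm_num) (by norm_num) (by omega) h
    · exact not_boninConjecture_of_large (by omega)

theorem theorem1p2 (q : ℕ) (hq : IsPrimePow q) : BoninConjecture.{u} q ↔ q ≤ 5 := by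
  constructor
  · intro h
    by_contra! h5
    exact not_boninConjecture_of_five_lt hq h5 h
  · exact boninConjecture_of_le_five hq.two_le
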